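/- **Setting.** Let $n\ge 1$ and let $M$ be a nonempty smooth $n$-dimensional manifold. An *abstract exponential map* on $M$ is a smooth map $\varphi:TM\to M$ such that for every $x\in M$ the map $\varphi_x:=\varphi(x,\cdot):T_xM\to M$ is a diffeomorphism with $\varphi_x(0)=x$ and $(d\varphi_x)_0=\mathrm{Id}$. Let $\exp$ and $\psi$ be two abstract exponential maps on $M$. A frame $(z,\mathfrak b)$ consists of $z\in M$ and a basis $\mathfrak b$ of $T_zM$, with associated linear isomorphism $L_{\mathfrak b}:T_zM\to\mathbb R^n$; it gives the global chart $n_z^{\mathfrak b}:=L_{\mathfrak b}\circ\exp_z^{-1}:M\to\mathbb R^n$, with induced global charts $n^{\mathfrak b}_{z,T}:TM\to\mathbb R^{2n}$, $n^{\mathfrak b}_{z,*}:T^*M\to\mathbb R^{2n}$. Let $\mathcal O_M$ denote smooth functions all of whose derivatives are polynomially bounded. Assume $\mathcal O_M$-bounded geometry: * for all frames, $n_z^{\mathfrak b}\circ(n_{z'}^{\mathfrak b'})^{-1}\in\mathcal O_M(\mathbb R^n,\mathbb R^n)$; * $d\mu$ is a smooth strictly positive density on $M$ such that in every frame $d\mu=(\mu_{z,\mathfrak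 b}\circ n_z^{\mathfrak b})|dx^{z,\mathfrak b}|$ with $\mu_{z,\mathfrak b}$ and $1/\mu_{z,\mathfrak b}$ in $\mathcal O_M(\mathbb R^n)$; * $\psi$ is an $\mathcal O_M$-linearization: in every frame the coordinate expressions of $(x,\xi)\mapsto\psi_x(\xi)$ and $(x,y)\mapsto\psi_x^{-1}(y)$ are in $\mathcal O_M(\mathbb R^{2n},\mathbb R^n)$. Let $d\mu_x$ be the Lebesgue measure on $T_xM$ normalized by $d\mu$, and $d\mu_x^*$ the dual Lebesgue measure on $T_x^*M$; that is, $d\mu_x=\mu_{z,\mathfrak b}(n_z^{\mathfrak b}(x))\,|dx^{z,\mathfrak b}_x|$ and $d\mu^*_x=\mu_{z,\mathfrak b}(n_z^{\mathfrak b}(x))^{-1}\,|\partial_{z,\mathfrak b,x}|$ in any frame. Let $\lambda\in[0,1]$; if $0<\lambda<1$, assume moreover $\psi_x(t\psi_x^{-1}(y))=\psi_y((1-t)\psi_y^{-1}(x))$ for all $x,y\in M$, $t\in\mathbb R$. Write $\Phi_\lambda:TM\to M\times M$, $\Phi_\lambda(x,\xi)=(\psi_x(\lambda\xi),\psi_x((\lambda-1)\xi))$,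 which is a diffeomorphism, and $\Phi_\lambda^{-1}(x,y)=(m_\lambda(x,y),\xi_\lambda(x,y))$ with $\xi_\lambda(x,y)\in T_{m_\lambda(x,y)}M$. Let $J_\lambda$ be the Jacobian of $\Phi_\lambda$ in the coordinates of a frame, and $$\mu_\lambda(x,y)=\frac{\mu_{z,\mathfrak b}(n_z^{\mathfrak b}x)\,\mu_{z,\mathfrak b}(n_z^{\mathfrak b}y)}{\mu_{z,\mathfrak b}(n_z^{\mathfrak b}m_\lambda(x,y))^2}\,|J_\lambda|\big(n^{\mathfrak b}_{z,T}(\Phi_\lambda^{-1}(x,y))\big).$$ Let $\mathcal S(M)$, resp. $\mathcal S(T^*M)$, be the space of complex functions that are Schwartz functions in all charts $n_z^{\mathfrak b}$, resp. $n_{z,*}^{\mathfrak b}$; the latter has the topology generated by all the Schwartz seminorms in these charts. For $a\in\mathcal S(T^*M)$ let $\mathfrak{Op}_\lambda(a)$ be its $\lambda$-quantization, the operator from $\mathcal S(M)$ to its antidual given by $$\langle\mathfrak{Op}_\lambda(a)v,u\rangle=\int_M d\mu(x)\int_{T_x^*M}d\mu_x^*(\theta)\;a(x,\theta)\,\overline{\mathcal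 F\big((u\otimes\bar v)\circ\Phi_\lambda\big)(x,\theta)},\qquad \mathcal F(f)(x,\theta)=\int_{T_xM}e^{-2\pi i\langle\theta,\xi\rangle}f(x,\xi)\,d\mu_x(\xi),$$ where $(u\otimes\bar v)(x,y)=u(x)\overline{v(y)}$ and a function $w\in\mathcal S(M)$ is identified with the functional $u\mapsto\int_M w\bar u\,d\mu$. **Proposition 3.11.** $\mathcal S(T^*M)$ is a Fréchet space. For $a,b\in\mathcal S(T^*M)$ there is exactly one $a\circ_\lambda b\in\mathcal S(T^*M)$ with $\mathfrak{Op}_\lambda(a\circ_\lambda b)=\mathfrak{Op}_\lambda(a)\,\mathfrak{Op}_\lambda(b)$ (where $\mathfrak{Op}_\lambda(b)$ maps $\mathcal S(M)$ into itself). With the product $\circ_\lambda$, $\mathcal S(T^*M)$ is a Fréchet algebra ($\circ_\lambda$ is bilinear, associative and jointly continuous) which is noncommutative and has no unit. Moreover, for $a,b\in\mathcal S(T^*M)$ and $(x,\eta)\in T^*M$, $$a\circ_\lambda b(x,\eta)=\int_{T_xM\times M}d\mu_x(\xi)\,d\mu(y)\int_{V^\lambda_{x,\xi,y}}d\mu^*_{x,\xi,y}(\theta,\theta')\;g^\lambda_{x,\xi,y}\,e^{2\pi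 i\,\omega^\lambda_{x,\xi,y}(\eta,\theta,\theta')}\,a(y^\lambda_{x,\xi},\theta)\,b(y^{1-\lambda}_{x,-\xi},\theta'),$$ where the inner integral converges absolutely for all $(\xi,y)$ and is an integrable function of $(\xi,y)$, and where $y^\lambda_{x,\xi}:=m_\lambda(\psi_x(\lambda\xi),y)$, $\bar y^\lambda_{x,\xi}:=\xi_\lambda(\psi_x(\lambda\xi),y)$, $$V^\lambda_{x,\xi,y}:=T^*_{y^\lambda_{x,\xi}}M\times T^*_{y^{1-\lambda}_{x,-\xi}}M,\qquad d\mu^*_{x,\xi,y}(\theta,\theta'):=d\mu^*_{y^\lambda_{x,\xi}}(\theta)\,d\mu^*_{y^{1-\lambda}_{x,-\xi}}(\theta'),$$ $$g^\lambda_{x,\xi,y}:=\frac{\mu_\lambda(\psi_x(\lambda\xi),\psi_x((\lambda-1)\xi))}{\mu_\lambda(\psi_x(\lambda\xi),y)\,\mu_\lambda(y,\psi_x((\lambda-1)\xi))},\qquad \omega^\lambda_{x,\xi,y}(\eta,\theta,\theta'):=\langle\theta,\bar y^\lambda_{x,\xi}\rangle-\langle\theta',\bar y^{1-\lambda}_{x,-\xi}\rangle-\langle\eta,\xi\rangle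 .$$ -/

import Mathlib

open MeasureTheory
open scoped Manifold ContDiff SchwartzMap

noncomputable section

namespace ExpMan

/-- The coordinate space `ℝⁿ`. -/
abbrev Coord (n : ℕ) := EuclideanSpace ℝ (Fin n)

/-- The tangent space `T_x M`. -/
abbrev TanSpace (n : ℕ) {M : Type*} [TopologicalSpace M] [ChartedSpace (Coord n) M] (x : M) :=
  TangentSpace 𝓘(ℝ, Coord n) x

/-- The cotangent space `T_x^* M`. -/
abbrev CotSpace (n : ℕ) {M : Type*} [TopologicalSpace M] [ChartedSpace (Coord n) M] (x : M) :=
  TanSpace n x →L[ℝ] ℝ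

/-- The tangent bundle `TM`. -/
abbrev TanBundle (n : ℕ) (M : Type*) [TopologicalSpace M] [ChartedSpace (Coord n) M] :=
  TangentBundle 𝓘(ℝ, Coord n) M

/-- The cotangent bundle `T^*M` (pairs of a point and a covector at that point). -/
abbrev CotBundle (n : ℕ) (M : Type*) [TopologicalSpace M] [ChartedSpace (Coord n) M] :=
  Bundle.TotalSpace (Coord n →L[ℝ] ℝ) (fun x : M => CotSpace n x)

instance instMeasurableSpaceTan {n : ℕ} {M : Type*} [TopologicalSpace M]
    [ChartedSpace (Coord n) M] (x : M) : MeasurableSpace (TanSpace n x) := borel _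

instance instMeasurableSpaceCot {n : ℕ} {M : Type*} [TopologicalSpace M]
    [ChartedSpace (Coord n) M] (x : M) : MeasurableSpace (CotSpace n x) := borel _

/-- An abstract exponential map on `M`: a smooth map `TM → M` such that every `exp_x : T_x M → M`
is a global diffeomorphism, `exp_x 0 = x` and `(d exp_x)_0 = Id`.
The field `log x` is the inverse of `exp_x` (so it is determined by `toFun`). -/
structure AbstractExp (n : ℕ) (M : Type*) [TopologicalSpace M] [ChartedSpace (Coord n) M]
    [IsManifold 𝓘(ℝ, Coord n) ∞ M] where
  toFun : TanBundle n M → M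
  log : (x : M) → M → TanSpace n x
  smooth : ContMDiff (𝓘(ℝ, Coord n).tangent) 𝓘(ℝ, Coord n) ∞ toFun
  smooth_exp : ∀ x : M, ContMDiff 𝓘(ℝ, Coord n) 𝓘(ℝ, Coord n) ∞
    (fun v : Coord n => toFun ⟨x, v⟩)
  smooth_log : ∀ x : M, ContMDiff (M' := Coord n) 𝓘(ℝ, Coord n) 𝓘(ℝ, Coord n) ∞ (log x)
  log_exp : ∀ (x : M) (v : TanSpace n x), log x (toFun ⟨x, v⟩) = v
  exp_log : ∀ x y : M, toFun ⟨x, log x y⟩ = y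
  exp_zero : ∀ x : M, toFun ⟨x, 0⟩ = x
  deriv_zero : ∀ x : M, HasMFDerivAt 𝓘(ℝ, Coord n) 𝓘(ℝ, Coord n)
    (fun v : Coord n => toFun ⟨x, v⟩) 0 (ContinuousLinearMap.id ℝ (Coord n))

/-- A normal frame `(z, 𝔟)`: a point `z` and a linear basis `𝔟` of `T_z M`, the latter given by the
associated linear isomorphism `L_𝔟 : T_z M → ℝⁿ`. -/
structure Frame (n : ℕ) (M : Type*) [TopologicalSpace M] [ChartedSpace (Coord n) M] where
  base : M
  coord : TanSpace n base ≃L[ℝ] Coord n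

section Geometry

variable {n : ℕ} {M : Type*} [TopologicalSpace M] [ChartedSpace (Coord n) M]
  [IsManifold 𝓘(ℝ, Coord n) ∞ M]

/-- The normal chart `n_z^𝔟 = L_𝔟 ∘ exp_z⁻¹ : M → ℝⁿ`. -/
def AbstractExp.chart (e : AbstractExp n M) (F : Frame n M) :
    Diffeomorph 𝓘(ℝ, Coord n) 𝓘(ℝ, Coord n) M (Coord n) ∞ where
  toFun y := F.coord (e.log F.base y)
  invFun p := e.toFun ⟨F.base, F.coord.symm p⟩
  left_inv y := by simp [e.exp_log]
  right_inv p := by simp [e.log_exp]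
  contMDiff_toFun :=
    (ContinuousLinearEquiv.contDiff (E := Coord n) (F := Coord n) (𝕜 := ℝ)
      F.coord).contMDiff.comp (e.smooth_log F.base)
  contMDiff_invFun :=
    (e.smooth_exp F.base).comp
      (ContinuousLinearEquiv.contDiff (E := Coord n) (F := Coord n) (𝕜 := ℝ)
        F.coord.symm).contMDiff

/-- `M_{z,x}^𝔟 = (d n_z^𝔟)_x : T_x M → ℝⁿ`. -/
def AbstractExp.tanCoord (e : AbstractExp n M) (F : Frame n M) (x : M) :
    TanSpace n x ≃L[ℝ] Coord n :=
  (e.chart F).mfderivToContinuousLinearEquiv (by simp) x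

/-- The inverse of `θ ↦ (components of θ in the basis dx^{i,z,𝔟}_x)`, that is
`ϑ ↦ ∑ ϑ_i dx^{i,z,𝔟}_x = ⟨ϑ, M_{z,x}^𝔟 (·)⟩`, from `ℝⁿ` to `T_x^* M`. -/
def AbstractExp.cotCoordInv (e : AbstractExp n M) (F : Frame n M) (x : M) (ϑ : Coord n) :
    CotSpace n x :=
  (innerSL ℝ ϑ).comp (e.tanCoord F x : TanSpace n x →L[ℝ] Coord n)

/-- The chart `n_{z,T}^𝔟 : TM → ℝ²ⁿ`. -/
def AbstractExp.tanChart (e : AbstractExp n M) (F : Frame n M) (w : TanBundle n M) :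
    Coord n × Coord n :=
  (e.chart F w.1, e.tanCoord F w.1 w.2)

/-- The inverse of the chart `n_{z,T}^𝔟`. -/
def AbstractExp.tanChartInv (e : AbstractExp n M) (F : Frame n M) (q : Coord n × Coord n) :
    TanBundle n M :=
  ⟨(e.chart F).symm q.1, (e.tanCoord F ((e.chart F).symm q.1)).symm q.2⟩

/-- The inverse of the chart `n_{z,*}^𝔟 : T^*M → ℝ²ⁿ`. -/
def AbstractExp.cotChartInv (e : AbstractExp n M) (F : Frame n M) (q : Coord n × Coord n) :
    CotBundle n M :=
  ⟨(e.chart F).symm q.1, e.cotCoordInv F ((e.chart F).symm q.1) q.2⟩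

/-! ### Densities and bounded geometry -/

variable (n M) in
/-- A (real) density on `M`: at each point `x` a function of `n` tangent vectors at `x` that is
multiplied by `|det A|` when a linear map `A` is applied to the vectors. -/
structure Density where
  toFun : (x : M) → (Fin n → TanSpace n x) → ℝ
  map_linear : ∀ (x : M) (A : TanSpace n x →ₗ[ℝ] TanSpace n x) (v : Fin n → TanSpace n x),
    toFun x (fun i => A (v i)) = |LinearMap.det A| * toFun x v

/-- The function `μ_{z,𝔟}` on `ℝⁿ` with `dμ = (μ_{z,𝔟} ∘ n_z^𝔟) |dx^{z,𝔟}|`: the value of the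
density on the coordinate vector fields of the chart `n_z^𝔟`. -/
def Density.coord (μ : Density n M) (e : AbstractExp n M) (F : Frame n M) (p : Coord n) : ℝ :=
  μ.toFun ((e.chart F).symm p)
    (fun i => (e.tanCoord F ((e.chart F).symm p)).symm (EuclideanSpace.single i 1))

/-- `(M, exp)` has `𝒪_M`-bounded geometry: all the normal coordinate changes are smooth with
polynomially bounded derivatives. -/
def OMBounded (e : AbstractExp n M) : Prop :=
  ∀ F F' : Frame n M,
    Function.HasTemperateGrowth (fun p : Coord n => e.chart F ((e.chart F').symm p))

/-- `dμ` is a smooth strictly positive density which is an `𝒪_M^×`-density. -/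
def IsOMDensity (e : AbstractExp n M) (μ : Density n M) : Prop :=
  ∀ F : Frame n M, (∀ p, 0 < μ.coord e F p) ∧
    Function.HasTemperateGrowth (μ.coord e F) ∧
    Function.HasTemperateGrowth (fun p => (μ.coord e F p)⁻¹)

/-- `ψ` is an `𝒪_M`-linearization (for the trivial line bundle): in every normal frame of `exp`
the maps `(x, ζ) ↦ ψ_x(ζ)` and `(x, y) ↦ ψ_x⁻¹(y)` are smooth with polynomially bounded
derivatives. -/
def IsOMLinearization (e ψ : AbstractExp n M) : Prop :=
  ∀ F : Frame n M,
    Function.HasTemperateGrowth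
      (fun q : Coord n × Coord n => e.chart F (ψ.toFun (e.tanChartInv F q))) ∧
    Function.HasTemperateGrowth
      (fun q : Coord n × Coord n =>
        e.tanCoord F ((e.chart F).symm q.1)
          (ψ.log ((e.chart F).symm q.1) ((e.chart F).symm q.2)))

/-- The hypothesis `(H_ψ)`: `ψ_x(t ψ_x⁻¹(y)) = ψ_y((1 - t) ψ_y⁻¹(x))`. -/
def HypothesisHPsi (ψ : AbstractExp n M) : Prop :=
  ∀ (x y : M) (t : ℝ), ψ.toFun ⟨x, t • ψ.log x y⟩ = ψ.toFun ⟨y, (1 - t) • ψ.log y x⟩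

/-! ### The diffeomorphism `Φ_λ : TM → M × M` -/

/-- `Φ_λ(x, ξ) = (ψ_x(λ ξ), ψ_x(-(1 - λ) ξ))`. -/
def Phi (ψ : AbstractExp n M) (l : ℝ) (w : TanBundle n M) : M × M :=
  (ψ.toFun ⟨w.1, l • w.2⟩, ψ.toFun ⟨w.1, (-(1 - l)) • w.2⟩)

open Classical in
/-- `Φ_λ⁻¹(x, y) = (m_λ(x, y), ξ_λ(x, y))`, where `m_λ(x, y) = ψ_x(λ ψ_x⁻¹(y))` and
`ξ_λ(x, y) = (1/λ) ψ_{m_λ(x, y)}⁻¹(x)` for `λ ≠ 0`, while `m_0(x, y) = x` and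
`ξ_0(x, y) = -ψ_x⁻¹(y)`. -/
def PhiInv (ψ : AbstractExp n M) (l : ℝ) (x y : M) : TanBundle n M :=
  if l = 0 then ⟨x, -ψ.log x y⟩
  else ⟨ψ.toFun ⟨x, l • ψ.log x y⟩, l⁻¹ • ψ.log (ψ.toFun ⟨x, l • ψ.log x y⟩) x⟩

/-- `Φ_λ` read in the frame `(z, 𝔟)`, as a map of `ℝ²ⁿ`. -/
def PhiCoord (e ψ : AbstractExp n M) (F : Frame n M) (l : ℝ) (q : Coord n × Coord n) :
    Coord n × Coord n :=
  (e.chart F (Phi ψ l (e.tanChartInv F q)).1, e.chart F (Phi ψ l (e.tanChartInv F q)).2)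

/-- The function `μ_λ` on `M × M`, computed in the frame `(z, 𝔟)`:
`μ_λ(x, y) = μ(x) μ(y) / μ(m_λ(x, y))² · |J_λ|(Φ_λ⁻¹(x, y))`, `J_λ` the Jacobian of `Φ_λ`. -/
def muLambda (e ψ : AbstractExp n M) (μ : Density n M) (F : Frame n M) (l : ℝ) (x y : M) : ℝ :=
  μ.coord e F (e.chart F x) * μ.coord e F (e.chart F y) /
      μ.coord e F (e.chart F (PhiInv ψ l x y).1) ^ 2 *
    |(fderiv ℝ (PhiCoord e ψ F l) (e.tanChart F (PhiInv ψ l x y))).det|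

/-! ### The measures associated to a density, computed in a frame -/

/-- The measure `dμ` on `M`. -/
def Density.vol [MeasurableSpace M] (μ : Density n M) (e : AbstractExp n M) (F : Frame n M) :
    Measure M :=
  ((volume : Measure (Coord n)).withDensity (fun p => ENNReal.ofReal (μ.coord e F p))).map
    (e.chart F).symm

/-- The measure `dμ_x = μ_{z,𝔟}(n_z^𝔟(x)) |dx_x^{z,𝔟}|` on `T_x M`. -/
def Density.tan (μ : Density n M) (e : AbstractExp n M) (F : Frame n M) (x : M) :
    Measure (TanSpace n x) :=
  ENNReal.ofReal (μ.coord e F (e.chart F x)) •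
    (volume : Measure (Coord n)).map (e.tanCoord F x).symm

/-- The dual measure `dμ_x^* = μ_{z,𝔟}(n_z^𝔟(x))⁻¹ |∂_{z,𝔟,x}|` on `T_x^* M`. -/
def Density.cot (μ : Density n M) (e : AbstractExp n M) (F : Frame n M) (x : M) :
    Measure (CotSpace n x) :=
  ENNReal.ofReal (μ.coord e F (e.chart F x))⁻¹ •
    (volume : Measure (Coord n)).map (e.cotCoordInv F x)

/-! ### Schwartz spaces -/

/-- `u ∈ 𝒮(M)`: in every normal chart `u` is a Schwartz function on `ℝⁿ`. -/
def IsSchwartz (e : AbstractExp n M) (u : M → ℂ) : Prop :=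
  ∀ F : Frame n M, ∃ f : 𝓢(Coord n, ℂ), ∀ p, f p = u ((e.chart F).symm p)

/-- The functions on `T^*M` which in every chart `n_{z,*}^𝔟` are Schwartz functions on `ℝ²ⁿ`. -/
def schwartzCotSubmodule (e : AbstractExp n M) : Submodule ℂ (CotBundle n M → ℂ) where
  carrier := {a | ∀ F : Frame n M, ∃ f : 𝓢(Coord n × Coord n, ℂ), ∀ q, f q = a (e.cotChartInv F q)}
  add_mem' := by
    intro a b ha hb F
    obtain ⟨f, hf⟩ := ha F
    obtain ⟨g, hg⟩ := hb F
    exact ⟨f + g, fun q => by simp [hf, hg]⟩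
  zero_mem' := fun F => ⟨0, fun q => by simp⟩
  smul_mem' := by
    intro c a ha F
    obtain ⟨f, hf⟩ := ha F
    exact ⟨c • f, fun q => by simp [hf]⟩

/-- The Schwartz space `𝒮(T^*M)`. -/
def SchwartzCot (e : AbstractExp n M) : Type _ := ↥(schwartzCotSubmodule e)

instance (e : AbstractExp n M) : AddCommGroup (SchwartzCot e) :=
  inferInstanceAs (AddCommGroup ↥(schwartzCotSubmodule e))

instance (e : AbstractExp n M) : Module ℂ (SchwartzCot e) :=
  inferInstanceAs (Module ℂ ↥(schwartzCotSubmodule e))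

instance (e : AbstractExp n M) : CoeFun (SchwartzCot e) (fun _ => CotBundle n M → ℂ) :=
  ⟨fun a => Subtype.val (p := fun a => a ∈ schwartzCotSubmodule e) a⟩

/-- The map `T_{z,𝔟,*} : 𝒮(T^*M) → 𝒮(ℝ²ⁿ)`, `a ↦ a ∘ (n_{z,*}^𝔟)⁻¹`. -/
def SchwartzCot.toCoord {e : AbstractExp n M} (F : Frame n M) (a : SchwartzCot e) :
    𝓢(Coord n × Coord n, ℂ) :=
  Classical.choose
    (Subtype.property (p := fun a => a ∈ schwartzCotSubmodule e) a F)

/-- The topology (and uniform structure) of `𝒮(T^*M)`: the one generated by all the seminorms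
`sup ⟨x, θ⟩_{z,𝔟}^p |∂_{z,𝔟}^ν a|`, i.e. the coarsest one for which all the maps `T_{z,𝔟,*}` into
the Schwartz space of `ℝ²ⁿ` are (uniformly) continuous. -/
instance (e : AbstractExp n M) : UniformSpace (SchwartzCot e) :=
  ⨅ F : Frame n M, UniformSpace.comap (SchwartzCot.toCoord F) inferInstance

/-! ### Fourier transform, quantization and the product -/

/-- The Fourier transform `ℱ(a)(x, θ) = ∫_{T_x M} e^{-2πi⟨θ, ξ⟩} a(x, ξ) dμ_x(ξ)`. -/
def fourier (e : AbstractExp n M) (μ : Density n M) (F : Frame n M) (a : TanBundle n M → ℂ)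
    (w : CotBundle n M) : ℂ :=
  ∫ ξ : TanSpace n w.1,
    Complex.exp (-(2 * Real.pi * Complex.I * (w.2 ξ : ℝ))) * a ⟨w.1, ξ⟩ ∂(μ.tan e F w.1)

/-- The pairing `⟨w, u⟩ = ∫_M w ū dμ`. -/
def pairing [MeasurableSpace M] (e : AbstractExp n M) (μ : Density n M) (F : Frame n M)
    (w u : M → ℂ) : ℂ :=
  ∫ x, w x * starRingEnd ℂ (u x) ∂(μ.vol e F)

/-- The `λ`-quantization of `a`, as a continuous operator from `𝒮(M)` to its antidual: the number
`⟨𝔒𝔭_λ(a) v, u⟩`. The symbol map is `σ_λ = ℱ ∘ (Γ_λ⁻¹)^*` on distributions (with `ℱ` the adjoint of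
the inverse Fourier transform and `Γ_λ K = K ∘ Φ_λ`), so that its inverse sends `a`, regarded as the
distribution `w ↦ ∫_{T^*M} a w̄ dμ_x^*(θ) dμ(x)`, to the distributional kernel
`K ↦ ∫_{T^*M} a · conj (ℱ (K ∘ Φ_λ)) dμ_x^*(θ) dμ(x)` on `M × M`, and the operator with this
kernel satisfies: `⟨A v, u⟩` is the value of the kernel at `(x, y) ↦ u(x) conj (v(y))`. -/
def opPairing [MeasurableSpace M] (e ψ : AbstractExp n M) (μ : Density n M) (F : Frame n M) (l : ℝ)
    (a : CotBundle n M → ℂ) (v u : M → ℂ) : ℂ :=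
  ∫ x : M, ∫ θ : CotSpace n x,
    a ⟨x, θ⟩ * starRingEnd ℂ
      (fourier e μ F (fun w => u (Phi ψ l w).1 * starRingEnd ℂ (v (Phi ψ l w).2)) ⟨x, θ⟩)
    ∂(μ.cot e F x) ∂(μ.vol e F)

/-- `c = a ∘_λ b`: the operator `𝔒𝔭_λ(c)` is the composition `𝔒𝔭_λ(a) 𝔒𝔭_λ(b)`. That is, for all
`v ∈ 𝒮(M)` the distribution `𝔒𝔭_λ(b) v` is a Schwartz function `w`, and
`𝔒𝔭_λ(c) v = 𝔒𝔭_λ(a) w`. -/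
def IsLambdaProduct [MeasurableSpace M] (e ψ : AbstractExp n M) (μ : Density n M) (F : Frame n M)
    (l : ℝ) (a b c : CotBundle n M → ℂ) : Prop :=
  ∀ v : M → ℂ, IsSchwartz e v → ∃ w : M → ℂ, IsSchwartz e w ∧
    (∀ u : M → ℂ, IsSchwartz e u → opPairing e ψ μ F l b v u = pairing e μ F w u) ∧
    (∀ u : M → ℂ, IsSchwartz e u → opPairing e ψ μ F l c v u = opPairing e ψ μ F l a w u)

/-- `(m_λ(ψ_x(λξ), y), ξ_λ(ψ_x(λξ), y)) ∈ TM`: the point `y^λ_{x,ξ}` together with the tangent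
vector `ȳ^λ_{x,ξ}` at it. -/
def yPoint (ψ : AbstractExp n M) (l : ℝ) (x : M) (ξ : TanSpace n x) (y : M) : TanBundle n M :=
  PhiInv ψ l (ψ.toFun ⟨x, l • ξ⟩) y

/-- The factor `g^λ_{x,ξ,y}`. -/
def gFactor (e ψ : AbstractExp n M) (μ : Density n M) (F : Frame n M) (l : ℝ)
    (x : M) (ξ : TanSpace n x) (y : M) : ℝ :=
  muLambda e ψ μ F l (ψ.toFun ⟨x, l • ξ⟩) (ψ.toFun ⟨x, (l - 1) • ξ⟩) /
    (muLambda e ψ μ F l (ψ.toFun ⟨x, l • ξ⟩) y *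
      muLambda e ψ μ F l y (ψ.toFun ⟨x, (l - 1) • ξ⟩))

/-- The phase `ω^λ_{x,ξ,y}(η, θ, θ') = ⟨θ, ȳ^λ_{x,ξ}⟩ - ⟨θ', ȳ^{1-λ}_{x,-ξ}⟩ - ⟨η, ξ⟩`. -/
def phase (ψ : AbstractExp n M) (l : ℝ) (x : M) (η : CotSpace n x) (ξ : TanSpace n x) (y : M)
    (θ : CotSpace n (yPoint ψ l x ξ y).1) (θ' : CotSpace n (yPoint ψ (1 - l) x (-ξ) y).1) : ℝ :=
  θ (yPoint ψ l x ξ y).2 - θ' (yPoint ψ (1 - l) x (-ξ) y).2 - η ξ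

/-- The integrand of the product formula, as a function of `(θ, θ')` in the product of cotangent
fibers `V^λ_{x,ξ,y}`. -/
def fiberIntegrand (e ψ : AbstractExp n M) (μ : Density n M) (F : Frame n M) (l : ℝ)
    (a b : CotBundle n M → ℂ) (x : M) (η : CotSpace n x) (ξ : TanSpace n x) (y : M)
    (t : CotSpace n (yPoint ψ l x ξ y).1 × CotSpace n (yPoint ψ (1 - l) x (-ξ) y).1) : ℂ :=
  (gFactor e ψ μ F l x ξ y : ℂ) *
    Complex.exp (2 * Real.pi * Complex.I * (phase ψ l x η ξ y t.1 t.2 : ℝ)) *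
    a ⟨(yPoint ψ l x ξ y).1, t.1⟩ * b ⟨(yPoint ψ (1 - l) x (-ξ) y).1, t.2⟩

/-- The measure `dμ^*_{x,ξ,y}` on `V^λ_{x,ξ,y}`. -/
def fiberMeasure (e ψ : AbstractExp n M) (μ : Density n M) (F : Frame n M) (l : ℝ)
    (x : M) (ξ : TanSpace n x) (y : M) :
    Measure (CotSpace n (yPoint ψ l x ξ y).1 × CotSpace n (yPoint ψ (1 - l) x (-ξ) y).1) :=
  (μ.cot e F (yPoint ψ l x ξ y).1).prod (μ.cot e F (yPoint ψ (1 - l) x (-ξ) y).1)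

end Geometry

/-- A Fréchet space: a complete Hausdorff topological vector space whose topology is defined by a
countable family of seminorms. -/
structure IsFrechetSpace (V : Type*) [AddCommGroup V] [Module ℂ V] [UniformSpace V] : Prop where
  isUniformAddGroup : IsUniformAddGroup V
  seminorms : ∃ q : ℕ → Seminorm ℂ V, WithSeminorms q
  t2 : T2Space V
  complete : CompleteSpace V

end ExpMan

end

open ExpMan

/-!
The proof passes to the coordinates of a normal frame, where the quantization becomes an explicit
integral operator with a Schwartz kernel.

In a frame `F` let `m` be the coordinate expression of the density, `Φ` that of `Φ_λ` (a
diffeomorphism of `ℝ²ⁿ` which, like its inverse, has temperate growth: `quantData`), and let `𝓕₂` be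
the Fourier transform in the second variable. Put
`W(x, ζ) = m(x) / (|J_Φ(x, ζ)| m(Φ₁(x, ζ)) m(Φ₂(x, ζ)))`. Parseval in each cotangent fiber and the
change of variables `Φ` show that `𝔒𝔭_λ(a)` is the integral operator, with respect to `dμ`, whose
kernel `K_A` is determined by `K_A ∘ Φ = W · 𝓕₂⁻¹ A`, where `A` is the symbol `a` read in the chart
of `T^*M` (`QuantData.form_eq`). The map `A ↦ K_A` is an isomorphism of `𝒮(ℝ²ⁿ)`
(`QuantData.toKernel`), because `W`, `1/W`, `Φ` and `Φ⁻¹` have temperate growth and `𝓕₂` is an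
isomorphism. So the product `∘_λ` is the composition of Schwartz kernels,
`(K₁ ∘ K₂)(x, z) = ∫ K₁(x, y) K₂(y, z) m(y) dy`, transported to symbols (`QuantData.mul`).

All the algebraic assertions can now be read off from kernels. A kernel is determined by its action
on Schwartz functions (`kernelAct_injective`), which gives uniqueness and associativity of the
product. Kernels of rank one do not commute in general (`exists_kernelComp_ne`), and a unit would be a kernel
representing the delta function (`not_exists_kernelComp_left_unit`). Joint continuity comes from a
Leibniz estimate for products `(f ∘ p) · (g ∘ q)` (`continuous_pullMul`).

The topology of `𝒮(T^*M)` is that of `𝒮(ℝ²ⁿ)` in any single frame, since the changes of frame in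
`T^*M` have temperate growth (`isUniformInducing_coordEquiv`); hence it is a Fréchet space. The
measures `dμ`, `dμ_x`, `dμ_x^*` do not depend on the frame (`Density.vol_eq`, `Density.tan_eq`,
`Density.cot_eq`), so neither does the product.

For the integral formula, the integral over a cotangent fiber is a Fourier inversion integral, and
`μ_λ(x, y)` is the inverse of `m · W` at `Φ_λ⁻¹(x, y)` (`muLambda_eq`). With the relation
`Φ_{1-λ}⁻¹(y, x) = (m_λ(x, y), -ξ_λ(x, y))` (`phiInv_one_sub`) the inner integral becomes `K_A K_B`
times explicit weights, and the outer one is `𝓕₂` applied to `W⁻¹ · (K_A ∘ K_B) ∘ Φ`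
(`integral_fiberIntegrand`, `QuantData.mul_eq_integral`).
-/

noncomputable section

namespace ExpMan

/-! ### Functions of temperate growth -/

section Temperate

variable {D E F G : Type*} [NormedAddCommGroup D] [NormedSpace ℝ D] [NormedAddCommGroup E]
  [NormedSpace ℝ E] [NormedAddCommGroup F] [NormedSpace ℝ F]
  [NormedAddCommGroup G] [NormedSpace ℝ G]

theorem hasTemperateGrowth_fst : Function.HasTemperateGrowth (Prod.fst : E × F → E) :=
  (ContinuousLinearMap.fst ℝ E F).hasTemperateGrowth

theorem hasTemperateGrowth_snd : Function.HasTemperateGrowth (Prod.snd : E × F → F) :=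
  (ContinuousLinearMap.snd ℝ E F).hasTemperateGrowth

theorem _root_.Function.HasTemperateGrowth.prodMk {f : D → E} {g : D → F}
    (hf : f.HasTemperateGrowth) (hg : g.HasTemperateGrowth) :
    Function.HasTemperateGrowth (fun x => (f x, g x)) := by
  have h := ((ContinuousLinearMap.inl ℝ E F).hasTemperateGrowth.comp hf).add
    ((ContinuousLinearMap.inr ℝ E F).hasTemperateGrowth.comp hg)
  convert h using 1
  ext x <;> simp

theorem _root_.Function.HasTemperateGrowth.fst {f : D → E × F} (hf : f.HasTemperateGrowth) :
    Function.HasTemperateGrowth (fun x => (f x).1) :=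
  hasTemperateGrowth_fst.comp hf

theorem _root_.Function.HasTemperateGrowth.snd {f : D → E × F} (hf : f.HasTemperateGrowth) :
    Function.HasTemperateGrowth (fun x => (f x).2) :=
  hasTemperateGrowth_snd.comp hf

theorem _root_.Function.HasTemperateGrowth.fderiv {f : E → F} (hf : f.HasTemperateGrowth) :
    Function.HasTemperateGrowth (fderiv ℝ f) := by
  refine ⟨hf.1.fderiv_right (by simp), fun n => ?_⟩
  obtain ⟨k, C, h⟩ := hf.2 (n + 1)
  exact ⟨k, C, fun x => by simpa only [norm_iteratedFDeriv_fderiv] using h x⟩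

theorem _root_.Function.HasTemperateGrowth.clm_apply {f : D → E →L[ℝ] F} {g : D → E}
    (hf : f.HasTemperateGrowth) (hg : g.HasTemperateGrowth) :
    Function.HasTemperateGrowth (fun x => f x (g x)) :=
  (ContinuousLinearMap.id ℝ (E →L[ℝ] F)).bilinear_hasTemperateGrowth hf hg

theorem _root_.Function.HasTemperateGrowth.prod {ι : Type*} {f : ι → D → ℝ} {s : Finset ι}
    (hf : ∀ i ∈ s, (f i).HasTemperateGrowth) :
    Function.HasTemperateGrowth (fun x => ∏ i ∈ s, f i x) := by
  classical
  induction s using Finset.induction_on with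
  | empty => simp
  | insert a s has ih =>
    have h := (hf a (by simp)).mul (ih fun i hi => hf i (by simp [hi]))
    simpa [Finset.prod_insert has] using! h

/-- The determinant is a polynomial in the matrix coefficients. -/
theorem _root_.Function.HasTemperateGrowth.det [FiniteDimensional ℝ E] {f : D → E →L[ℝ] E}
    (hf : f.HasTemperateGrowth) : Function.HasTemperateGrowth (fun x => (f x).det) := by
  classical
  let b := Module.finBasis ℝ E
  have key : (fun x => (f x).det) =
      fun x => ∑ σ : Equiv.Perm (Fin (Module.finrank ℝ E)), ((Equiv.Perm.sign σ : ℤ) : ℝ) *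
        ∏ i, (LinearMap.toContinuousLinearMap (b.coord (σ i))) (f x (b i)) := by
    funext x
    rw [ContinuousLinearMap.det, ← LinearMap.det_toMatrix b, Matrix.det_apply']
    simp [LinearMap.toMatrix_apply]
  rw [key]
  refine Function.HasTemperateGrowth.sum fun σ _ => (Function.HasTemperateGrowth.const _).mul
    (Function.HasTemperateGrowth.prod fun i _ => ?_)
  exact (ContinuousLinearMap.hasTemperateGrowth _).comp
    (hf.clm_apply (Function.HasTemperateGrowth.const _))

/-- A nowhere vanishing function on a vector space has constant sign, so its absolute value is as
smooth as the function. -/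
theorem _root_.Function.HasTemperateGrowth.abs {f : E → ℝ} (hf : f.HasTemperateGrowth)
    (h0 : ∀ x, f x ≠ 0) : Function.HasTemperateGrowth (fun x => |f x|) := by
  have hc : Continuous f := hf.1.continuous
  by_cases hpos : 0 < f 0
  · have : ∀ x, 0 < f x := by
      intro x
      by_contra hx
      obtain ⟨z, hz⟩ := mem_range_of_exists_le_of_exists_ge hc ⟨x, not_lt.1 hx⟩ ⟨0, hpos.le⟩
      exact h0 z hz
    simpa only [abs_of_pos (this _)] using hf
  · have : ∀ x, f x < 0 := by
      intro x
      by_contra hx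
      obtain ⟨z, hz⟩ := mem_range_of_exists_le_of_exists_ge hc ⟨0, not_lt.1 hpos⟩ ⟨x, not_lt.1 hx⟩
      exact h0 z hz
    simpa only [abs_of_neg (this _)] using! hf.neg

theorem _root_.Function.HasTemperateGrowth.exists_norm_le {f : E → F}
    (hf : f.HasTemperateGrowth) : ∃ (k : ℕ) (C : ℝ), ∀ x, ‖f x‖ ≤ C * (1 + ‖x‖) ^ k := by
  simpa using hf.2 0

/-- Pulling back Schwartz functions along a map of temperate growth which has a left inverse of
temperate growth. -/
def schwartzComp (V : Type*) [NormedAddCommGroup V] [NormedSpace ℝ V] [NormedSpace ℂ V]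
    {g : D → E} {h : E → D} (hg : g.HasTemperateGrowth)
    (hh : h.HasTemperateGrowth) (hgh : Function.LeftInverse h g) : 𝓢(E, V) →L[ℂ] 𝓢(D, V) :=
  SchwartzMap.compCLM ℂ hg (by
    obtain ⟨k, C, hC⟩ := hh.exists_norm_le
    exact ⟨k, C, fun x => by simpa only [hgh x] using hC (g x)⟩)

@[simp] theorem schwartzComp_apply {V : Type*} [NormedAddCommGroup V] [NormedSpace ℝ V]
    [NormedSpace ℂ V] {g : D → E} {h : E → D} (hg : g.HasTemperateGrowth)
    (hh : h.HasTemperateGrowth) (hgh : Function.LeftInverse h g) (f : 𝓢(E, V)) (x : D) :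
    schwartzComp V hg hh hgh f x = f (g x) := rfl

end Temperate


/-! ### Completeness of the Schwartz space -/

section Complete

variable {E V : Type*} [NormedAddCommGroup E] [NormedSpace ℝ E] [NormedAddCommGroup V]
  [NormedSpace ℝ V] [CompleteSpace V]

open Filter Topology in
/-- All derivatives of a Cauchy sequence converge uniformly, with any polynomial weight; the limits
are the derivatives of a Schwartz function. -/
theorem schwartz_tendsto_of_cauchySeq (u : ℕ → 𝓢(E, V)) (hu : CauchySeq u) :
    ∃ f, Tendsto u atTop (𝓝 f) := by
  have hsem : ∀ k m : ℕ, ∀ ε > 0, ∃ N, ∀ i ≥ N, ∀ j ≥ N,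
      SchwartzMap.seminorm ℝ k m (u i - u j) < ε := by
    intro k m ε hε
    have hcont : Continuous (SchwartzMap.seminorm ℝ k m : 𝓢(E, V) → ℝ) :=
      (schwartz_withSeminorms ℝ E V).continuous_seminorm (k, m)
    have h0 : ∀ᶠ g in 𝓝 (0 : 𝓢(E, V)), SchwartzMap.seminorm ℝ k m g < ε :=
      hcont.continuousAt.eventually_lt continuousAt_const (by simpa using hε)
    have h1 : Tendsto (fun p : ℕ × ℕ => u p.1 - u p.2) atTop (𝓝 0) := by
      have := cauchySeq_iff_tendsto.1 hu
      rw [uniformity_eq_comap_nhds_zero, tendsto_comap_iff] at this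
      have h2 := this.neg
      simpa [Function.comp_def] using h2
    obtain ⟨⟨N1, N2⟩, hN⟩ := eventually_atTop.1 (h1.eventually h0)
    exact ⟨max N1 N2, fun i hi j hj => hN (i, j) ⟨le_trans (le_max_left _ _) hi,
      le_trans (le_max_right _ _) hj⟩⟩
  have hpt : ∀ (k m : ℕ), ∀ ε > 0, ∃ N, ∀ i ≥ N, ∀ j ≥ N, ∀ x,
      ‖x‖ ^ k * ‖iteratedFDeriv ℝ m (u i) x - iteratedFDeriv ℝ m (u j) x‖ < ε := by
    intro k m ε hε
    obtain ⟨N, hN⟩ := hsem k m ε hε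
    refine ⟨N, fun i hi j hj x => lt_of_le_of_lt ?_ (hN i hi j hj)⟩
    have := SchwartzMap.le_seminorm ℝ k m (u i - u j) x
    rwa [show (⇑(u i - u j) : E → V) = ⇑(u i) - ⇑(u j) from by ext; simp,
      iteratedFDeriv_sub_apply ((u i).smooth m).contDiffAt ((u j).smooth m).contDiffAt] at this
  have hlim : ∀ m x, ∃ L, Tendsto (fun i => iteratedFDeriv ℝ m (u i) x) atTop (𝓝 L) := by
    intro m x
    refine cauchySeq_tendsto_of_complete (Metric.cauchySeq_iff.2 fun ε hε => ?_)
    obtain ⟨N, hN⟩ := hpt 0 m ε hε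
    exact ⟨N, fun i hi j hj => by simpa [dist_eq_norm] using hN i hi j hj x⟩
  choose g hg using hlim
  have hbd : ∀ (k m : ℕ), ∀ ε > 0, ∃ N, ∀ i ≥ N, ∀ x,
      ‖x‖ ^ k * ‖iteratedFDeriv ℝ m (u i) x - g m x‖ ≤ ε := by
    intro k m ε hε
    obtain ⟨N, hN⟩ := hpt k m ε hε
    refine ⟨N, fun i hi x => ?_⟩
    have ht : Tendsto (fun j => ‖x‖ ^ k *
        ‖iteratedFDeriv ℝ m (u i) x - iteratedFDeriv ℝ m (u j) x‖) atTop
        (𝓝 (‖x‖ ^ k * ‖iteratedFDeriv ℝ m (u i) x - g m x‖)) :=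
      (tendsto_const_nhds.sub (hg m x)).norm.const_mul _
    exact le_of_tendsto ht (eventually_atTop.2 ⟨N, fun j hj => (hN i hi j hj x).le⟩)
  have hunif : ∀ m, TendstoUniformly (fun i => iteratedFDeriv ℝ m (u i)) (g m) atTop := by
    intro m
    rw [Metric.tendstoUniformly_iff]
    intro ε hε
    obtain ⟨N, hN⟩ := hbd 0 m (ε / 2) (by positivity)
    refine eventually_atTop.2 ⟨N, fun i hi x => ?_⟩
    have := hN i hi x
    rw [dist_comm, dist_eq_norm]
    simp only [pow_zero, one_mul] at this
    linarith
  have hder : ∀ m x, HasFDerivAt (g m) (g (m + 1) x).curryLeft x := by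
    intro m x
    refine hasFDerivAt_of_tendstoUniformly (l := atTop)
      (f := fun i => iteratedFDeriv ℝ m (u i))
      (f' := fun i x => (iteratedFDeriv ℝ (m + 1) (u i) x).curryLeft)
      (g' := fun x => (g (m + 1) x).curryLeft)
      ?_ ?_ (fun y => hg m y) x
    · have hL := (continuousMultilinearCurryLeftEquiv ℝ (fun _ : Fin (m + 1) => E)
        V).lipschitz.uniformContinuous
      exact hL.comp_tendstoUniformly (hunif (m + 1))
    · intro i y
      have hd : DifferentiableAt ℝ (iteratedFDeriv ℝ m (u i)) y :=
        ((u i).smooth ⊤).differentiable_iteratedFDeriv (by exact_mod_cast WithTop.coe_lt_top _) y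
      have := hd.hasFDerivAt
      rw [fderiv_iteratedFDeriv] at this
      exact this
  let f0 : E → V := fun x => (g 0 x).curry0
  let T : E → FormalMultilinearSeries ℝ E V := fun x m => g m x
  have htaylor : HasFTaylorSeriesUpTo ∞ f0 T :=
    ⟨fun x => rfl, fun m _ x => hder m x, fun m _ => continuous_iff_continuousAt.2 fun x =>
      (hder m x).continuousAt⟩
  have hsm : ContDiff ℝ ∞ f0 := htaylor.contDiff
  have heq : ∀ (m : ℕ) x, iteratedFDeriv ℝ m f0 x = g m x := fun m x =>
    (htaylor.eq_iteratedFDeriv (by exact_mod_cast le_top) x).symm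
  let f : 𝓢(E, V) :=
    { toFun := f0
      smooth' := hsm
      decay' := by
        intro k m
        obtain ⟨N, hN⟩ := hbd k m 1 one_pos
        obtain ⟨C, -, hC⟩ := (u N).decay k m
        refine ⟨C + 1, fun x => ?_⟩
        rw [heq]
        have h1 := hN N le_rfl x
        have h2 := hC x
        have h3 : ‖g m x‖ ≤ ‖iteratedFDeriv ℝ m (u N) x‖
            + ‖iteratedFDeriv ℝ m (u N) x - g m x‖ := by
          have := norm_sub_le (iteratedFDeriv ℝ m (u N) x)
            (iteratedFDeriv ℝ m (u N) x - g m x)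
          simpa using this
        calc ‖x‖ ^ k * ‖g m x‖ ≤ ‖x‖ ^ k * (‖iteratedFDeriv ℝ m (u N) x‖
            + ‖iteratedFDeriv ℝ m (u N) x - g m x‖) := by gcongr
          _ ≤ C + 1 := by rw [mul_add]; exact add_le_add h2 h1 }
  refine ⟨f, ?_⟩
  rw [(schwartz_withSeminorms ℝ E V).tendsto_nhds]
  rintro ⟨k, m⟩ ε hε
  obtain ⟨N, hN⟩ := hbd k m (ε / 2) (by positivity)
  refine eventually_atTop.2 ⟨N, fun i hi => ?_⟩
  refine lt_of_le_of_lt (SchwartzMap.seminorm_le_bound ℝ k m _ (M := ε / 2) (by positivity)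
    fun x => ?_) (by linarith)
  rw [show (⇑(u i - f) : E → V) = ⇑(u i) - f0 from by ext; simp; rfl,
      iteratedFDeriv_sub_apply ((u i).smooth m).contDiffAt
        (hsm.of_le (by exact_mod_cast le_top)).contDiffAt, heq]
  exact hN i hi x

/-- The Schwartz space is complete, its uniform structure being metrizable. -/
instance : CompleteSpace 𝓢(E, V) := by
  have : (uniformity 𝓢(E, V)).IsCountablyGenerated :=
    IsUniformAddGroup.uniformity_countably_generated
  exact UniformSpace.complete_of_cauchySeq_tendsto schwartz_tendsto_of_cauchySeq

end Complete


/-! ### The partial Fourier transform -/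

section PartialFourier

open scoped FourierTransform RealInnerProductSpace

variable {E F V : Type} [NormedAddCommGroup E] [NormedSpace ℝ E]
  [NormedAddCommGroup F] [InnerProductSpace ℝ F] [NormedAddCommGroup V] [NormedSpace ℂ V]

theorem hasTemperateGrowth_mk_left (x : E) :
    Function.HasTemperateGrowth (fun y : F => (x, y)) :=
  (Function.HasTemperateGrowth.const x).prodMk Function.HasTemperateGrowth.id'

/-- The slice `f(x, ·)` of a Schwartz function of two variables. -/
def slice (x : E) : 𝓢(E × F, V) →L[ℂ] 𝓢(F, V) :=
  schwartzComp V (hasTemperateGrowth_mk_left x) hasTemperateGrowth_snd fun _ => rfl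

@[simp] theorem slice_apply (x : E) (f : 𝓢(E × F, V)) (y : F) : slice x f y = f (x, y) := rfl

theorem norm_iteratedFDeriv_slice_le (x : E) (f : 𝓢(E × F, V)) (m : ℕ) (y : F) :
    ‖iteratedFDeriv ℝ m (slice x f) y‖ ≤ ‖iteratedFDeriv ℝ m f (x, y)‖ := by
  have h1 : (slice x f : F → V) =
      (fun p : E × F => f (p + (x, 0))) ∘ ContinuousLinearMap.inr ℝ E F := by
    ext y; simp
  have h2 : ContDiff ℝ m (fun p : E × F => f (p + (x, 0))) :=
    (f.smooth m).comp (contDiff_id.add contDiff_const)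
  rw [h1, ContinuousLinearMap.iteratedFDeriv_comp_right _ h2 _ le_rfl,
    iteratedFDeriv_comp_add_right]
  refine (ContinuousMultilinearMap.norm_compContinuousLinearMap_le _ _).trans ?_
  simp only [ContinuousLinearMap.inr_apply, Prod.mk_add_mk, zero_add, add_zero,
    Finset.prod_const]
  exact mul_le_of_le_one_right (norm_nonneg _)
    (pow_le_one₀ (norm_nonneg _) (ContinuousLinearMap.norm_inr_le_one ℝ E F))

/-- The seminorms of the slices are bounded uniformly in the base point, with any polynomial
weight in the base point. -/
theorem seminorm_slice_le (j k m : ℕ) (x : E) (f : 𝓢(E × F, V)) :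
    ‖x‖ ^ j * SchwartzMap.seminorm ℝ k m (slice x f) ≤ SchwartzMap.seminorm ℝ (j + k) m f := by
  by_cases hx : ‖x‖ ^ j = 0
  · rw [hx, zero_mul]; positivity
  have hpos : 0 < ‖x‖ ^ j := lt_of_le_of_ne (by positivity) (Ne.symm hx)
  rw [mul_comm, ← le_div_iff₀ hpos]
  refine SchwartzMap.seminorm_le_bound ℝ k m _ (by positivity) fun y => ?_
  rw [le_div_iff₀ hpos]
  calc ‖y‖ ^ k * ‖iteratedFDeriv ℝ m (slice x f) y‖ * ‖x‖ ^ j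
      ≤ ‖(x, y)‖ ^ k * ‖iteratedFDeriv ℝ m f (x, y)‖ * ‖(x, y)‖ ^ j := by
        gcongr
        · exact norm_snd_le (x, y)
        · exact norm_iteratedFDeriv_slice_le x f m y
        · exact norm_fst_le (x, y)
    _ = ‖(x, y)‖ ^ (j + k) * ‖iteratedFDeriv ℝ m f (x, y)‖ := by ring
    _ ≤ _ := SchwartzMap.le_seminorm ℝ (j + k) m f (x, y)

/-- The operator `L` with `D (𝓕₂ f) = 𝓕₂ (L f)`: differentiation in the first variable, and
multiplication by `-2πi⟨y, ·⟩` in the second one. -/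
def partialFourierDeriv : 𝓢(E × F, V) →L[ℝ] 𝓢(E × F, E × F →L[ℝ] V) :=
  (SchwartzMap.postcompCLM
    (((ContinuousLinearMap.compL ℝ (E × F) (E × F) V).flip
      ((ContinuousLinearMap.inl ℝ E F).comp (ContinuousLinearMap.fst ℝ E F))))).comp
      (SchwartzMap.fderivCLM ℝ (E × F) V)
  - (SchwartzMap.smulRightCLM ℝ V
      ((ContinuousLinearMap.precomp ℝ (ContinuousLinearMap.snd ℝ E F)).comp
        ((innerSL ℝ).comp (ContinuousLinearMap.snd ℝ E F)))).comp
      ((SchwartzMap.postcompCLM ((2 * Real.pi * Complex.I) •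
        ContinuousLinearMap.id ℂ V)).restrictScalars ℝ)

theorem partialFourierDeriv_apply (f : 𝓢(E × F, V)) (p v : E × F) :
    partialFourierDeriv f p v =
      fderiv ℝ f p (v.1, 0) - ((⟪p.2, v.2⟫ : ℝ) * (2 * Real.pi * Complex.I)) • f p := by
  simp [partialFourierDeriv, mul_smul]

variable [FiniteDimensional ℝ F] [MeasurableSpace F] [BorelSpace F]

/-- The partial Fourier transform `∫ e^{-2πi⟨y, η⟩} f(x, y) dy` in the second variable, as a mere
function. -/
def partialFourierFun (f : 𝓢(E × F, V)) (p : E × F) : V := 𝓕 (slice p.1 f) p.2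

theorem partialFourierFun_eq (f : 𝓢(E × F, V)) (p : E × F) :
    partialFourierFun f p = ∫ y, 𝐞 (-⟪y, p.2⟫) • f (p.1, y) := by
  rw [partialFourierFun, SchwartzMap.fourier_coe, Real.fourier_eq]
  rfl

/-- A bound of `f(x, y)` which is integrable in `y` and independent of `x`. -/
theorem exists_norm_le_rpow {W : Type*} [NormedAddCommGroup W] [NormedSpace ℝ W]
    (f : 𝓢(E × F, W)) : ∃ C : ℝ, ∀ x y,
    ‖f (x, y)‖ ≤ C * (1 + ‖y‖) ^ (-((volume : Measure F).integrablePower : ℝ)) := by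
  set k := (volume : Measure F).integrablePower
  refine ⟨2 ^ k * ((Finset.Iic (k, 0)).sup (schwartzSeminormFamily ℝ (E × F) W)) f, fun x y => ?_⟩
  have h := SchwartzMap.one_add_le_sup_seminorm_apply (𝕜 := ℝ) (m := (k, 0)) (k := k) (n := 0)
    le_rfl le_rfl f (x, y)
  rw [norm_iteratedFDeriv_zero] at h
  rw [Real.rpow_neg (by positivity), Real.rpow_natCast, ← div_eq_mul_inv,
    le_div_iff₀ (by positivity)]
  refine le_trans ?_ h
  rw [mul_comm]
  gcongr
  exact norm_snd_le (x, y)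

omit [FiniteDimensional ℝ F] [MeasurableSpace F] [BorelSpace F] in
theorem continuous_fourierChar_smul {W : Type*} [NormedAddCommGroup W] [NormedSpace ℂ W]
    (g : 𝓢(E × F, W)) (p : E × F) : Continuous fun y : F => 𝐞 (-⟪y, p.2⟫) • g (p.1, y) := by
  have := g.continuous
  simp only [Circle.smul_def]
  have h2 : Continuous fun y : F => ((𝐞 (-⟪y, p.2⟫) : Circle) : ℂ) := by fun_prop
  exact h2.smul (by fun_prop)

theorem aestronglyMeasurable_fourierChar_smul {W : Type*} [NormedAddCommGroup W]
    [NormedSpace ℂ W] (g : 𝓢(E × F, W)) (p : E × F) :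
    AEStronglyMeasurable (fun y : F => 𝐞 (-⟪y, p.2⟫) • g (p.1, y)) volume :=
  (continuous_fourierChar_smul g p).aestronglyMeasurable

omit [FiniteDimensional ℝ F] [MeasurableSpace F] [BorelSpace F] in
theorem hasFDerivAt_fourierChar_smul (f : 𝓢(E × F, V)) (y : F) (q : E × F) :
    HasFDerivAt (fun q : E × F => 𝐞 (-⟪y, q.2⟫) • f (q.1, y))
      (𝐞 (-⟪y, q.2⟫) • partialFourierDeriv f (q.1, y)) q := by
  have h1 : HasFDerivAt (fun q : E × F => -⟪y, q.2⟫)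
      (-((innerSL ℝ y).comp (ContinuousLinearMap.snd ℝ E F))) q :=
    (((innerSL ℝ y).comp (ContinuousLinearMap.snd ℝ E F)).hasFDerivAt).neg
  have h2 := (Real.hasDerivAt_fourierChar (-⟪y, q.2⟫)).hasFDerivAt.comp q h1
  have h3 : HasFDerivAt (fun q : E × F => f (q.1, y)) ((fderiv ℝ f (q.1, y)).comp
      ((ContinuousLinearMap.inl ℝ E F).comp (ContinuousLinearMap.fst ℝ E F))) q := by
    have h4 : HasFDerivAt (fun q : E × F => (q.1, y))
        ((ContinuousLinearMap.inl ℝ E F).comp (ContinuousLinearMap.fst ℝ E F)) q :=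
      (hasFDerivAt_fst (𝕜 := ℝ) (p := q)).prodMk (hasFDerivAt_const y q)
    exact (f.differentiableAt.hasFDerivAt).comp q h4
  have h5 := h2.smul h3
  simp only [Function.comp_def, ← Circle.smul_def] at h5
  refine h5.congr_fderiv ?_
  refine ContinuousLinearMap.ext fun v => ?_
  simp [partialFourierDeriv_apply, Circle.smul_def, smul_sub, smul_smul]
  module

/-- `Continuous.aestronglyMeasurable` for operator-valued maps, with the topology on the target that
comes from the real structures of the two spaces. -/
theorem _root_.Continuous.aestronglyMeasurable_clm {D W : Type*} [NormedAddCommGroup D]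
    [NormedSpace ℝ D] [NormedAddCommGroup W]
    [NormedSpace ℝ W] {g : F → D →L[ℝ] W} (hg : Continuous g) :
    AEStronglyMeasurable g volume :=
  hg.aestronglyMeasurable

/-- Differentiation under the integral sign, for an arbitrary expression `G` of the derivative of
the integrand. -/
theorem hasFDerivAt_integral_fourierChar_smul (f : 𝓢(E × F, V)) (p : E × F)
    (G : E × F → F → E × F →L[ℝ] V) (hm : Continuous (G p)) {C : ℝ}
    (hG : ∀ q y, ‖G q y‖ ≤ C * (1 + ‖y‖) ^ (-((volume : Measure F).integrablePower : ℝ)))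
    (hd : ∀ q y, HasFDerivAt (fun q : E × F => 𝐞 (-⟪y, q.2⟫) • f (q.1, y)) (G q y) q) :
    HasFDerivAt (fun p : E × F => ∫ y, 𝐞 (-⟪y, p.2⟫) • f (p.1, y)) (∫ y, G p y) p := by
  have hint : Integrable (fun y : F => 𝐞 (-⟪y, p.2⟫) • f (p.1, y)) := by
    refine Integrable.mono' (slice p.1 f).integrable.norm
      (aestronglyMeasurable_fourierChar_smul f p) ?_
    exact Filter.Eventually.of_forall fun y => by simp
  exact hasFDerivAt_integral_of_dominated_of_fderiv_le (𝕜 := ℝ)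
    (F := fun (p : E × F) (y : F) => 𝐞 (-⟪y, p.2⟫) • f (p.1, y)) (F' := G)
    (bound := fun y => C * (1 + ‖y‖) ^ (-((volume : Measure F).integrablePower : ℝ)))
    Filter.univ_mem
    (Filter.Eventually.of_forall fun q => aestronglyMeasurable_fourierChar_smul f q)
    hint hm.aestronglyMeasurable_clm (Filter.Eventually.of_forall fun y q _ => hG q y)
    ((Measure.integrable_pow_neg_integrablePower _).const_mul C)
    (Filter.Eventually.of_forall fun y q _ => hd q y)

/-- The derivative of a partial Fourier transform is again a partial Fourier transform, so that
smoothness and decay follow by induction on the order of differentiation. -/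
theorem hasFDerivAt_partialFourierFun (f : 𝓢(E × F, V)) (p : E × F) :
    HasFDerivAt (partialFourierFun f)
      (partialFourierFun (V := E × F →L[ℝ] V) (partialFourierDeriv f) p) p := by
  obtain ⟨C, hC⟩ := exists_norm_le_rpow (W := E × F →L[ℝ] V) (partialFourierDeriv f)
  have hfun : partialFourierFun f = fun p => ∫ y, 𝐞 (-⟪y, p.2⟫) • f (p.1, y) := by
    funext p; exact partialFourierFun_eq f p
  rw [partialFourierFun_eq, hfun]
  have hbound : ∀ (q : E × F) (y : F), ‖𝐞 (-⟪y, q.2⟫) • partialFourierDeriv f (q.1, y)‖ ≤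
      C * (1 + ‖y‖) ^ (-((volume : Measure F).integrablePower : ℝ)) := fun q y =>
    ((Circle.norm_smul (E := E × F →L[ℝ] V) _ _).le).trans (hC q.1 y)
  have hm : Continuous (fun y : F => 𝐞 (-⟪y, p.2⟫) • partialFourierDeriv f (p.1, y)) :=
    continuous_fourierChar_smul (W := E × F →L[ℝ] V) (partialFourierDeriv f) p
  exact hasFDerivAt_integral_fourierChar_smul f p
    (fun q y => 𝐞 (-⟪y, q.2⟫) • partialFourierDeriv f (q.1, y)) hm hbound
    fun q y => hasFDerivAt_fourierChar_smul f y q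

end PartialFourier

/-! ### Continuity and inversion of the partial Fourier transform -/

section PartialFourierCLM

open scoped FourierTransform RealInnerProductSpace

variable {E F V : Type} [NormedAddCommGroup E] [NormedSpace ℝ E]
  [NormedAddCommGroup F] [InnerProductSpace ℝ F] [NormedAddCommGroup V] [NormedSpace ℂ V]
  [FiniteDimensional ℝ F] [MeasurableSpace F] [BorelSpace F]

theorem fderiv_partialFourierFun (f : 𝓢(E × F, V)) :
    fderiv ℝ (partialFourierFun f) =
      partialFourierFun (V := E × F →L[ℝ] V) (partialFourierDeriv f) :=
  funext fun p => (hasFDerivAt_partialFourierFun f p).fderiv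

/-- The target `V` varies in the induction, since a derivative takes values in linear maps. -/
theorem contDiff_partialFourierFun_nat (m : ℕ) :
    ∀ {V : Type} [NormedAddCommGroup V] [NormedSpace ℂ V] (f : 𝓢(E × F, V)),
      ContDiff ℝ m (partialFourierFun f) := by
  induction m with
  | zero =>
    intro V _ _ f
    exact contDiff_zero.2 (continuous_iff_continuousAt.2 fun p =>
      (hasFDerivAt_partialFourierFun f p).continuousAt)
  | succ m ih =>
    intro V _ _ f
    rw [Nat.cast_succ, contDiff_succ_iff_fderiv]
    refine ⟨fun p => (hasFDerivAt_partialFourierFun f p).differentiableAt, by simp, ?_⟩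
    rw [fderiv_partialFourierFun]
    exact ih (V := E × F →L[ℝ] V) (partialFourierDeriv f)

/-- Weighted sup norms of the partial Fourier transform are bounded by Schwartz seminorms: weights
in the second variable by the continuity of the Fourier transform of the slices, weights in the first
one by the decay of the slices. -/
theorem exists_seminorm_slice_fourier_le (i j : ℕ) :
    ∃ q : Seminorm ℝ 𝓢(E × F, V), Continuous q ∧ ∀ (f : 𝓢(E × F, V)) (p : E × F),
      ‖p.1‖ ^ i * (‖p.2‖ ^ j * ‖partialFourierFun f p‖) ≤ q f := by
  let r : Seminorm ℝ 𝓢(F, V) := (SchwartzMap.seminorm ℝ j 0).comp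
    (SchwartzMap.fourierTransformCLM ℝ : 𝓢(F, V) →L[ℝ] 𝓢(F, V)).toLinearMap
  have hr : Continuous r := ((schwartz_withSeminorms ℝ F V).continuous_seminorm (j, 0)).comp
    (SchwartzMap.fourierTransformCLM ℝ : 𝓢(F, V) →L[ℝ] 𝓢(F, V)).continuous
  obtain ⟨s, C, -, hs⟩ := Seminorm.bound_of_continuous (schwartz_withSeminorms ℝ F V) r hr
  refine ⟨∑ a ∈ s, C • SchwartzMap.seminorm ℝ (i + a.1) a.2, ?_, fun f p => ?_⟩
  · have : (⇑(∑ a ∈ s, C • SchwartzMap.seminorm ℝ (i + a.1) a.2 : Seminorm ℝ 𝓢(E × F, V))) =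
        fun f => ∑ a ∈ s, C • SchwartzMap.seminorm ℝ (i + a.1) a.2 f := by
      ext f; simp
    rw [this]
    exact continuous_finsetSum _ fun a _ =>
      ((schwartz_withSeminorms ℝ (E × F) V).continuous_seminorm (i + a.1, a.2)).const_smul C
  · have h1 : ‖p.2‖ ^ j * ‖partialFourierFun f p‖ ≤ r (slice p.1 f) := by
      have := SchwartzMap.le_seminorm ℝ j 0 (𝓕 (slice p.1 f)) p.2
      rwa [norm_iteratedFDeriv_zero] at this
    have h2 : r (slice p.1 f) ≤ ∑ a ∈ s, C * SchwartzMap.seminorm ℝ a.1 a.2 (slice p.1 f) := by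
      refine (hs _).trans ?_
      rw [smul_apply, ← Finset.mul_sum]
      have := Seminorm.finset_sup_le_sum (schwartzSeminormFamily ℝ F V) s (slice p.1 f)
      simp only [sum_apply] at this
      exact mul_le_mul_of_nonneg_left this C.2
    calc ‖p.1‖ ^ i * (‖p.2‖ ^ j * ‖partialFourierFun f p‖)
        ≤ ‖p.1‖ ^ i * ∑ a ∈ s, C * SchwartzMap.seminorm ℝ a.1 a.2 (slice p.1 f) := by
          gcongr; exact h1.trans h2
      _ = ∑ a ∈ s, C * (‖p.1‖ ^ i * SchwartzMap.seminorm ℝ a.1 a.2 (slice p.1 f)) := by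
          rw [Finset.mul_sum]; exact Finset.sum_congr rfl fun a _ => by ring
      _ ≤ ∑ a ∈ s, C * SchwartzMap.seminorm ℝ (i + a.1) a.2 f := by
          gcongr with a _
          exact seminorm_slice_le i a.1 a.2 p.1 f
      _ = _ := by simp [NNReal.smul_def]

/-- Every Schwartz seminorm of the partial Fourier transform of `f` is bounded by a continuous
seminorm of `f`. -/
theorem exists_seminorm_partialFourierFun_le (k m : ℕ) :
    ∀ {V : Type} [NormedAddCommGroup V] [NormedSpace ℂ V],
      ∃ q : Seminorm ℝ 𝓢(E × F, V), Continuous q ∧ ∀ (f : 𝓢(E × F, V)) (p : E × F),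
        ‖p‖ ^ k * ‖iteratedFDeriv ℝ m (partialFourierFun f) p‖ ≤ q f := by
  induction m with
  | zero =>
    intro V _ _
    obtain ⟨q1, hq1, h1⟩ := exists_seminorm_slice_fourier_le (E := E) (F := F) (V := V) k 0
    obtain ⟨q2, hq2, h2⟩ := exists_seminorm_slice_fourier_le (E := E) (F := F) (V := V) 0 k
    refine ⟨q1 + q2, hq1.add hq2, fun f p => ?_⟩
    rw [norm_iteratedFDeriv_zero]
    have h1 := h1 f p
    have h2 := h2 f p
    simp only [pow_zero, one_mul] at h1 h2
    have hp : ‖p‖ ^ k ≤ ‖p.1‖ ^ k + ‖p.2‖ ^ k := by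
      rcases max_choice ‖p.1‖ ‖p.2‖ with h | h <;> rw [Prod.norm_def, h]
      · exact le_add_of_nonneg_right (by positivity)
      · exact le_add_of_nonneg_left (by positivity)
    calc ‖p‖ ^ k * ‖partialFourierFun f p‖
        ≤ (‖p.1‖ ^ k + ‖p.2‖ ^ k) * ‖partialFourierFun f p‖ := by gcongr
      _ ≤ q1 f + q2 f := by rw [add_mul]; exact add_le_add h1 h2
  | succ m ih =>
    intro V _ _
    obtain ⟨q, hq, h⟩ := ih (V := E × F →L[ℝ] V)
    have hD : Continuous fun f : 𝓢(E × F, V) => q (partialFourierDeriv f) :=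
      hq.comp (partialFourierDeriv (E := E) (F := F) (V := V)).continuous
    let r : Seminorm ℝ 𝓢(E × F, V) :=
      q.comp (partialFourierDeriv (E := E) (F := F) (V := V)).toLinearMap
    refine ⟨r, hD, fun f p => ?_⟩
    rw [← norm_iteratedFDeriv_fderiv, fderiv_partialFourierFun]
    exact h (partialFourierDeriv f) p

/-- The partial Fourier transform in the second variable as a real linear map. -/
def partialFourierReal : 𝓢(E × F, V) →L[ℝ] 𝓢(E × F, V) :=
  SchwartzMap.mkCLM (𝕜 := ℝ) (𝕜' := ℝ) (σ := RingHom.id ℝ) partialFourierFun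
    (fun f g p => by
      simp only [partialFourierFun, map_add, FourierTransform.fourier_add]
      rfl)
    (fun c f p => by
      have h : slice p.1 (c • f) = c • slice p.1 f := by ext; simp
      simp only [partialFourierFun, h, FourierTransform.fourier_smul]
      rfl)
    (fun f => contDiff_infty.2 fun m => contDiff_partialFourierFun_nat m f)
    (fun n => by
      obtain ⟨q, hq, h⟩ := exists_seminorm_partialFourierFun_le (E := E) (F := F) n.1 n.2 (V := V)
      obtain ⟨s, C, -, hs⟩ := Seminorm.bound_of_continuous
        (schwartz_withSeminorms ℝ (E × F) V) q hq
      exact ⟨s, C, C.2, fun f p => (h f p).trans (hs f)⟩)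

/-- The partial Fourier transform `f ↦ ∫ e^{-2πi⟨y, η⟩} f(x, y) dy` in the second variable. -/
def partialFourier : 𝓢(E × F, V) →L[ℂ] 𝓢(E × F, V) where
  toFun := partialFourierReal
  map_add' := map_add _
  map_smul' c f := by
    ext p
    change partialFourierFun (c • f) p = c • partialFourierFun f p
    simp only [partialFourierFun, map_smul, FourierTransform.fourier_smul]
    rfl
  cont := partialFourierReal.continuous

theorem partialFourier_apply (f : 𝓢(E × F, V)) (p : E × F) :
    partialFourier f p = 𝓕 (slice p.1 f) p.2 := rfl

theorem slice_partialFourier (f : 𝓢(E × F, V)) (x : E) :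
    slice x (partialFourier f) = 𝓕 (slice x f) := rfl

omit [FiniteDimensional ℝ F] [MeasurableSpace F] [BorelSpace F] in
theorem hasTemperateGrowth_neg_snd :
    Function.HasTemperateGrowth (fun p : E × F => (p.1, -p.2)) :=
  hasTemperateGrowth_fst.prodMk hasTemperateGrowth_snd.neg

/-- The inverse partial Fourier transform in the second variable. -/
def partialFourierInv : 𝓢(E × F, V) →L[ℂ] 𝓢(E × F, V) :=
  (schwartzComp V (g := fun p : E × F => (p.1, -p.2)) hasTemperateGrowth_neg_snd
    hasTemperateGrowth_neg_snd fun p => by simp).comp partialFourier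

theorem slice_partialFourierInv (f : 𝓢(E × F, V)) (x : E) :
    slice x (partialFourierInv f) = 𝓕⁻ (slice x f) := by
  rw [SchwartzMap.fourierInv_apply_eq]
  rfl

theorem partialFourierInv_apply (f : 𝓢(E × F, V)) (p : E × F) :
    partialFourierInv f p = 𝓕⁻ (slice p.1 f) p.2 := by
  rw [← slice_partialFourierInv]; rfl

theorem partialFourier_partialFourierInv [CompleteSpace V] (f : 𝓢(E × F, V)) :
    partialFourier (partialFourierInv f) = f := by
  ext p
  rw [partialFourier_apply, slice_partialFourierInv, FourierTransform.fourier_fourierInv_eq]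
  rfl

theorem partialFourierInv_partialFourier [CompleteSpace V] (f : 𝓢(E × F, V)) :
    partialFourierInv (partialFourier f) = f := by
  ext p
  rw [partialFourierInv_apply, slice_partialFourier, FourierTransform.fourierInv_fourier_eq]
  rfl

/-- Integration over the second variable: the value of the partial Fourier transform at frequency
zero. -/
def partialIntegral : 𝓢(E × F, V) →L[ℂ] 𝓢(E, V) :=
  (schwartzComp V (g := fun x : E => (x, (0 : F)))
    (Function.HasTemperateGrowth.id'.prodMk (Function.HasTemperateGrowth.const 0))
    hasTemperateGrowth_fst fun _ => rfl).comp partialFourier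

theorem partialIntegral_apply (f : 𝓢(E × F, V)) (x : E) :
    partialIntegral f x = ∫ y, f (x, y) := by
  change partialFourierFun f (x, 0) = _
  simp [partialFourierFun_eq]

end PartialFourierCLM

/-! ### Products of Schwartz functions of complementary variables -/

section PullMul

variable {G G₁ G₂ : Type*} [NormedAddCommGroup G] [NormedSpace ℝ G] [NormedAddCommGroup G₁]
  [NormedSpace ℝ G₁] [NormedAddCommGroup G₂] [NormedSpace ℝ G₂]

theorem norm_iteratedFDeriv_comp_clm_le (p : G →L[ℝ] G₁) (f : 𝓢(G₁, ℂ)) (m : ℕ) (w : G) :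
    ‖iteratedFDeriv ℝ m (fun w => f (p w)) w‖ ≤ ‖p‖ ^ m * ‖iteratedFDeriv ℝ m f (p w)‖ := by
  change ‖iteratedFDeriv ℝ m (f ∘ p) w‖ ≤ _
  rw [ContinuousLinearMap.iteratedFDeriv_comp_right _ (f.smooth m) _ le_rfl]
  refine (ContinuousMultilinearMap.norm_compContinuousLinearMap_le _ _).trans ?_
  simp [mul_comm]

/-- The bound of the `(k, m)` seminorm of `f ∘ p * g ∘ q` by the seminorms of `f` and `g`. It is
irreducible to keep unification from unfolding the sum. -/
@[irreducible]
def pullMulBound (p : G →L[ℝ] G₁) (q : G →L[ℝ] G₂) (k m : ℕ) (f : 𝓢(G₁, ℂ)) (g : 𝓢(G₂, ℂ)) : ℝ :=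
  ∑ i ∈ Finset.range (m + 1), 2 ^ (k - 1) * (m.choose i) * ‖p‖ ^ i * ‖q‖ ^ (m - i) *
    (SchwartzMap.seminorm ℝ k i f * SchwartzMap.seminorm ℝ 0 (m - i) g
      + SchwartzMap.seminorm ℝ 0 i f * SchwartzMap.seminorm ℝ k (m - i) g)

theorem continuous_pullMulBound (p : G →L[ℝ] G₁) (q : G →L[ℝ] G₂) (k m : ℕ) :
    Continuous fun a : 𝓢(G₁, ℂ) × 𝓢(G₂, ℂ) => pullMulBound p q k m a.1 a.2 := by
  have h1 : ∀ i j, Continuous fun a : 𝓢(G₁, ℂ) × 𝓢(G₂, ℂ) => SchwartzMap.seminorm ℝ i j a.1 :=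
    fun i j => ((schwartz_withSeminorms ℝ G₁ ℂ).continuous_seminorm (i, j)).comp continuous_fst
  have h2 : ∀ i j, Continuous fun a : 𝓢(G₁, ℂ) × 𝓢(G₂, ℂ) => SchwartzMap.seminorm ℝ i j a.2 :=
    fun i j => ((schwartz_withSeminorms ℝ G₂ ℂ).continuous_seminorm (i, j)).comp continuous_snd
  unfold pullMulBound
  exact continuous_finsetSum _ fun i _ => continuous_const.mul
    (((h1 _ _).mul (h2 _ _)).add ((h1 _ _).mul (h2 _ _)))

theorem pullMulBound_zero_left (p : G →L[ℝ] G₁) (q : G →L[ℝ] G₂) (k m : ℕ) (g : 𝓢(G₂, ℂ)) :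
    pullMulBound p q k m 0 g = 0 := by
  simp [pullMulBound]

theorem pullMulBound_zero_right (p : G →L[ℝ] G₁) (q : G →L[ℝ] G₂) (k m : ℕ) (f : 𝓢(G₁, ℂ)) :
    pullMulBound p q k m f 0 = 0 := by
  simp [pullMulBound]

theorem norm_pow_mul_iteratedFDeriv_le_pullMulBound (p : G →L[ℝ] G₁) (q : G →L[ℝ] G₂)
    (hpq : ∀ w, ‖w‖ ≤ ‖p w‖ + ‖q w‖) (k m : ℕ) (f : 𝓢(G₁, ℂ)) (g : 𝓢(G₂, ℂ)) (w : G) :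
    ‖w‖ ^ k * ‖iteratedFDeriv ℝ m (fun w => f (p w) * g (q w)) w‖ ≤ pullMulBound p q k m f g := by
  have hf : ContDiff ℝ m (fun w => f (p w)) := (f.smooth m).comp p.contDiff
  have hg : ContDiff ℝ m (fun w => g (q w)) := (g.smooth m).comp q.contDiff
  have hw : ‖w‖ ^ k ≤ 2 ^ (k - 1) * (‖p w‖ ^ k + ‖q w‖ ^ k) :=
    (pow_le_pow_left₀ (norm_nonneg _) (hpq w) k).trans
      (add_pow_le (norm_nonneg _) (norm_nonneg _) k)
  calc ‖w‖ ^ k * ‖iteratedFDeriv ℝ m (fun w => f (p w) * g (q w)) w‖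
      ≤ (2 ^ (k - 1) * (‖p w‖ ^ k + ‖q w‖ ^ k)) * ∑ i ∈ Finset.range (m + 1), (m.choose i : ℝ) *
          (‖p‖ ^ i * ‖iteratedFDeriv ℝ i f (p w)‖) *
          (‖q‖ ^ (m - i) * ‖iteratedFDeriv ℝ (m - i) g (q w)‖) := by
        gcongr
        refine (norm_iteratedFDeriv_mul_le hf hg w le_rfl).trans ?_
        gcongr with i _
        · exact norm_iteratedFDeriv_comp_clm_le p f i w
        · exact norm_iteratedFDeriv_comp_clm_le q g (m - i) w
    _ = ∑ i ∈ Finset.range (m + 1), 2 ^ (k - 1) * (m.choose i) * ‖p‖ ^ i * ‖q‖ ^ (m - i) *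
        ((‖p w‖ ^ k * ‖iteratedFDeriv ℝ i f (p w)‖) *
          (‖q w‖ ^ 0 * ‖iteratedFDeriv ℝ (m - i) g (q w)‖)
        + (‖p w‖ ^ 0 * ‖iteratedFDeriv ℝ i f (p w)‖) *
          (‖q w‖ ^ k * ‖iteratedFDeriv ℝ (m - i) g (q w)‖)) := by
        rw [Finset.mul_sum]
        exact Finset.sum_congr rfl fun i _ => by ring
    _ ≤ _ := by
        unfold pullMulBound
        gcongr <;> exact SchwartzMap.le_seminorm ℝ _ _ _ _

/-- The function `w ↦ f(p w) g(q w)`, for linear maps `p`, `q` that jointly control the norm. -/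
def pullMul (p : G →L[ℝ] G₁) (q : G →L[ℝ] G₂) (hpq : ∀ w, ‖w‖ ≤ ‖p w‖ + ‖q w‖) :
    𝓢(G₁, ℂ) →ₗ[ℂ] 𝓢(G₂, ℂ) →ₗ[ℂ] 𝓢(G, ℂ) :=
  LinearMap.mk₂ ℂ (fun f g =>
    { toFun := fun w => f (p w) * g (q w)
      smooth' := ((f.smooth ⊤).comp p.contDiff).mul ((g.smooth ⊤).comp q.contDiff)
      decay' := fun k m => ⟨pullMulBound p q k m f g, fun w =>
        norm_pow_mul_iteratedFDeriv_le_pullMulBound p q hpq k m f g w⟩ })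
    (fun f f' g => by ext w; exact add_mul _ _ _)
    (fun c f g => by ext w; exact mul_assoc _ _ _)
    (fun f g g' => by ext w; exact mul_add _ _ _)
    (fun c f g => by ext w; exact mul_left_comm _ _ _)

theorem seminorm_pullMul_le (p : G →L[ℝ] G₁) (q : G →L[ℝ] G₂) (hpq : ∀ w, ‖w‖ ≤ ‖p w‖ + ‖q w‖)
    (k m : ℕ) (f : 𝓢(G₁, ℂ)) (g : 𝓢(G₂, ℂ)) :
    SchwartzMap.seminorm ℝ k m (pullMul p q hpq f g) ≤ pullMulBound p q k m f g :=
  SchwartzMap.seminorm_le_bound ℝ k m _ (le_trans (by positivity)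
    (norm_pow_mul_iteratedFDeriv_le_pullMulBound p q hpq k m f g 0)) fun w =>
    norm_pow_mul_iteratedFDeriv_le_pullMulBound p q hpq k m f g w

theorem pullMul_sub_pullMul (p : G →L[ℝ] G₁) (q : G →L[ℝ] G₂) (hpq : ∀ w, ‖w‖ ≤ ‖p w‖ + ‖q w‖)
    (f f₀ : 𝓢(G₁, ℂ)) (g g₀ : 𝓢(G₂, ℂ)) :
    pullMul p q hpq f g - pullMul p q hpq f₀ g₀ =
      pullMul p q hpq (f - f₀) g + pullMul p q hpq f₀ (g - g₀) := by
  ext w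
  change f (p w) * g (q w) - f₀ (p w) * g₀ (q w) =
    (f (p w) - f₀ (p w)) * g (q w) + f₀ (p w) * (g (q w) - g₀ (q w))
  ring

open Filter Topology in
theorem continuous_pullMul (p : G →L[ℝ] G₁) (q : G →L[ℝ] G₂) (hpq : ∀ w, ‖w‖ ≤ ‖p w‖ + ‖q w‖) :
    Continuous fun a : 𝓢(G₁, ℂ) × 𝓢(G₂, ℂ) => pullMul p q hpq a.1 a.2 := by
  rw [continuous_iff_continuousAt]
  rintro ⟨f₀, g₀⟩
  refine ((schwartz_withSeminorms ℝ G ℂ).tendsto_nhds _ _).2 ?_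
  rintro ⟨k, m⟩ ε hε
  have hb : Continuous fun a : 𝓢(G₁, ℂ) × 𝓢(G₂, ℂ) =>
      pullMulBound p q k m (a.1 - f₀) a.2 + pullMulBound p q k m f₀ (a.2 - g₀) := by
    have h1 : Continuous fun a : 𝓢(G₁, ℂ) × 𝓢(G₂, ℂ) => (a.1 - f₀, a.2) :=
      (continuous_fst.sub continuous_const).prodMk continuous_snd
    have h2 : Continuous fun a : 𝓢(G₁, ℂ) × 𝓢(G₂, ℂ) => (f₀, a.2 - g₀) :=
      continuous_const.prodMk (continuous_snd.sub continuous_const)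
    exact ((continuous_pullMulBound p q k m).comp h1).add
      ((continuous_pullMulBound p q k m).comp h2)
  have h0 : pullMulBound p q k m (f₀ - f₀) g₀ + pullMulBound p q k m f₀ (g₀ - g₀) < ε := by
    rw [sub_self, sub_self, pullMulBound_zero_left, pullMulBound_zero_right, add_zero]
    exact hε
  filter_upwards [(hb.tendsto (f₀, g₀)).eventually (gt_mem_nhds h0)] with a ha
  change SchwartzMap.seminorm ℝ k m (pullMul p q hpq a.1 a.2 - pullMul p q hpq f₀ g₀) < ε
  rw [pullMul_sub_pullMul]
  exact ((map_add_le_add _ _ _).trans (add_le_add (seminorm_pullMul_le _ _ _ _ _ _ _)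
    (seminorm_pullMul_le _ _ _ _ _ _ _))).trans_lt ha

end PullMul

/-! ### The algebra of Schwartz kernels -/

section Kernel

open scoped ComplexConjugate

variable {E : Type} [NormedAddCommGroup E] [InnerProductSpace ℝ E]

/-- Multiplication of a Schwartz function by a real function of temperate growth. -/
def mulTemperate {D : Type*} [NormedAddCommGroup D] [NormedSpace ℝ D] (m : D → ℝ) :
    𝓢(D, ℂ) →L[ℂ] 𝓢(D, ℂ) :=
  SchwartzMap.smulLeftCLM ℂ (fun x => (m x : ℂ))

theorem mulTemperate_apply {D : Type*} [NormedAddCommGroup D] [NormedSpace ℝ D] {m : D → ℝ}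
    (hm : m.HasTemperateGrowth) (f : 𝓢(D, ℂ)) (x : D) :
    mulTemperate m f x = m x * f x := by
  have h : Function.HasTemperateGrowth (fun x => (m x : ℂ)) :=
    Function.Complex.hasTemperateGrowth_ofReal.comp hm
  rw [mulTemperate, SchwartzMap.smulLeftCLM_apply_apply h]
  rfl

/-- The complex conjugate of a Schwartz function. -/
def conjSchwartz {D : Type*} [NormedAddCommGroup D] [NormedSpace ℝ D] (f : 𝓢(D, ℂ)) : 𝓢(D, ℂ) :=
  SchwartzMap.postcompCLM (𝕜 := ℝ) (Complex.conjCLE : ℂ →L[ℝ] ℂ) f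

/-- The Schwartz function `(x, y) ↦ f(x) g(y)`. -/
def tensor {D₁ D₂ : Type*} [NormedAddCommGroup D₁] [NormedSpace ℝ D₁] [NormedAddCommGroup D₂]
    [NormedSpace ℝ D₂] : 𝓢(D₁, ℂ) →ₗ[ℂ] 𝓢(D₂, ℂ) →ₗ[ℂ] 𝓢(D₁ × D₂, ℂ) :=
  pullMul (ContinuousLinearMap.fst ℝ D₁ D₂) (ContinuousLinearMap.snd ℝ D₁ D₂) fun _ =>
    max_le (le_add_of_nonneg_right (norm_nonneg _)) (le_add_of_nonneg_left (norm_nonneg _))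

@[simp] theorem tensor_apply {D₁ D₂ : Type*} [NormedAddCommGroup D₁] [NormedSpace ℝ D₁]
    [NormedAddCommGroup D₂] [NormedSpace ℝ D₂] (f : 𝓢(D₁, ℂ)) (g : 𝓢(D₂, ℂ)) (w : D₁ × D₂) :
    tensor f g w = f w.1 * g w.2 := rfl

/-- The Schwartz function `((x, z), y) ↦ K₁(x, y) K₂(y, z)`. -/
def kernelMul : 𝓢(E × E, ℂ) →ₗ[ℂ] 𝓢(E × E, ℂ) →ₗ[ℂ] 𝓢((E × E) × E, ℂ) :=
  pullMul
    (((ContinuousLinearMap.fst ℝ E E).comp (ContinuousLinearMap.fst ℝ (E × E) E)).prod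
      (ContinuousLinearMap.snd ℝ (E × E) E))
    ((ContinuousLinearMap.snd ℝ (E × E) E).prod
      ((ContinuousLinearMap.snd ℝ E E).comp (ContinuousLinearMap.fst ℝ (E × E) E)))
    fun w => max_le (max_le
        ((norm_fst_le (w.1.1, w.2)).trans (le_add_of_nonneg_right (norm_nonneg _)))
        ((norm_snd_le (w.2, w.1.2)).trans (le_add_of_nonneg_left (norm_nonneg _))))
      ((norm_snd_le (w.1.1, w.2)).trans (le_add_of_nonneg_right (norm_nonneg _)))

@[simp] theorem kernelMul_apply (K₁ K₂ : 𝓢(E × E, ℂ)) (w : (E × E) × E) :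
    kernelMul K₁ K₂ w = K₁ (w.1.1, w.2) * K₂ (w.2, w.1.2) := rfl

/-- The Schwartz function `(x, y) ↦ K(x, y) v(y)`. -/
def kernelMulVec : 𝓢(E × E, ℂ) →ₗ[ℂ] 𝓢(E, ℂ) →ₗ[ℂ] 𝓢(E × E, ℂ) :=
  pullMul (ContinuousLinearMap.id ℝ (E × E)) (ContinuousLinearMap.snd ℝ E E)
    fun _ => le_add_of_nonneg_right (norm_nonneg _)

variable [FiniteDimensional ℝ E] [MeasurableSpace E] [BorelSpace E]

/-- The composition `(x, z) ↦ ∫ K₁(x, y) K₂(y, z) m(y) dy` of Schwartz kernels. -/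
def kernelComp (m : E → ℝ) : 𝓢(E × E, ℂ) →ₗ[ℂ] 𝓢(E × E, ℂ) →ₗ[ℂ] 𝓢(E × E, ℂ) :=
  kernelMul.compr₂ ((partialIntegral.comp (mulTemperate fun w : (E × E) × E => m w.2) :
    𝓢((E × E) × E, ℂ) →L[ℂ] 𝓢(E × E, ℂ)) : 𝓢((E × E) × E, ℂ) →ₗ[ℂ] 𝓢(E × E, ℂ))

/-- The action `x ↦ ∫ K(x, y) v(y) m(y) dy` of a Schwartz kernel on Schwartz functions. -/
def kernelAct (m : E → ℝ) : 𝓢(E × E, ℂ) →ₗ[ℂ] 𝓢(E, ℂ) →ₗ[ℂ] 𝓢(E, ℂ) :=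
  kernelMulVec.compr₂ ((partialIntegral.comp (mulTemperate fun w : E × E => m w.2) :
    𝓢(E × E, ℂ) →L[ℂ] 𝓢(E, ℂ)) : 𝓢(E × E, ℂ) →ₗ[ℂ] 𝓢(E, ℂ))

theorem continuous_kernelComp (m : E → ℝ) :
    Continuous fun a : 𝓢(E × E, ℂ) × 𝓢(E × E, ℂ) => kernelComp m a.1 a.2 :=
  (partialIntegral.comp (mulTemperate fun w : (E × E) × E => m w.2) :
    𝓢((E × E) × E, ℂ) →L[ℂ] 𝓢(E × E, ℂ)).continuous.comp
    (show Continuous fun a : 𝓢(E × E, ℂ) × 𝓢(E × E, ℂ) => kernelMul a.1 a.2 from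
      continuous_pullMul _ _ _)

variable {m : E → ℝ} (hm : m.HasTemperateGrowth)
include hm

theorem kernelComp_apply (K₁ K₂ : 𝓢(E × E, ℂ)) (p : E × E) :
    kernelComp m K₁ K₂ p = ∫ y, m y * (K₁ (p.1, y) * K₂ (y, p.2)) := by
  change partialIntegral (mulTemperate (fun w : (E × E) × E => m w.2) (kernelMul K₁ K₂)) p = _
  rw [partialIntegral_apply]
  refine integral_congr_ae (Filter.Eventually.of_forall fun y => ?_)
  exact mulTemperate_apply (hm.comp hasTemperateGrowth_snd) _ (p, y)

theorem kernelAct_apply (K : 𝓢(E × E, ℂ)) (v : 𝓢(E, ℂ)) (x : E) :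
    kernelAct m K v x = ∫ y, m y * (K (x, y) * v y) := by
  change partialIntegral (mulTemperate (fun w : E × E => m w.2) (kernelMulVec K v)) x = _
  rw [partialIntegral_apply]
  refine integral_congr_ae (Filter.Eventually.of_forall fun y => ?_)
  exact mulTemperate_apply (hm.comp hasTemperateGrowth_snd) _ (x, y)

theorem kernelAct_kernelComp (K₁ K₂ : 𝓢(E × E, ℂ)) (v : 𝓢(E, ℂ)) :
    kernelAct m (kernelComp m K₁ K₂) v = kernelAct m K₁ (kernelAct m K₂ v) := by
  ext x
  rw [kernelAct_apply hm, kernelAct_apply hm]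
  have hmm : Function.HasTemperateGrowth fun w : E × E => m w.1 * m w.2 :=
    (hm.comp hasTemperateGrowth_fst).mul (hm.comp hasTemperateGrowth_snd)
  let H : 𝓢(E × E, ℂ) := mulTemperate (fun w : E × E => m w.1 * m w.2)
    (pullMul (ContinuousLinearMap.fst ℝ E E) (ContinuousLinearMap.id ℝ (E × E))
      (fun w => le_add_of_nonneg_left (norm_nonneg _)) (slice x K₁) (kernelMulVec K₂ v))
  have hH : ∀ y z, H (y, z) = m z * (m y * (K₁ (x, y) * K₂ (y, z)) * v z) := fun y z => by
    rw [mulTemperate_apply hmm]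
    change ((m y * m z : ℝ) : ℂ) * (K₁ (x, y) * (K₂ (y, z) * v z)) = _
    push_cast
    ring
  have hint : Integrable (Function.uncurry fun y z : E => H (y, z)) (volume.prod volume) :=
    H.integrable
  calc ∫ z, m z * (kernelComp m K₁ K₂ (x, z) * v z)
      = ∫ z, ∫ y, H (y, z) := by
        congr 1; ext z
        simp_rw [kernelComp_apply hm, hH, integral_const_mul, integral_mul_const]
    _ = ∫ y, ∫ z, H (y, z) := (integral_integral_swap hint).symm
    _ = ∫ y, m y * (K₁ (x, y) * kernelAct m K₂ v y) := by
        congr 1; ext y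
        rw [kernelAct_apply hm, ← integral_const_mul, ← integral_const_mul]
        congr 1; ext z
        rw [hH]; ring

/-- The pairing with a positive weight of temperate growth is definite on Schwartz functions. -/
theorem eq_zero_of_integral_mul_conj_eq_zero (hpos : ∀ y, 0 < m y) (w : 𝓢(E, ℂ))
    (h : ∫ y, m y * (w y * conj (w y)) = 0) : w = 0 := by
  have hfun : ∀ y, (m y : ℂ) * (w y * conj (w y)) = ((m y * ‖w y‖ ^ 2 : ℝ) : ℂ) := fun y => by
    rw [Complex.mul_conj, Complex.normSq_eq_norm_sq]; push_cast; ring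
  have hint : Integrable fun y => m y * ‖w y‖ ^ 2 := by
    have h1 := (mulTemperate m (pullMul (ContinuousLinearMap.id ℝ E) (ContinuousLinearMap.id ℝ E)
      (fun w => le_add_of_nonneg_left (norm_nonneg _)) w (conjSchwartz w))).integrable
        (μ := volume)
    have h2 := h1.re
    refine h2.congr (Filter.Eventually.of_forall fun y => ?_)
    change RCLike.re (mulTemperate m _ y) = _
    rw [mulTemperate_apply hm]
    change RCLike.re ((m y : ℂ) * (w y * conj (w y))) = _
    rw [hfun]; exact Complex.ofReal_re _
  simp_rw [hfun] at h
  rw [integral_complex_ofReal, Complex.ofReal_eq_zero,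
    integral_eq_zero_iff_of_nonneg (fun y => mul_nonneg (hpos y).le (by positivity)) hint] at h
  have hc : Continuous fun y => m y * ‖w y‖ ^ 2 :=
    hm.1.continuous.mul (w.continuous.norm.pow 2)
  have h0 := (hc.ae_eq_iff_eq volume continuous_zero).1 h
  ext y
  have := congrFun h0 y
  simpa [(hpos y).ne'] using this

/-- A kernel is tested on the complex conjugates of its own slices. -/
theorem kernelAct_injective (hpos : ∀ y, 0 < m y) :
    Function.Injective (kernelAct m : 𝓢(E × E, ℂ) → 𝓢(E, ℂ) →ₗ[ℂ] 𝓢(E, ℂ)) := by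
  refine (injective_iff_map_eq_zero (kernelAct m)).2 fun K hK => ?_
  ext ⟨x, y⟩
  have h := congrArg (fun T => T (conjSchwartz (slice x K)) x) hK
  simp only [kernelAct_apply hm] at h
  have := eq_zero_of_integral_mul_conj_eq_zero hm hpos (slice x K) h
  simpa using congrArg (fun f : 𝓢(E, ℂ) => f y) this

/-- Kernels compose associatively because operators do. -/
theorem kernelComp_assoc (hpos : ∀ y, 0 < m y) (K₁ K₂ K₃ : 𝓢(E × E, ℂ)) :
    kernelComp m (kernelComp m K₁ K₂) K₃ = kernelComp m K₁ (kernelComp m K₂ K₃) := by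
  refine kernelAct_injective hm hpos (LinearMap.ext fun v => ?_)
  simp only [kernelAct_kernelComp hm]

theorem kernelComp_tensor_tensor (f g h k : 𝓢(E, ℂ)) (x z : E) :
    kernelComp m (tensor f g) (tensor h k) (x, z) = (∫ y, m y * (g y * h y)) * (f x * k z) := by
  rw [kernelComp_apply hm, ← integral_mul_const]
  congr 1; ext y; simp; ring

omit hm [FiniteDimensional ℝ E] [MeasurableSpace E] [BorelSpace E] in
theorem exists_schwartz_eq_ofReal {b : E → ℝ} (hb : ContDiff ℝ ∞ b) (hc : HasCompactSupport b) :
    ∃ f : 𝓢(E, ℂ), ∀ x, f x = b x :=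
  ⟨(hc.comp_left (g := ((↑) : ℝ → ℂ)) Complex.ofReal_zero).toSchwartzMap
    (Complex.ofRealCLM.contDiff.comp hb), fun _ => rfl⟩

omit hm [MeasurableSpace E] [BorelSpace E] in
theorem exists_schwartz_bump (c : E) : ∃ f : 𝓢(E, ℂ), f c = 1 ∧ (∀ x, conj (f x) = f x) ∧
    ∀ x, 2 ≤ dist x c → f x = 0 := by
  let b : ContDiffBump c := ⟨1, 2, one_pos, one_lt_two⟩
  obtain ⟨f, hf⟩ := exists_schwartz_eq_ofReal b.contDiff b.hasCompactSupport
  refine ⟨f, ?_, fun x => ?_, fun x hx => ?_⟩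
  · rw [hf, b.one_of_mem_closedBall (Metric.mem_closedBall_self zero_le_one), Complex.ofReal_one]
  · rw [hf, Complex.conj_ofReal]
  · rw [hf, b.zero_of_le_dist hx, Complex.ofReal_zero]

/-- The rank one kernels `f ⊗ f` and `f ⊗ k` do not commute when `k` does not vanish at some zero of
`f`. -/
theorem exists_kernelComp_ne [Nontrivial E] (hpos : ∀ y, 0 < m y) :
    ∃ K₁ K₂ : 𝓢(E × E, ℂ), kernelComp m K₁ K₂ ≠ kernelComp m K₂ K₁ := by
  obtain ⟨c, hc⟩ := exists_norm_eq E (show (0 : ℝ) ≤ 4 by norm_num)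
  obtain ⟨f, hf1, hfc, hf0⟩ := exists_schwartz_bump (0 : E)
  obtain ⟨k, hk1, -, -⟩ := exists_schwartz_bump c
  refine ⟨tensor f f, tensor f k, fun h => ?_⟩
  have h1 := congrArg (fun K : 𝓢(E × E, ℂ) => K (0, c)) h
  simp only [kernelComp_tensor_tensor hm, hf1, hk1, mul_one] at h1
  have hfc0 : f c = 0 := hf0 c (by rw [dist_zero_right, hc]; norm_num)
  rw [hfc0, mul_zero, mul_zero] at h1
  have h2 : f = 0 := eq_zero_of_integral_mul_conj_eq_zero hm hpos f (by simpa only [hfc] using h1)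
  rw [h2] at hf1
  simp at hf1

/-- A kernel reproducing all Schwartz functions would be a delta function. -/
theorem not_exists_kernelComp_left_unit [Nontrivial E] :
    ¬ ∃ U : 𝓢(E × E, ℂ), ∀ K, kernelComp m U K = K := by
  rintro ⟨U, hU⟩
  obtain ⟨g, hg1, -, -⟩ := exists_schwartz_bump (0 : E)
  have hrep : ∀ f : 𝓢(E, ℂ), ∫ y, m y * (U (0, y) * f y) = f 0 := by
    intro f
    have h := congrArg (fun K : 𝓢(E × E, ℂ) => K (0, 0)) (hU (tensor f g))
    simp only [kernelComp_apply hm, tensor_apply, hg1, mul_one] at h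
    exact h
  have hc : Continuous fun y => (m y : ℂ) * U (0, y) := by
    have := hm.1.continuous
    have := U.continuous
    fun_prop
  have hae : ∀ᵐ y, y ∈ ({0}ᶜ : Set E) → (m y : ℂ) * U (0, y) = 0 := by
    refine IsOpen.ae_eq_zero_of_integral_contDiff_smul_eq_zero isOpen_compl_singleton
      (hc.locallyIntegrable.locallyIntegrableOn _) fun b hb hbc hbs => ?_
    obtain ⟨f, hf⟩ := exists_schwartz_eq_ofReal hb hbc
    have h := hrep f
    have hb0 : b 0 = 0 := by
      by_contra h0
      exact hbs (subset_tsupport _ h0) rfl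
    simp_rw [hf, hb0, Complex.ofReal_zero] at h
    rw [← h]
    congr 1; ext y
    rw [Complex.real_smul]; ring
  have hne : ∀ᵐ y : E, y ∈ ({0}ᶜ : Set E) := by
    simp [ae_iff]
  have hzero := hrep g
  rw [hg1, integral_eq_zero_of_ae] at hzero
  · exact zero_ne_one hzero
  · filter_upwards [hae, hne] with y h1 h2
    rw [← mul_assoc, h1 h2, zero_mul]; rfl

end Kernel

/-! ### Symbols and kernels in coordinates -/

section Quantization

open scoped ComplexConjugate FourierTransform RealInnerProductSpace

/-- The coordinate expression of a quantization: a weight `m` (the density) and a diffeomorphism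
`Φ` of `E × E` with inverse `Ψ`, everything of temperate growth. -/
structure QuantData (E : Type) [NormedAddCommGroup E] [InnerProductSpace ℝ E] where
  m : E → ℝ
  Φ : E × E → E × E
  Ψ : E × E → E × E
  m_pos : ∀ x, 0 < m x
  m_temp : m.HasTemperateGrowth
  m_inv_temp : Function.HasTemperateGrowth fun x => (m x)⁻¹
  Φ_temp : Φ.HasTemperateGrowth
  Ψ_temp : Ψ.HasTemperateGrowth
  left_inv : Function.LeftInverse Ψ Φ
  right_inv : Function.LeftInverse Φ Ψ

/-- Joint continuity of the composition of kernels, precomposed with a continuous linear map. -/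
theorem continuous_kernelComp_comp {E : Type} [NormedAddCommGroup E] [InnerProductSpace ℝ E]
    [FiniteDimensional ℝ E] [MeasurableSpace E] [BorelSpace E] (m : E → ℝ)
    (k : 𝓢(E × E, ℂ) →L[ℂ] 𝓢(E × E, ℂ)) :
    Continuous fun a : 𝓢(E × E, ℂ) × 𝓢(E × E, ℂ) => kernelComp m (k a.1) (k a.2) := by
  have h : Continuous fun a : 𝓢(E × E, ℂ) × 𝓢(E × E, ℂ) => (k a.1, k a.2) :=
    (k.continuous.comp continuous_fst).prodMk (k.continuous.comp continuous_snd)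
  have h3 := continuous_kernelComp m
  have h2 := h3.comp h
  exact h2

namespace QuantData

variable {E : Type} [NormedAddCommGroup E] [InnerProductSpace ℝ E] (D : QuantData E)

/-- The absolute value of the Jacobian of `Φ`. -/
def jac (q : E × E) : ℝ := |(fderiv ℝ D.Φ q).det|

theorem det_mul_det (q : E × E) :
    (fderiv ℝ D.Ψ (D.Φ q)).det * (fderiv ℝ D.Φ q).det = 1 := by
  have hΨ : HasFDerivAt D.Ψ (fderiv ℝ D.Ψ (D.Φ q)) (D.Φ q) :=
    (D.Ψ_temp.1.differentiable (by simp) _).hasFDerivAt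
  have hΦ : HasFDerivAt D.Φ (fderiv ℝ D.Φ q) q :=
    (D.Φ_temp.1.differentiable (by simp) _).hasFDerivAt
  have h1 := hΨ.comp q hΦ
  have h2 : D.Ψ ∘ D.Φ = id := funext D.left_inv
  rw [h2] at h1
  have h3 := h1.unique (hasFDerivAt_id q)
  have h4 := congrArg ContinuousLinearMap.det h3
  simpa [ContinuousLinearMap.det, LinearMap.det_comp] using h4

theorem jac_pos (q : E × E) : 0 < D.jac q :=
  abs_pos.2 (right_ne_zero_of_mul_eq_one (D.det_mul_det q))

/-- The weight `W` with `K ∘ Φ = W · 𝓕₂⁻¹ A` when `K` is the kernel of the symbol `A`. -/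
def weight (q : E × E) : ℝ := D.m q.1 / (D.jac q * (D.m (D.Φ q).1 * D.m (D.Φ q).2))

theorem weight_pos (q : E × E) : 0 < D.weight q :=
  div_pos (D.m_pos _) (mul_pos (D.jac_pos q) (mul_pos (D.m_pos _) (D.m_pos _)))

variable [FiniteDimensional ℝ E]

theorem jac_temp : D.jac.HasTemperateGrowth :=
  D.Φ_temp.fderiv.det.abs fun q => right_ne_zero_of_mul_eq_one (D.det_mul_det q)

theorem jac_inv_temp : Function.HasTemperateGrowth fun q => (D.jac q)⁻¹ := by
  have h : (fun q => (D.jac q)⁻¹) = fun q => |(fderiv ℝ D.Ψ (D.Φ q)).det| := by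
    funext q
    refine (eq_inv_of_mul_eq_one_left ?_).symm
    rw [jac, ← abs_mul, D.det_mul_det, abs_one]
  rw [h]
  exact ((D.Ψ_temp.fderiv.comp D.Φ_temp).det).abs fun q =>
    left_ne_zero_of_mul_eq_one (D.det_mul_det q)

theorem weight_temp : D.weight.HasTemperateGrowth := by
  have h : D.weight = fun q => D.m q.1 * ((D.jac q)⁻¹ *
      ((D.m (D.Φ q).1)⁻¹ * (D.m (D.Φ q).2)⁻¹)) := by
    funext q; simp only [weight]; rw [div_eq_mul_inv, mul_inv, mul_inv]
  rw [h]
  exact (D.m_temp.comp hasTemperateGrowth_fst).mul (D.jac_inv_temp.mul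
    ((D.m_inv_temp.comp D.Φ_temp.fst).mul (D.m_inv_temp.comp D.Φ_temp.snd)))

theorem weight_inv_temp : Function.HasTemperateGrowth fun q => (D.weight q)⁻¹ := by
  have h : (fun q => (D.weight q)⁻¹) = fun q => (D.jac q * (D.m (D.Φ q).1 * D.m (D.Φ q).2)) *
      (D.m q.1)⁻¹ := by
    funext q; simp only [weight]; rw [inv_div, div_eq_mul_inv]
  rw [h]
  exact (D.jac_temp.mul ((D.m_temp.comp D.Φ_temp.fst).mul (D.m_temp.comp D.Φ_temp.snd))).mul
    (D.m_inv_temp.comp hasTemperateGrowth_fst)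

variable [MeasurableSpace E] [BorelSpace E]

/-- The isomorphism from symbols to kernels: `K(Φ q) = W(q) (𝓕₂⁻¹ A)(q)`. -/
def toKernel : 𝓢(E × E, ℂ) ≃L[ℂ] 𝓢(E × E, ℂ) :=
  ContinuousLinearEquiv.equivOfInverse
    ((schwartzComp ℂ D.Ψ_temp D.Φ_temp D.right_inv).comp
      ((mulTemperate D.weight).comp partialFourierInv))
    (partialFourier.comp ((mulTemperate fun q => (D.weight q)⁻¹).comp
      (schwartzComp ℂ D.Φ_temp D.Ψ_temp D.left_inv)))
    (fun A => by
      have h : (mulTemperate fun q => (D.weight q)⁻¹)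
          (schwartzComp ℂ D.Φ_temp D.Ψ_temp D.left_inv
            (schwartzComp ℂ D.Ψ_temp D.Φ_temp D.right_inv
              (mulTemperate D.weight (partialFourierInv A)))) = partialFourierInv A := by
        ext q
        rw [mulTemperate_apply D.weight_inv_temp, schwartzComp_apply, schwartzComp_apply,
          D.left_inv, mulTemperate_apply D.weight_temp, ← mul_assoc, ← Complex.ofReal_mul,
          inv_mul_cancel₀ (D.weight_pos q).ne', Complex.ofReal_one, one_mul]
      exact (congrArg partialFourier h).trans (partialFourier_partialFourierInv A))
    (fun K => by
      ext r
      change schwartzComp ℂ D.Ψ_temp D.Φ_temp D.right_inv (mulTemperate D.weight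
        (partialFourierInv (partialFourier (mulTemperate (fun q => (D.weight q)⁻¹)
          (schwartzComp ℂ D.Φ_temp D.Ψ_temp D.left_inv K))))) r = K r
      rw [partialFourierInv_partialFourier, schwartzComp_apply,
        mulTemperate_apply D.weight_temp, mulTemperate_apply D.weight_inv_temp,
        schwartzComp_apply, D.right_inv, ← mul_assoc, ← Complex.ofReal_mul,
        mul_inv_cancel₀ (D.weight_pos _).ne', Complex.ofReal_one, one_mul])

theorem toKernel_apply (A : 𝓢(E × E, ℂ)) (r : E × E) :
    D.toKernel A r = D.weight (D.Ψ r) * partialFourierInv A (D.Ψ r) := by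
  change schwartzComp ℂ D.Ψ_temp D.Φ_temp D.right_inv
    (mulTemperate D.weight (partialFourierInv A)) r = _
  rw [schwartzComp_apply, mulTemperate_apply D.weight_temp]

theorem toKernel_symm_apply (K : 𝓢(E × E, ℂ)) (p : E × E) :
    D.toKernel.symm K p =
      ∫ ζ, 𝐞 (-⟪ζ, p.2⟫) • (((D.weight (p.1, ζ))⁻¹ : ℝ) * K (D.Φ (p.1, ζ))) := by
  change partialFourierFun (mulTemperate (fun q => (D.weight q)⁻¹)
    (schwartzComp ℂ D.Φ_temp D.Ψ_temp D.left_inv K)) p = _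
  rw [partialFourierFun_eq]
  simp_rw [mulTemperate_apply D.weight_inv_temp, schwartzComp_apply]

/-- The product of symbols that corresponds to the composition of kernels. -/
def mul : 𝓢(E × E, ℂ) →ₗ[ℂ] 𝓢(E × E, ℂ) →ₗ[ℂ] 𝓢(E × E, ℂ) :=
  ((kernelComp D.m).compl₁₂ (D.toKernel : 𝓢(E × E, ℂ) →ₗ[ℂ] 𝓢(E × E, ℂ))
    (D.toKernel : 𝓢(E × E, ℂ) →ₗ[ℂ] 𝓢(E × E, ℂ))).compr₂
    (D.toKernel.symm : 𝓢(E × E, ℂ) →ₗ[ℂ] 𝓢(E × E, ℂ))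

theorem mul_apply (A B : 𝓢(E × E, ℂ)) :
    D.mul A B = D.toKernel.symm (kernelComp D.m (D.toKernel A) (D.toKernel B)) := rfl

theorem toKernel_mul (A B : 𝓢(E × E, ℂ)) :
    D.toKernel (D.mul A B) = kernelComp D.m (D.toKernel A) (D.toKernel B) := by
  rw [mul_apply, ContinuousLinearEquiv.apply_symm_apply]

theorem continuous_mul : Continuous fun a : 𝓢(E × E, ℂ) × 𝓢(E × E, ℂ) => D.mul a.1 a.2 :=
  D.toKernel.symm.continuous.comp
    (continuous_kernelComp_comp D.m (D.toKernel : 𝓢(E × E, ℂ) →L[ℂ] 𝓢(E × E, ℂ)))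

theorem mul_assoc (A B C : 𝓢(E × E, ℂ)) : D.mul (D.mul A B) C = D.mul A (D.mul B C) := by
  apply D.toKernel.injective
  simp only [toKernel_mul]
  exact kernelComp_assoc D.m_temp D.m_pos _ _ _

theorem exists_mul_ne [Nontrivial E] : ∃ A B, D.mul A B ≠ D.mul B A := by
  obtain ⟨K₁, K₂, h⟩ := exists_kernelComp_ne D.m_temp D.m_pos
  refine ⟨D.toKernel.symm K₁, D.toKernel.symm K₂, fun h' => h ?_⟩
  have := congrArg D.toKernel h'
  simpa only [toKernel_mul, ContinuousLinearEquiv.apply_symm_apply] using this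

theorem not_exists_left_unit [Nontrivial E] : ¬ ∃ U, ∀ A, D.mul U A = A := by
  rintro ⟨U, hU⟩
  refine not_exists_kernelComp_left_unit D.m_temp ⟨D.toKernel U, fun K => ?_⟩
  have := congrArg D.toKernel (hU (D.toKernel.symm K))
  simpa only [toKernel_mul, ContinuousLinearEquiv.apply_symm_apply] using this

/-- The integrand of the product formula in coordinates, as a function of `w = (ζ, y)`. -/
def mulIntegrand (A B : 𝓢(E × E, ℂ)) (p : E × E) (w : E × E) : ℂ :=
  𝐞 (-⟪w.1, p.2⟫) • (((D.weight (p.1, w.1))⁻¹ : ℝ) * (D.m w.2 *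
    (D.toKernel A ((D.Φ (p.1, w.1)).1, w.2) * D.toKernel B (w.2, (D.Φ (p.1, w.1)).2))))

theorem integrable_mulIntegrand (A B : 𝓢(E × E, ℂ)) (p : E × E) :
    Integrable (D.mulIntegrand A B p) := by
  have hg : Function.HasTemperateGrowth fun w : E × E => (D.Φ (p.1, w.1), w.2) :=
    (D.Φ_temp.comp ((Function.HasTemperateGrowth.const p.1).prodMk
      hasTemperateGrowth_fst)).prodMk hasTemperateGrowth_snd
  have hh : Function.HasTemperateGrowth fun w : (E × E) × E => ((D.Ψ w.1).2, w.2) :=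
    (D.Ψ_temp.comp hasTemperateGrowth_fst).snd.prodMk hasTemperateGrowth_snd
  have hw : Function.HasTemperateGrowth fun w : E × E => (D.weight (p.1, w.1))⁻¹ * D.m w.2 :=
    (D.weight_inv_temp.comp ((Function.HasTemperateGrowth.const p.1).prodMk
      hasTemperateGrowth_fst)).mul (D.m_temp.comp hasTemperateGrowth_snd)
  let H : 𝓢(E × E, ℂ) := mulTemperate (fun w : E × E => (D.weight (p.1, w.1))⁻¹ * D.m w.2)
    (schwartzComp ℂ hg hh (fun w => by simp [D.left_inv (p.1, w.1)])
      (kernelMul (D.toKernel A) (D.toKernel B)))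
  have hc : Continuous fun w : E × E => ((𝐞 (-⟪w.1, p.2⟫) : Circle) : ℂ) := by fun_prop
  have hI : D.mulIntegrand A B p = fun w => ((𝐞 (-⟪w.1, p.2⟫) : Circle) : ℂ) * H w := by
    funext w
    rw [mulIntegrand, Circle.smul_def, smul_eq_mul, mulTemperate_apply hw, schwartzComp_apply,
      kernelMul_apply]
    push_cast
    ring
  have hH : Integrable (⇑H) (volume.prod volume) := H.integrable
  rw [hI]
  exact hH.bdd_mul hc.aestronglyMeasurable
    (Filter.Eventually.of_forall fun w => (Circle.norm_coe _).le)

theorem mul_eq_integral (A B : 𝓢(E × E, ℂ)) (p : E × E) :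
    D.mul A B p = ∫ w, D.mulIntegrand A B p w := by
  have hint : Integrable (D.mulIntegrand A B p) (volume.prod volume) :=
    D.integrable_mulIntegrand A B p
  rw [mul_apply, toKernel_symm_apply, Measure.volume_eq_prod, integral_prod _ hint]
  congr 1; ext ζ
  simp only [mulIntegrand]
  simp_rw [kernelComp_apply D.m_temp, Circle.smul_def, smul_eq_mul, integral_const_mul]

/-- The sesquilinear form of the operator with symbol `A`, in coordinates: `m` and its inverse are
the densities of the base and of the two fibers. -/
def form (A : 𝓢(E × E, ℂ)) (V U : 𝓢(E, ℂ)) : ℂ :=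
  ∫ p, D.m p * ∫ ϑ, ((D.m p)⁻¹ : ℝ) * (A (p, ϑ) * conj ((D.m p : ℂ) *
    ∫ ζ, 𝐞 (-⟪ζ, ϑ⟫) • (U (D.Φ (p, ζ)).1 * conj (V (D.Φ (p, ζ)).2))))

/-- The change of variables `Φ`. -/
theorem integral_comp_Φ (h : E × E → ℂ) : ∫ q, (D.jac q : ℂ) * h (D.Φ q) = ∫ r, h r := by
  have hinj : Function.Injective D.Φ := D.left_inv.injective
  have himg : D.Φ '' Set.univ = Set.univ :=
    Set.image_univ_of_surjective D.right_inv.surjective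
  have := integral_image_eq_integral_abs_det_fderiv_smul
    ((volume : Measure E).prod (volume : Measure E))
    MeasurableSet.univ (f' := fderiv ℝ D.Φ)
    (fun q _ => (D.Φ_temp.1.differentiable (by simp) q).hasFDerivAt.hasFDerivWithinAt)
    hinj.injOn h
  rw [himg, Measure.restrict_univ] at this
  rw [Measure.volume_eq_prod, this]
  rfl

/-- The operator with symbol `A` is the integral operator with kernel `D.toKernel A`. -/
theorem form_eq (A : 𝓢(E × E, ℂ)) (V U : 𝓢(E, ℂ)) :
    D.form A V U = ∫ x, D.m x * (kernelAct D.m (D.toKernel A) V x * conj (U x)) := by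
  let g : 𝓢(E × E, ℂ) := schwartzComp ℂ D.Φ_temp D.Ψ_temp D.left_inv
    (tensor U (conjSchwartz V))
  have hg : ∀ q, g q = U (D.Φ q).1 * conj (V (D.Φ q).2) := fun q => rfl
  let K := D.toKernel A
  -- Parseval in each fiber moves the Fourier transform from `g` to the symbol
  have hfib : ∀ p, ∫ ϑ, ((D.m p)⁻¹ : ℝ) * (A (p, ϑ) * conj ((D.m p : ℂ) *
      ∫ ζ, 𝐞 (-⟪ζ, ϑ⟫) • (U (D.Φ (p, ζ)).1 * conj (V (D.Φ (p, ζ)).2)))) =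
      ∫ ζ, partialFourierInv A (p, ζ) * conj (g (p, ζ)) := fun p => by
    have h1 := SchwartzMap.integral_sesq_fourier_eq (slice p g) (slice p A) (innerSL ℂ)
    simp only [innerSL_apply_apply, RCLike.inner_apply] at h1
    refine Eq.trans ?_ (h1.trans ?_)
    · congr 1; ext ϑ
      have h2 : 𝓕 (slice p g) ϑ =
          ∫ ζ, 𝐞 (-⟪ζ, ϑ⟫) • (U (D.Φ (p, ζ)).1 * conj (V (D.Φ (p, ζ)).2)) :=
        partialFourierFun_eq g (p, ϑ)
      rw [← h2, map_mul, Complex.conj_ofReal, slice_apply]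
      have h3 : (D.m p : ℂ) ≠ 0 := by exact_mod_cast (D.m_pos p).ne'
      push_cast
      field_simp
    · congr 1
  let H : 𝓢(E × E, ℂ) := mulTemperate (fun q : E × E => D.m q.1)
    (pullMul (ContinuousLinearMap.id ℝ (E × E)) (ContinuousLinearMap.id ℝ (E × E))
      (fun _ => le_add_of_nonneg_right (norm_nonneg _)) (partialFourierInv A) (conjSchwartz g))
  have hH : ∀ q, H q = D.m q.1 * (partialFourierInv A q * conj (g q)) := fun q =>
    mulTemperate_apply (D.m_temp.comp hasTemperateGrowth_fst) _ q
  have hmm : Function.HasTemperateGrowth fun w : E × E => D.m w.1 * D.m w.2 :=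
    (D.m_temp.comp hasTemperateGrowth_fst).mul (D.m_temp.comp hasTemperateGrowth_snd)
  let L : 𝓢(E × E, ℂ) := mulTemperate (fun q : E × E => D.m q.1 * D.m q.2)
    (pullMul (ContinuousLinearMap.id ℝ (E × E)) (ContinuousLinearMap.id ℝ (E × E))
      (fun _ => le_add_of_nonneg_right (norm_nonneg _)) K
      (tensor (conjSchwartz U) V))
  have hL : ∀ q, L q = ((D.m q.1 * D.m q.2 : ℝ) : ℂ) * (K q * (conj (U q.1) * V q.2)) := fun q =>
    mulTemperate_apply hmm _ q
  have hLH : ∀ q, (D.jac q : ℂ) * L (D.Φ q) = H q := fun q => by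
    have h1 : K (D.Φ q) = D.weight q * partialFourierInv A q := by
      rw [D.toKernel_apply, D.left_inv]
    rw [hL, hH, hg, h1, map_mul, Complex.conj_conj, weight]
    have hj : (D.jac q : ℂ) ≠ 0 := by exact_mod_cast (D.jac_pos q).ne'
    have h2 : (D.m (D.Φ q).1 : ℂ) ≠ 0 := by exact_mod_cast (D.m_pos _).ne'
    have h3 : (D.m (D.Φ q).2 : ℂ) ≠ 0 := by exact_mod_cast (D.m_pos _).ne'
    push_cast
    field_simp
  have hHint : Integrable (⇑H) (volume.prod volume) := H.integrable
  have hLint : Integrable (⇑L) (volume.prod volume) := L.integrable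
  calc D.form A V U = ∫ p, ∫ ζ, H (p, ζ) := by
        unfold form
        simp_rw [hfib, hH, integral_const_mul]
    _ = ∫ q, H q := by rw [Measure.volume_eq_prod, integral_prod _ hHint]
    _ = ∫ r, L r := by simp_rw [← hLH]; exact D.integral_comp_Φ L
    _ = ∫ x, ∫ y, L (x, y) := by rw [Measure.volume_eq_prod, integral_prod _ hLint]
    _ = _ := by
        congr 1; ext x
        rw [kernelAct_apply D.m_temp, ← integral_mul_const, ← integral_const_mul]
        congr 1; ext y
        rw [hL]; push_cast; ring

end QuantData
end Quantization

/-! ### The maps `Φ_λ` and `Φ_λ⁻¹` -/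

section PhiInverse

variable {n : ℕ} {M : Type*} [TopologicalSpace M] [ChartedSpace (Coord n) M]
  [IsManifold 𝓘(ℝ, Coord n) ∞ M]

theorem phiInv_zero (ψ : AbstractExp n M) (x y : M) : PhiInv ψ 0 x y = ⟨x, -ψ.log x y⟩ :=
  if_pos rfl

theorem phiInv_of_ne_zero (ψ : AbstractExp n M) {l : ℝ} (h : l ≠ 0) (x y : M) :
    PhiInv ψ l x y = ⟨ψ.toFun ⟨x, l • ψ.log x y⟩,
      l⁻¹ • ψ.log (ψ.toFun ⟨x, l • ψ.log x y⟩) x⟩ :=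
  if_neg h

theorem phi_mk (ψ : AbstractExp n M) (l : ℝ) (m : M) (ξ : TanSpace n m) :
    Phi ψ l ⟨m, ξ⟩ = (ψ.toFun ⟨m, l • ξ⟩, ψ.toFun ⟨m, (-(1 - l)) • ξ⟩) := rfl

/-- The base point `p` is a variable so that the equality `p = m` can be substituted. -/
theorem mk_smul_log_exp (ψ : AbstractExp n M) {p m : M} (h : p = m) (c : ℝ) (ξ : TanSpace n m) :
    (⟨p, c • ψ.log p (ψ.toFun ⟨m, ξ⟩)⟩ : TanBundle n M) = ⟨m, c • ξ⟩ := by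
  subst h
  rw [ψ.log_exp]

theorem phiInv_phi {ψ : AbstractExp n M} {l : ℝ} (hl : l ∈ Set.Icc (0 : ℝ) 1)
    (hsymm : l ∈ Set.Ioo (0 : ℝ) 1 → HypothesisHPsi ψ) (w : TanBundle n M) :
    PhiInv ψ l (Phi ψ l w).1 (Phi ψ l w).2 = w := by
  obtain ⟨m, ξ⟩ := w
  rw [phi_mk]
  dsimp only
  by_cases h0 : l = 0
  · subst h0
    rw [phiInv_zero, zero_smul, ψ.exp_zero, ψ.log_exp, sub_zero, neg_smul, one_smul, neg_neg]
  rw [phiInv_of_ne_zero ψ h0]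
  have key : ψ.toFun ⟨ψ.toFun ⟨m, l • ξ⟩, l • ψ.log (ψ.toFun ⟨m, l • ξ⟩)
      (ψ.toFun ⟨m, (-(1 - l)) • ξ⟩)⟩ = m := by
    by_cases h1 : l = 1
    · subst h1
      rw [sub_self, neg_zero, zero_smul, one_smul, one_smul, ψ.exp_zero, ψ.exp_log]
    -- `(H_ψ)` with parameter `(l - 1) / l`, which is `1 - l⁻¹`
    have hH := hsymm ⟨lt_of_le_of_ne hl.1 (Ne.symm h0), lt_of_le_of_ne hl.2 h1⟩ m
      (ψ.toFun ⟨m, l • ξ⟩) ((l - 1) / l)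
    rw [ψ.log_exp, smul_smul, div_mul_cancel₀ _ h0] at hH
    have h2 : 1 - (l - 1) / l = l⁻¹ := by field_simp; ring
    rw [h2] at hH
    have h3 : -(1 - l) = l - 1 := by ring
    rw [h3, hH, ψ.log_exp, smul_smul, mul_inv_cancel₀ h0, one_smul, ψ.exp_log]
  rw [mk_smul_log_exp ψ key, smul_smul, inv_mul_cancel₀ h0, one_smul]

theorem phi_phiInv {ψ : AbstractExp n M} {l : ℝ} (hl : l ∈ Set.Icc (0 : ℝ) 1)
    (hsymm : l ∈ Set.Ioo (0 : ℝ) 1 → HypothesisHPsi ψ) (x y : M) :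
    Phi ψ l (PhiInv ψ l x y) = (x, y) := by
  by_cases h0 : l = 0
  · subst h0
    rw [phiInv_zero, phi_mk, zero_smul, ψ.exp_zero, sub_zero, neg_smul, one_smul, neg_neg,
      ψ.exp_log]
  rw [phiInv_of_ne_zero ψ h0, phi_mk, smul_smul, mul_inv_cancel₀ h0, one_smul, ψ.exp_log,
    smul_smul]
  refine Prod.ext rfl ?_
  dsimp only
  by_cases h1 : l = 1
  · subst h1
    rw [sub_self, neg_zero, zero_mul, zero_smul, ψ.exp_zero, one_smul, ψ.exp_log]
  have hH := hsymm ⟨lt_of_le_of_ne hl.1 (Ne.symm h0), lt_of_le_of_ne hl.2 h1⟩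
    (ψ.toFun ⟨x, l • ψ.log x y⟩) x (-(1 - l) * l⁻¹)
  have h2 : 1 - -(1 - l) * l⁻¹ = l⁻¹ := by field_simp; ring
  rw [h2, ψ.log_exp, smul_smul, inv_mul_cancel₀ h0, one_smul, ψ.exp_log] at hH
  exact hH

/-- `Φ_{1-λ}` is `Φ_λ` composed with the swap of `M × M` and the antipode of `TM`. -/
theorem phi_one_sub (ψ : AbstractExp n M) (l : ℝ) (w : TanBundle n M) :
    Phi ψ (1 - l) ⟨w.1, -w.2⟩ = (Phi ψ l w).swap := by
  simp only [Phi, Prod.swap]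
  refine Prod.ext ?_ ?_
  · dsimp only; congr 2; rw [smul_neg, neg_smul]
  · dsimp only; congr 2; rw [smul_neg, neg_smul, neg_neg, sub_sub_cancel]

theorem phiInv_one_sub {ψ : AbstractExp n M} {l : ℝ} (hl : l ∈ Set.Icc (0 : ℝ) 1)
    (hsymm : l ∈ Set.Ioo (0 : ℝ) 1 → HypothesisHPsi ψ) (x y : M) :
    PhiInv ψ (1 - l) y x = ⟨(PhiInv ψ l x y).1, -(PhiInv ψ l x y).2⟩ := by
  have hl' : 1 - l ∈ Set.Icc (0 : ℝ) 1 := ⟨by linarith [hl.2], by linarith [hl.1]⟩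
  have hs' : 1 - l ∈ Set.Ioo (0 : ℝ) 1 → HypothesisHPsi ψ := fun h =>
    hsymm ⟨by linarith [h.2], by linarith [h.1]⟩
  have h := phiInv_phi hl' hs' ⟨(PhiInv ψ l x y).1, -(PhiInv ψ l x y).2⟩
  rw [phi_one_sub, phi_phiInv hl hsymm] at h
  exact h

end PhiInverse

/-! ### The coordinates of a normal frame -/

section Coordinates

variable {n : ℕ} {M : Type*} [TopologicalSpace M] [ChartedSpace (Coord n) M]
  [IsManifold 𝓘(ℝ, Coord n) ∞ M] (e : AbstractExp n M) (F : Frame n M)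

theorem tanChart_tanChartInv (q : Coord n × Coord n) : e.tanChart F (e.tanChartInv F q) = q :=
  Prod.ext ((e.chart F).apply_symm_apply q.1) ((e.tanCoord F _).apply_symm_apply q.2)

theorem tanChart_mk (x : M) (ξ : TanSpace n x) :
    e.tanChart F ⟨x, ξ⟩ = (e.chart F x, e.tanCoord F x ξ) := rfl

theorem tanChartInv_tanChart (w : TanBundle n M) : e.tanChartInv F (e.tanChart F w) = w := by
  have h : ∀ y : M, y = w.1 →
      (⟨y, (e.tanCoord F y).symm (e.tanCoord F w.1 w.2)⟩ : TanBundle n M) = w := by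
    rintro y rfl
    rw [ContinuousLinearEquiv.symm_apply_apply]
  exact h _ ((e.chart F).symm_apply_apply w.1)

theorem tanChartInv_tanCoord (X : Coord n) (ξ : TanSpace n ((e.chart F).symm X)) :
    e.tanChartInv F (X, e.tanCoord F _ ξ) = ⟨(e.chart F).symm X, ξ⟩ :=
  congrArg (Bundle.TotalSpace.mk _) ((e.tanCoord F _).symm_apply_apply ξ)

theorem tanChartInv_smul (x ζ : Coord n) (l : ℝ) :
    e.tanChartInv F (x, l • ζ) =
      ⟨(e.tanChartInv F (x, ζ)).1, l • (e.tanChartInv F (x, ζ)).2⟩ :=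
  congrArg (Bundle.TotalSpace.mk _) ((e.tanCoord F _).symm.map_smul l ζ)

theorem phiCoord_eq (ψ : AbstractExp n M) (l : ℝ) (q : Coord n × Coord n) :
    PhiCoord e ψ F l q = (e.chart F (ψ.toFun (e.tanChartInv F (q.1, l • q.2))),
      e.chart F (ψ.toFun (e.tanChartInv F (q.1, (-(1 - l)) • q.2)))) := by
  rw [tanChartInv_smul, tanChartInv_smul]
  rfl

/-- `Φ_λ⁻¹` read in a frame, as a map of `ℝ²ⁿ`. -/
def phiInvCoord (ψ : AbstractExp n M) (l : ℝ) (r : Coord n × Coord n) : Coord n × Coord n :=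
  e.tanChart F (PhiInv ψ l ((e.chart F).symm r.1) ((e.chart F).symm r.2))

variable {e F} {ψ : AbstractExp n M} {l : ℝ}

theorem phiInvCoord_phiCoord (hl : l ∈ Set.Icc (0 : ℝ) 1)
    (hsymm : l ∈ Set.Ioo (0 : ℝ) 1 → HypothesisHPsi ψ) :
    Function.LeftInverse (phiInvCoord e F ψ l) (PhiCoord e ψ F l) := fun q => by
  simp only [phiInvCoord, PhiCoord, Diffeomorph.symm_apply_apply]
  rw [phiInv_phi hl hsymm, tanChart_tanChartInv]

theorem phiCoord_phiInvCoord (hl : l ∈ Set.Icc (0 : ℝ) 1)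
    (hsymm : l ∈ Set.Ioo (0 : ℝ) 1 → HypothesisHPsi ψ) :
    Function.LeftInverse (PhiCoord e ψ F l) (phiInvCoord e F ψ l) := fun r => by
  simp only [phiInvCoord, PhiCoord]
  rw [tanChartInv_tanChart, phi_phiInv hl hsymm]
  simp

theorem phiCoord_hasTemperateGrowth (hψ : IsOMLinearization e ψ) :
    (PhiCoord e ψ F l).HasTemperateGrowth := by
  have hP := (hψ F).1
  have h : ∀ t : ℝ, Function.HasTemperateGrowth fun q : Coord n × Coord n => (q.1, t • q.2) :=
    fun t => hasTemperateGrowth_fst.prodMk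
      ((Function.HasTemperateGrowth.const t).smul hasTemperateGrowth_snd)
  have := (hP.comp (h l)).prodMk (hP.comp (h (-(1 - l))))
  rw [show PhiCoord e ψ F l = _ from funext (phiCoord_eq e F ψ l)]
  exact this

theorem phiInvCoord_hasTemperateGrowth (hψ : IsOMLinearization e ψ) :
    (phiInvCoord e F ψ l).HasTemperateGrowth := by
  obtain ⟨hP, hQ⟩ := hψ F
  by_cases h0 : l = 0
  · subst h0
    have h : phiInvCoord e F ψ 0 = fun r => (r.1, (-1 : ℝ) • e.tanCoord F ((e.chart F).symm r.1)
        (ψ.log ((e.chart F).symm r.1) ((e.chart F).symm r.2))) := by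
      funext r
      rw [phiInvCoord, phiInv_zero, tanChart_mk, map_neg, Diffeomorph.apply_symm_apply, neg_smul,
        one_smul]
    rw [h]
    have h2 := hasTemperateGrowth_fst.prodMk ((Function.HasTemperateGrowth.const (-1 : ℝ)).smul hQ)
    exact h2
  · have hN : Function.HasTemperateGrowth fun r : Coord n × Coord n => e.chart F (ψ.toFun
        (e.tanChartInv F (r.1, l • e.tanCoord F ((e.chart F).symm r.1)
          (ψ.log ((e.chart F).symm r.1) ((e.chart F).symm r.2))))) :=
      hP.comp (hasTemperateGrowth_fst.prodMk ((Function.HasTemperateGrowth.const l).smul hQ))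
    have h2 := hN.prodMk ((Function.HasTemperateGrowth.const l⁻¹).smul
      (hQ.comp (hN.prodMk hasTemperateGrowth_fst)))
    convert h2 using 1
    funext r
    have h3 : e.tanChartInv F (r.1, l • e.tanCoord F ((e.chart F).symm r.1)
        (ψ.log ((e.chart F).symm r.1) ((e.chart F).symm r.2))) =
        ⟨(e.chart F).symm r.1, l • ψ.log ((e.chart F).symm r.1) ((e.chart F).symm r.2)⟩ := by
      rw [← map_smul]
      exact tanChartInv_tanCoord e F _ _
    simp only [Pi.smul_apply', Function.comp_apply]
    rw [h3, phiInvCoord, phiInv_of_ne_zero ψ h0, tanChart_mk, map_smul,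
      Diffeomorph.symm_apply_apply]

/-- The data of the `λ`-quantization in the coordinates of the frame `F`. -/
def quantData {μ : Density n M} (hμ : IsOMDensity e μ) (hψ : IsOMLinearization e ψ)
    (hl : l ∈ Set.Icc (0 : ℝ) 1) (hsymm : l ∈ Set.Ioo (0 : ℝ) 1 → HypothesisHPsi ψ)
    (F : Frame n M) : QuantData (Coord n) where
  m := μ.coord e F
  Φ := PhiCoord e ψ F l
  Ψ := phiInvCoord e F ψ l
  m_pos := (hμ F).1
  m_temp := (hμ F).2.1
  m_inv_temp := (hμ F).2.2
  Φ_temp := phiCoord_hasTemperateGrowth hψ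
  Ψ_temp := phiInvCoord_hasTemperateGrowth hψ
  left_inv := phiInvCoord_phiCoord hl hsymm
  right_inv := phiCoord_phiInvCoord hl hsymm

end Coordinates

/-! ### Change of normal frame -/

section FrameChange

variable {n : ℕ} {M : Type*} [TopologicalSpace M] [ChartedSpace (Coord n) M]
  [IsManifold 𝓘(ℝ, Coord n) ∞ M] (e : AbstractExp n M) (F F' : Frame n M)

/-- The coordinate change from the normal chart of `F` to that of `F'`. -/
def transition (p : Coord n) : Coord n := e.chart F' ((e.chart F).symm p)

theorem transition_chart (x : M) : transition e F F' (e.chart F x) = e.chart F' x :=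
  congrArg (e.chart F') ((e.chart F).symm_apply_apply x)

theorem transition_transition (p : Coord n) :
    transition e F' F (transition e F F' p) = p := by
  simp [transition]

theorem contDiff_transition : ContDiff ℝ ∞ (transition e F F') :=
  contMDiff_iff_contDiff.1 ((e.chart F').contMDiff.comp (e.chart F).symm.contMDiff)

theorem hasFDerivAt_transition (p : Coord n) :
    HasFDerivAt (transition e F F') (fderiv ℝ (transition e F F') p) p :=
  ((contDiff_transition e F F').differentiable (by simp) p).hasFDerivAt

/-- The chain rule for the normal charts. -/
theorem tanCoord_eq_fderiv_transition (x : M) (v : TanSpace n x) :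
    e.tanCoord F' x v = fderiv ℝ (transition e F F') (e.chart F x) (e.tanCoord F x v) := by
  have h1 : (transition e F F') ∘ (e.chart F) = e.chart F' := funext (transition_chart e F F')
  have h2 : MDifferentiableAt 𝓘(ℝ, Coord n) 𝓘(ℝ, Coord n) (transition e F F') (e.chart F x) :=
    ((contDiff_transition e F F').differentiable (by simp) _).mdifferentiableAt
  have h3 : MDifferentiableAt 𝓘(ℝ, Coord n) 𝓘(ℝ, Coord n) (e.chart F) x :=
    (e.chart F).contMDiff.mdifferentiableAt (by simp)
  have h4 := mfderiv_comp x h2 h3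
  rw [h1, mfderiv_eq_fderiv] at h4
  exact DFunLike.congr_fun h4 v

theorem det_fderiv_transition_mul (p : Coord n) :
    (fderiv ℝ (transition e F' F) (transition e F F' p)).det *
      (fderiv ℝ (transition e F F') p).det = 1 := by
  have h1 := (hasFDerivAt_transition e F' F (transition e F F' p)).comp p
    (hasFDerivAt_transition e F F' p)
  have h2 : transition e F' F ∘ transition e F F' = id := funext (transition_transition e F F')
  rw [h2] at h1
  have h4 := congrArg ContinuousLinearMap.det (h1.unique (hasFDerivAt_id p))
  simpa [ContinuousLinearMap.det, LinearMap.det_comp] using h4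

theorem det_fderiv_transition_ne_zero (p : Coord n) :
    (fderiv ℝ (transition e F F') p).det ≠ 0 :=
  right_ne_zero_of_mul_eq_one (det_fderiv_transition_mul e F F' p)

theorem Density.coord_chart (μ : Density n M) (x : M) : μ.coord e F (e.chart F x) =
    μ.toFun x (fun i => (e.tanCoord F x).symm (EuclideanSpace.single i 1)) := by
  have h : ∀ y : M, y = x →
      μ.toFun y (fun i => (e.tanCoord F y).symm (EuclideanSpace.single i 1)) =
      μ.toFun x (fun i => (e.tanCoord F x).symm (EuclideanSpace.single i 1)) := by
    rintro y rfl; rfl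
  exact h _ ((e.chart F).symm_apply_apply x)

/-- The transformation rule of the density under a change of frame. -/
theorem Density.coord_transition (μ : Density n M) (x : M) :
    μ.coord e F (e.chart F x) =
      |(fderiv ℝ (transition e F F') (e.chart F x)).det| * μ.coord e F' (e.chart F' x) := by
  rw [μ.coord_chart, μ.coord_chart]
  -- the endomorphism of `T_x M` which maps the coordinate vectors of `F'` to those of `F`
  let B : TanSpace n x →ₗ[ℝ] TanSpace n x :=
    (e.tanCoord F x).symm.toLinearEquiv.toLinearMap ∘ₗ
      (e.tanCoord F' x).toLinearEquiv.toLinearMap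
  have hB : (fun i => (e.tanCoord F x).symm (EuclideanSpace.single i (1 : ℝ))) =
      fun i => B ((e.tanCoord F' x).symm (EuclideanSpace.single i 1)) := by
    funext i
    exact congrArg (e.tanCoord F x).symm ((e.tanCoord F' x).apply_symm_apply _).symm
  rw [hB, μ.map_linear]
  congr 2
  rw [← LinearMap.det_conj B (e.tanCoord F x).toLinearEquiv]
  have h : (e.tanCoord F x).toLinearEquiv.toLinearMap ∘ₗ B ∘ₗ
      (e.tanCoord F x).toLinearEquiv.symm.toLinearMap =
      (fderiv ℝ (transition e F F') (e.chart F x) : Coord n →ₗ[ℝ] Coord n) := by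
    ext1 v
    refine ((e.tanCoord F x).apply_symm_apply _).trans ?_
    refine (tanCoord_eq_fderiv_transition e F F' x _).trans ?_
    exact congrArg _ ((e.tanCoord F x).apply_symm_apply v)
  exact congrArg LinearMap.det h

end FrameChange

/-! ### The measures do not depend on the frame -/

section Measures

variable {n : ℕ} {M : Type*} [TopologicalSpace M] [ChartedSpace (Coord n) M]
  [IsManifold 𝓘(ℝ, Coord n) ∞ M] (e : AbstractExp n M) (F F' : Frame n M)

instance instBorelSpaceTan (x : M) : BorelSpace (TanSpace n x) := ⟨rfl⟩

instance instBorelSpaceCot (x : M) : BorelSpace (CotSpace n x) := ⟨rfl⟩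

theorem measurable_chart_symm [MeasurableSpace M] [BorelSpace M] :
    Measurable (e.chart F).symm :=
  (e.chart F).symm.continuous.measurable

theorem continuous_transition : Continuous (transition e F F') :=
  (contDiff_transition e F F').continuous

variable {e} {μ : Density n M}

theorem map_transition_withDensity (hμ : IsOMDensity e μ) :
    ((volume : Measure (Coord n)).withDensity
      (fun p => ENNReal.ofReal (μ.coord e F p))).map (transition e F F') =
      (volume : Measure (Coord n)).withDensity (fun p => ENNReal.ofReal (μ.coord e F' p)) := by
  have hc : ∀ F : Frame n M, Measurable fun p => ENNReal.ofReal (μ.coord e F p) := fun F =>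
    ((hμ F).2.1.1.continuous.measurable).ennreal_ofReal
  have hm : Measurable (transition e F F') := (continuous_transition e F F').measurable
  ext S hS
  rw [Measure.map_apply hm hS, withDensity_apply _ (hm hS), withDensity_apply _ hS]
  have hinj : Function.Injective (transition e F F') :=
    Function.LeftInverse.injective (g := transition e F' F) (transition_transition e F F')
  have himg : transition e F F' '' (transition e F F' ⁻¹' S) = S :=
    Set.image_preimage_eq S
      (Function.RightInverse.surjective (g := transition e F' F) (transition_transition e F' F))
  have h := lintegral_image_eq_lintegral_abs_det_fderiv_mul volume (hm hS)
    (fun p _ => (hasFDerivAt_transition e F F' p).hasFDerivWithinAt) hinj.injOn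
    (fun p => ENNReal.ofReal (μ.coord e F' p))
  rw [himg] at h
  rw [h]
  congr 1; ext p
  rw [← ENNReal.ofReal_mul (abs_nonneg _)]
  congr 1
  have h2 := μ.coord_transition e F F' ((e.chart F).symm p)
  rw [Diffeomorph.apply_symm_apply] at h2
  exact h2

theorem Density.vol_eq [MeasurableSpace M] [BorelSpace M] (hμ : IsOMDensity e μ) :
    μ.vol e F = μ.vol e F' := by
  have h : (e.chart F).symm = (e.chart F').symm ∘ transition e F F' := by
    funext p
    simp [transition]
  rw [Density.vol, Density.vol, ← map_transition_withDensity F F' hμ,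
    Measure.map_map (measurable_chart_symm e F') (continuous_transition e F F').measurable]
  exact congrArg (fun f => Measure.map f _) h

theorem Density.tan_eq (hμ : IsOMDensity e μ) (x : M) : μ.tan e F x = μ.tan e F' x := by
  set L := fderiv ℝ (transition e F F') (e.chart F x) with hL
  have hdet : L.det ≠ 0 := det_fderiv_transition_ne_zero e F F' _
  have h : ((e.tanCoord F x).symm : Coord n → TanSpace n x) =
      (e.tanCoord F' x).symm ∘ (L : Coord n →ₗ[ℝ] Coord n) := by
    funext ζ
    refine (e.tanCoord F' x).injective ?_
    refine (tanCoord_eq_fderiv_transition e F F' x _).trans ?_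
    refine Eq.trans ?_ ((e.tanCoord F' x).apply_symm_apply _).symm
    exact congrArg L ((e.tanCoord F x).apply_symm_apply ζ)
  have hm : Measurable ((e.tanCoord F' x).symm : Coord n → TanSpace n x) :=
    (e.tanCoord F' x).symm.continuous.measurable
  have hmL : Measurable (L : Coord n →ₗ[ℝ] Coord n) := L.continuous.measurable
  unfold Density.tan
  rw [h, ← Measure.map_map hm hmL, Measure.map_linearMap_addHaar_eq_smul_addHaar _ hdet,
    Measure.map_smul, smul_smul, ← ENNReal.ofReal_mul ((hμ F).1 _).le,
    μ.coord_transition e F F' x, ← hL, abs_inv]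
  congr 2
  have : |L.det| ≠ 0 := abs_ne_zero.2 hdet
  change |L.det| * _ * |L.det|⁻¹ = _
  field_simp

/-- Covectors transform by the adjoint of the derivative of the coordinate change. -/
theorem cotCoordInv_eq_adjoint (x : M) (ϑ : Coord n) : e.cotCoordInv F' x ϑ =
    e.cotCoordInv F x (ContinuousLinearMap.adjoint
      (fderiv ℝ (transition e F F') (e.chart F x)) ϑ) := by
  ext v
  change inner ℝ ϑ (e.tanCoord F' x v) = inner ℝ _ (e.tanCoord F x v)
  rw [ContinuousLinearMap.adjoint_inner_left, tanCoord_eq_fderiv_transition e F F']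

theorem continuous_cotCoordInv (x : M) : Continuous (e.cotCoordInv F x) := by
  let φ : Coord n →ₗ[ℝ] CotSpace n x :=
    { toFun := e.cotCoordInv F x
      map_add' := fun a b => by ext v; simp [AbstractExp.cotCoordInv]
      map_smul' := fun a b => by ext v; simp [AbstractExp.cotCoordInv] }
  exact φ.continuous_of_finiteDimensional

theorem det_adjoint (L : Coord n →L[ℝ] Coord n) :
    (ContinuousLinearMap.adjoint L).det = L.det := by
  let b := EuclideanSpace.basisFun (Fin n) ℝ
  have h1 : ((ContinuousLinearMap.adjoint L : Coord n →L[ℝ] Coord n) : Coord n →ₗ[ℝ] Coord n) =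
    LinearMap.adjoint (L : Coord n →ₗ[ℝ] Coord n) := by
    exact (ContinuousLinearMap.adjoint_toLinearMap L).symm
  rw [ContinuousLinearMap.det, ContinuousLinearMap.det, h1, ← LinearMap.det_toMatrix b.toBasis,
    LinearMap.toMatrix_adjoint, Matrix.det_conjTranspose, star_trivial, LinearMap.det_toMatrix]

theorem Density.cot_eq (hμ : IsOMDensity e μ) (x : M) : μ.cot e F x = μ.cot e F' x := by
  set L := fderiv ℝ (transition e F F') (e.chart F x) with hL
  have hdet : L.det ≠ 0 := det_fderiv_transition_ne_zero e F F' _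
  set L' := ContinuousLinearMap.adjoint L with hL'
  have hdet' : LinearMap.det (L' : Coord n →ₗ[ℝ] Coord n) = L.det := det_adjoint L
  have h : e.cotCoordInv F' x = e.cotCoordInv F x ∘ (L' : Coord n →ₗ[ℝ] Coord n) :=
    funext (cotCoordInv_eq_adjoint F F' x)
  have hmL : Measurable (L' : Coord n →ₗ[ℝ] Coord n) := L'.continuous.measurable
  unfold Density.cot
  rw [h, ← Measure.map_map (continuous_cotCoordInv F x).measurable hmL,
    Measure.map_linearMap_addHaar_eq_smul_addHaar _ (by rwa [hdet']),
    Measure.map_smul, smul_smul, ← ENNReal.ofReal_mul (inv_nonneg.2 ((hμ F').1 _).le),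
    μ.coord_transition e F F' x, ← hL, hdet', abs_inv]
  congr 2
  rw [mul_inv, mul_comm]

end Measures

/-! ### Schwartz functions on the manifold and on its cotangent bundle -/

section SchwartzSpaces

variable {n : ℕ} {M : Type*} [TopologicalSpace M] [ChartedSpace (Coord n) M]
  [IsManifold 𝓘(ℝ, Coord n) ∞ M] {e : AbstractExp n M}

theorem transition_hasTemperateGrowth (hgeom : OMBounded e) (F F' : Frame n M) :
    (transition e F F').HasTemperateGrowth :=
  hgeom F' F

/-- A function which is a Schwartz function in one normal chart is one in all of them. -/
theorem isSchwartz_of_chart (hgeom : OMBounded e) (F : Frame n M) (f : 𝓢(Coord n, ℂ)) :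
    IsSchwartz e fun x => f (e.chart F x) := fun F' =>
  ⟨schwartzComp ℂ (transition_hasTemperateGrowth hgeom F' F)
    (transition_hasTemperateGrowth hgeom F F') (transition_transition e F' F) f, fun _ => rfl⟩

/-- The chart of `T^*M` inverse to `AbstractExp.cotChartInv`. -/
def cotChart (e : AbstractExp n M) (F : Frame n M) (w : CotBundle n M) : Coord n × Coord n :=
  (e.chart F w.1, (InnerProductSpace.toDual ℝ (Coord n)).symm
    (w.2.comp ((e.tanCoord F w.1).symm : Coord n →L[ℝ] TanSpace n w.1)))

theorem cotCoordInv_apply (F : Frame n M) (x : M) (ϑ : Coord n) (v : TanSpace n x) :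
    e.cotCoordInv F x ϑ v = inner ℝ ϑ (e.tanCoord F x v) := rfl

theorem cotCoordInv_toDual_symm (F : Frame n M) (x : M) (θ : CotSpace n x) :
    e.cotCoordInv F x ((InnerProductSpace.toDual ℝ (Coord n)).symm
      (θ.comp ((e.tanCoord F x).symm : Coord n →L[ℝ] TanSpace n x))) = θ := by
  ext v
  rw [cotCoordInv_apply, InnerProductSpace.toDual_symm_apply]
  exact congrArg θ ((e.tanCoord F x).symm_apply_apply v)

theorem cotChart_cotChartInv (F : Frame n M) (q : Coord n × Coord n) :
    cotChart e F (e.cotChartInv F q) = q := by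
  refine Prod.ext ((e.chart F).apply_symm_apply q.1) ?_
  refine (LinearIsometryEquiv.symm_apply_eq _).2 ?_
  ext v
  rw [InnerProductSpace.toDual_apply_apply]
  exact congrArg (inner ℝ q.2) ((e.tanCoord F _).apply_symm_apply v)

theorem cotChartInv_chart (F : Frame n M) (x : M) (ϑ : Coord n) :
    e.cotChartInv F (e.chart F x, ϑ) = ⟨x, e.cotCoordInv F x ϑ⟩ := by
  have h : ∀ y : M, y = x →
      (⟨y, e.cotCoordInv F y ϑ⟩ : CotBundle n M) = ⟨x, e.cotCoordInv F x ϑ⟩ := by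
    rintro y rfl; rfl
  exact h _ ((e.chart F).symm_apply_apply x)

theorem cotChartInv_cotChart (F : Frame n M) (w : CotBundle n M) :
    e.cotChartInv F (cotChart e F w) = w := by
  rw [cotChart, cotChartInv_chart, cotCoordInv_toDual_symm]

/-- The adjoint as a real linear map. -/
def adjointCLM (n : ℕ) : (Coord n →L[ℝ] Coord n) →L[ℝ] (Coord n →L[ℝ] Coord n) :=
  LinearMap.toContinuousLinearMap
    { toFun := fun L => ContinuousLinearMap.adjoint L
      map_add' := fun L L' => map_add _ L L'
      map_smul' := fun c L => by simp }

/-- The coordinate change from the chart of `T^*M` given by `F'` to the one given by `F`. -/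
def cotTransition (e : AbstractExp n M) (F' F : Frame n M) (q : Coord n × Coord n) :
    Coord n × Coord n :=
  (transition e F' F q.1,
    adjointCLM n (fderiv ℝ (transition e F F') (transition e F' F q.1)) q.2)

theorem cotChartInv_cotTransition (F F' : Frame n M) (q : Coord n × Coord n) :
    e.cotChartInv F (cotTransition e F' F q) = e.cotChartInv F' q := by
  have h := cotChartInv_chart (e := e) F ((e.chart F').symm q.1)
    (ContinuousLinearMap.adjoint
      (fderiv ℝ (transition e F F') (e.chart F ((e.chart F').symm q.1))) q.2)
  rw [← cotCoordInv_eq_adjoint] at h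
  exact h

theorem cotTransition_cotTransition (F F' : Frame n M) :
    Function.LeftInverse (cotTransition e F F') (cotTransition e F' F) := fun q => by
  rw [← cotChart_cotChartInv (e := e) F' (cotTransition e F F' (cotTransition e F' F q)),
    cotChartInv_cotTransition, cotChartInv_cotTransition, cotChart_cotChartInv]

theorem cotTransition_hasTemperateGrowth (hgeom : OMBounded e) (F F' : Frame n M) :
    (cotTransition e F' F).HasTemperateGrowth := by
  have h1 : Function.HasTemperateGrowth fun q : Coord n × Coord n => transition e F' F q.1 :=
    (transition_hasTemperateGrowth hgeom F' F).comp hasTemperateGrowth_fst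
  have h2 := (adjointCLM n).hasTemperateGrowth.comp
    ((transition_hasTemperateGrowth hgeom F F').fderiv.comp h1)
  exact h1.prodMk (h2.clm_apply hasTemperateGrowth_snd)

theorem toCoord_apply (F : Frame n M) (a : SchwartzCot e) (q : Coord n × Coord n) :
    a.toCoord F q = a (e.cotChartInv F q) :=
  Classical.choose_spec (Subtype.property (p := fun a => a ∈ schwartzCotSubmodule e) a F) q

theorem apply_eq_toCoord (F : Frame n M) (a : SchwartzCot e) (w : CotBundle n M) :
    a w = a.toCoord F (cotChart e F w) := by
  rw [toCoord_apply, cotChartInv_cotChart]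

/-- Pulling back a Schwartz function along the coordinate change between charts of `T^*M`. -/
def cotPull (hgeom : OMBounded e) (F F' : Frame n M) :
    𝓢(Coord n × Coord n, ℂ) →L[ℂ] 𝓢(Coord n × Coord n, ℂ) :=
  schwartzComp ℂ (cotTransition_hasTemperateGrowth hgeom F F')
    (cotTransition_hasTemperateGrowth hgeom F' F) (cotTransition_cotTransition F F')

theorem cotPull_toCoord (hgeom : OMBounded e) (F F' : Frame n M) (a : SchwartzCot e) :
    cotPull hgeom F F' (a.toCoord F) = a.toCoord F' := by
  ext q
  rw [cotPull, schwartzComp_apply, toCoord_apply, toCoord_apply, cotChartInv_cotTransition]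

/-- The identification of `𝒮(T^*M)` with `𝒮(ℝ²ⁿ)` given by a normal frame. -/
def coordEquiv (hgeom : OMBounded e) (F : Frame n M) :
    SchwartzCot e ≃ₗ[ℂ] 𝓢(Coord n × Coord n, ℂ) where
  toFun := SchwartzCot.toCoord F
  map_add' a b := by
    ext q
    rw [add_apply, toCoord_apply, toCoord_apply, toCoord_apply]
    rfl
  map_smul' c a := by
    ext q
    rw [RingHom.id_apply, smul_apply, toCoord_apply, toCoord_apply]
    rfl
  invFun f := ⟨fun w => f (cotChart e F w), fun F' => ⟨cotPull hgeom F F' f, fun q => by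
    rw [cotPull, schwartzComp_apply, ← cotChartInv_cotTransition F F']
    exact congrArg f (cotChart_cotChartInv F _).symm⟩⟩
  left_inv a := Subtype.ext (funext fun w => (apply_eq_toCoord F a w).symm)
  right_inv f := by
    ext q
    exact (toCoord_apply F _ q).trans (congrArg f (cotChart_cotChartInv F q))

/-- One normal frame suffices to define the topology of `𝒮(T^*M)`. -/
theorem isUniformInducing_coordEquiv (hgeom : OMBounded e) (F : Frame n M) :
    IsUniformInducing (coordEquiv hgeom F) := by
  rw [isUniformInducing_iff_uniformSpace]
  refine le_antisymm (le_iInf fun F' => ?_) (iInf_le _ F)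
  have h : (SchwartzCot.toCoord F' : SchwartzCot e → _) =
      cotPull hgeom F F' ∘ coordEquiv hgeom F :=
    funext fun a => (cotPull_toCoord hgeom F F' a).symm
  rw [h]
  refine le_of_le_of_eq ?_ UniformSpace.comap_comap.symm
  exact UniformSpace.comap_mono (cotPull hgeom F F').uniformContinuous.le_comap

/-- The identification of `𝒮(T^*M)` with `𝒮(ℝ²ⁿ)` is an isomorphism of uniform spaces. -/
def coordUniformEquiv (hgeom : OMBounded e) (F : Frame n M) :
    SchwartzCot e ≃ᵤ 𝓢(Coord n × Coord n, ℂ) :=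
  (coordEquiv hgeom F).toEquiv.toUniformEquivOfIsUniformInducing
    (isUniformInducing_coordEquiv hgeom F)

theorem isFrechetSpace_schwartzCot (hgeom : OMBounded e) (F : Frame n M) :
    IsFrechetSpace (SchwartzCot e) where
  isUniformAddGroup := (isUniformInducing_coordEquiv hgeom F).isUniformAddGroup
    (coordEquiv hgeom F)
  seminorms :=
    ⟨_, ((isUniformInducing_coordEquiv hgeom F).isInducing.withSeminorms
      (f := (coordEquiv hgeom F : SchwartzCot e →ₗ[ℂ] 𝓢(Coord n × Coord n, ℂ)))
      (schwartz_withSeminorms ℂ (Coord n × Coord n) ℂ)).congr_equiv Nat.pairEquiv.symm⟩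
  t2 := (coordUniformEquiv hgeom F).toHomeomorph.symm.t2Space
  complete := (coordUniformEquiv hgeom F).completeSpace_iff.2 inferInstance

end SchwartzSpaces

/-! ### Integrals and operators in coordinates -/

section CoordinateIntegrals

open scoped ComplexConjugate FourierTransform RealInnerProductSpace

variable {n : ℕ} {M : Type*} [TopologicalSpace M] [ChartedSpace (Coord n) M]
  [IsManifold 𝓘(ℝ, Coord n) ∞ M] {e : AbstractExp n M} {μ : Density n M}

theorem measurableEmbedding_chart_symm [MeasurableSpace M] [BorelSpace M] (F : Frame n M) :
    MeasurableEmbedding (e.chart F).symm :=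
  (e.chart F).symm.toHomeomorph.measurableEmbedding

theorem measurableEmbedding_tanCoord_symm (F : Frame n M) (x : M) :
    MeasurableEmbedding (e.tanCoord F x).symm :=
  (e.tanCoord F x).symm.toHomeomorph.measurableEmbedding

theorem measurableEmbedding_cotCoordInv (F : Frame n M) (x : M) :
    MeasurableEmbedding (e.cotCoordInv F x) := by
  let φ : Coord n ≃ₜ CotSpace n x :=
    { toFun := e.cotCoordInv F x
      invFun := fun θ => (InnerProductSpace.toDual ℝ (Coord n)).symm
        (θ.comp ((e.tanCoord F x).symm : Coord n →L[ℝ] TanSpace n x))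
      left_inv := fun ϑ => by
        refine (LinearIsometryEquiv.symm_apply_eq _).2 ?_
        ext v
        exact congrArg (inner ℝ ϑ) ((e.tanCoord F x).apply_symm_apply v)
      right_inv := cotCoordInv_toDual_symm F x
      continuous_toFun := continuous_cotCoordInv F x
      continuous_invFun := (InnerProductSpace.toDual ℝ (Coord n)).symm.continuous.comp
        (ContinuousLinearMap.precomp ℝ
          ((e.tanCoord F x).symm : Coord n →L[ℝ] TanSpace n x)).continuous }
  exact φ.measurableEmbedding

theorem measurable_ofReal_coord (hμ : IsOMDensity e μ) (F : Frame n M) :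
    Measurable fun p => ENNReal.ofReal (μ.coord e F p) :=
  ((hμ F).2.1.1.continuous.measurable).ennreal_ofReal

theorem integral_vol [MeasurableSpace M] [BorelSpace M] (hμ : IsOMDensity e μ) (F : Frame n M)
    (g : M → ℂ) :
    ∫ x, g x ∂(μ.vol e F) = ∫ p, (μ.coord e F p : ℂ) * g ((e.chart F).symm p) := by
  rw [Density.vol, (measurableEmbedding_chart_symm F).integral_map,
    integral_withDensity_eq_integral_toReal_smul (measurable_ofReal_coord hμ F)
      (Filter.Eventually.of_forall fun _ => ENNReal.ofReal_lt_top)]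
  congr 1; ext p
  rw [ENNReal.toReal_ofReal ((hμ F).1 p).le, Complex.real_smul]

theorem integral_tan (hμ : IsOMDensity e μ) (F : Frame n M) (x : M) (g : TanSpace n x → ℂ) :
    ∫ ξ, g ξ ∂(μ.tan e F x) =
      (μ.coord e F (e.chart F x) : ℂ) * ∫ ζ, g ((e.tanCoord F x).symm ζ) := by
  rw [Density.tan, integral_smul_measure, (measurableEmbedding_tanCoord_symm F x).integral_map,
    ENNReal.toReal_ofReal ((hμ F).1 _).le, Complex.real_smul]

theorem integral_cot (hμ : IsOMDensity e μ) (F : Frame n M) (x : M) (g : CotSpace n x → ℂ) :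
    ∫ θ, g θ ∂(μ.cot e F x) =
      ((μ.coord e F (e.chart F x))⁻¹ : ℝ) * ∫ ϑ, g (e.cotCoordInv F x ϑ) := by
  rw [Density.cot, integral_smul_measure, (measurableEmbedding_cotCoordInv F x).integral_map,
    ENNReal.toReal_ofReal (inv_nonneg.2 ((hμ F).1 _).le), Complex.real_smul]

theorem integrable_cot_iff (hμ : IsOMDensity e μ) (F : Frame n M) (x : M) {g : CotSpace n x → ℂ} :
    Integrable g (μ.cot e F x) ↔ Integrable fun ϑ => g (e.cotCoordInv F x ϑ) := by
  rw [Density.cot, integrable_smul_measure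
    (ENNReal.ofReal_pos.2 (inv_pos.2 ((hμ F).1 _))).ne' ENNReal.ofReal_ne_top,
    (measurableEmbedding_cotCoordInv F x).integrable_map_iff]
  rfl

theorem cotCoordInv_tanCoord_symm (F : Frame n M) (x : M) (ϑ ζ : Coord n) :
    e.cotCoordInv F x ϑ ((e.tanCoord F x).symm ζ) = inner ℝ ϑ ζ :=
  congrArg (inner ℝ ϑ) ((e.tanCoord F x).apply_symm_apply ζ)

theorem fourierChar_smul_eq (t : ℝ) (z : ℂ) :
    𝐞 t • z = Complex.exp (2 * Real.pi * Complex.I * t) * z := by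
  rw [Circle.smul_def, Real.fourierChar_apply, smul_eq_mul]
  congr 2
  push_cast
  ring

variable {ψ : AbstractExp n M} {l : ℝ}

theorem fourier_cotChartInv (hμ : IsOMDensity e μ) (F : Frame n M) (g : TanBundle n M → ℂ)
    (q : Coord n × Coord n) : fourier e μ F g (e.cotChartInv F q) =
      (μ.coord e F q.1 : ℂ) * ∫ ζ, 𝐞 (-⟪ζ, q.2⟫) • g (e.tanChartInv F (q.1, ζ)) := by
  refine (integral_tan hμ F ((e.chart F).symm q.1) _).trans ?_
  rw [Diffeomorph.apply_symm_apply]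
  congr 2; ext ζ
  rw [fourierChar_smul_eq]
  have h : (e.cotChartInv F q).2 ((e.tanCoord F ((e.chart F).symm q.1)).symm ζ) = ⟪ζ, q.2⟫ :=
    (cotCoordInv_tanCoord_symm F _ q.2 ζ).trans (real_inner_comm _ _)
  congr 2
  rw [h]
  push_cast
  ring

variable (hμ : IsOMDensity e μ) (hψ : IsOMLinearization e ψ) (hl : l ∈ Set.Icc (0 : ℝ) 1)
  (hsymm : l ∈ Set.Ioo (0 : ℝ) 1 → HypothesisHPsi ψ)

/-- The quantization in coordinates. -/
theorem opPairing_eq_form [MeasurableSpace M] [BorelSpace M] (F : Frame n M)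
    (a : SchwartzCot e) {v u : M → ℂ} {V U : 𝓢(Coord n, ℂ)}
    (hV : ∀ p, V p = v ((e.chart F).symm p)) (hU : ∀ p, U p = u ((e.chart F).symm p)) :
    opPairing e ψ μ F l a v u = (quantData hμ hψ hl hsymm F).form (a.toCoord F) V U := by
  rw [opPairing, integral_vol hμ, QuantData.form]
  congr 1; ext p
  congr 1
  rw [integral_cot hμ, Diffeomorph.apply_symm_apply, ← integral_const_mul]
  congr 1; ext ϑ
  congr 1
  rw [toCoord_apply]
  refine congrArg (fun z => a (e.cotChartInv F (p, ϑ)) * conj z) ?_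
  refine (fourier_cotChartInv hμ F _ (p, ϑ)).trans ?_
  congr 2; ext ζ
  congr 1
  rw [hU, hV]
  simp [quantData, PhiCoord]

theorem pairing_eq [MeasurableSpace M] [BorelSpace M] (hμ : IsOMDensity e μ) (F : Frame n M)
    {w u : M → ℂ} {W U : 𝓢(Coord n, ℂ)}
    (hW : ∀ p, W p = w ((e.chart F).symm p)) (hU : ∀ p, U p = u ((e.chart F).symm p)) :
    pairing e μ F w u = ∫ p, μ.coord e F p * (W p * conj (U p)) := by
  rw [pairing, integral_vol hμ]
  simp_rw [hW, hU]

end CoordinateIntegrals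

/-! ### The `λ`-product in coordinates -/

section Product

open scoped ComplexConjugate

/-- Schwartz functions are separated by their weighted pairings with Schwartz functions. -/
theorem ext_of_integral_mul_conj {E : Type} [NormedAddCommGroup E] [InnerProductSpace ℝ E]
    [FiniteDimensional ℝ E] [MeasurableSpace E] [BorelSpace E] {m : E → ℝ}
    (hm : m.HasTemperateGrowth) (hpos : ∀ y, 0 < m y) {v w : 𝓢(E, ℂ)}
    (h : ∀ u : 𝓢(E, ℂ), ∫ y, m y * (v y * conj (u y)) = ∫ y, m y * (w y * conj (u y))) :
    v = w := by
  have hint : ∀ v u : 𝓢(E, ℂ), Integrable fun y => (m y : ℂ) * (v y * conj (u y)) := fun v u => by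
    have h1 := (mulTemperate m (pullMul (ContinuousLinearMap.id ℝ E) (ContinuousLinearMap.id ℝ E)
      (fun w => le_add_of_nonneg_left (norm_nonneg _)) v (conjSchwartz u))).integrable
        (μ := volume)
    refine h1.congr (Filter.Eventually.of_forall fun y => ?_)
    exact mulTemperate_apply hm _ y
  refine sub_eq_zero.1 (eq_zero_of_integral_mul_conj_eq_zero hm hpos (v - w) ?_)
  rw [← sub_eq_zero.2 (h (v - w)), ← integral_sub (hint _ _) (hint _ _)]
  congr 1; ext y
  rw [sub_apply]
  ring

/-- The product of symbols is characterized by the composition of the operators. The function `W` is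
necessarily the image of `V` under the operator with symbol `B`. -/
theorem QuantData.eq_mul_iff {E : Type} [NormedAddCommGroup E] [InnerProductSpace ℝ E]
    [FiniteDimensional ℝ E] [MeasurableSpace E] [BorelSpace E] (D : QuantData E)
    (A B C : 𝓢(E × E, ℂ)) :
    (∀ V : 𝓢(E, ℂ), ∃ W : 𝓢(E, ℂ),
      (∀ U, D.form B V U = ∫ x, D.m x * (W x * conj (U x))) ∧
      ∀ U, D.form C V U = D.form A W U) ↔ C = D.mul A B := by
  constructor
  · intro h
    apply D.toKernel.injective
    rw [D.toKernel_mul]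
    apply kernelAct_injective D.m_temp D.m_pos
    refine LinearMap.ext fun V => ?_
    obtain ⟨W, hW, hC⟩ := h V
    have h1 : kernelAct D.m (D.toKernel B) V = W :=
      ext_of_integral_mul_conj D.m_temp D.m_pos fun U => (D.form_eq B V U).symm.trans (hW U)
    rw [kernelAct_kernelComp D.m_temp, h1]
    exact ext_of_integral_mul_conj D.m_temp D.m_pos fun U =>
      (D.form_eq C V U).symm.trans ((hC U).trans (D.form_eq A W U))
  · rintro rfl V
    refine ⟨kernelAct D.m (D.toKernel B) V, D.form_eq B V, fun U => ?_⟩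
    rw [D.form_eq, D.form_eq, D.toKernel_mul, kernelAct_kernelComp D.m_temp]

variable {n : ℕ} {M : Type*} [TopologicalSpace M] [ChartedSpace (Coord n) M]
  [IsManifold 𝓘(ℝ, Coord n) ∞ M] [MeasurableSpace M] [BorelSpace M]
  {e : AbstractExp n M} {μ : Density n M} {ψ : AbstractExp n M} {l : ℝ}

/-- The `λ`-product in the coordinates of the frame that defines the operators. -/
theorem isLambdaProduct_iff (hgeom : OMBounded e) (hμ : IsOMDensity e μ)
    (hψ : IsOMLinearization e ψ) (hl : l ∈ Set.Icc (0 : ℝ) 1)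
    (hsymm : l ∈ Set.Ioo (0 : ℝ) 1 → HypothesisHPsi ψ) (F : Frame n M) (a b c : SchwartzCot e) :
    IsLambdaProduct e ψ μ F l a b c ↔
      c.toCoord F = (quantData hμ hψ hl hsymm F).mul (a.toCoord F) (b.toCoord F) := by
  rw [← QuantData.eq_mul_iff]
  have hs : ∀ V : 𝓢(Coord n, ℂ), IsSchwartz e fun x => V (e.chart F x) :=
    isSchwartz_of_chart hgeom F
  have hs' : ∀ (V : 𝓢(Coord n, ℂ)) p,
      V p = (fun x => V (e.chart F x)) ((e.chart F).symm p) := fun V p =>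
    congrArg V ((e.chart F).apply_symm_apply p).symm
  constructor
  · intro h V
    obtain ⟨w, hw, h1, h2⟩ := h _ (hs V)
    obtain ⟨W, hW⟩ := hw F
    refine ⟨W, fun U => ?_, fun U => ?_⟩
    · exact (opPairing_eq_form hμ hψ hl hsymm F b (hs' V) (hs' U)).symm.trans
        ((h1 _ (hs U)).trans (pairing_eq hμ F hW (hs' U)))
    · exact (opPairing_eq_form hμ hψ hl hsymm F c (hs' V) (hs' U)).symm.trans
        ((h2 _ (hs U)).trans (opPairing_eq_form hμ hψ hl hsymm F a hW (hs' U)))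
  · intro h v hv
    obtain ⟨V, hV⟩ := hv F
    obtain ⟨W, h1, h2⟩ := h V
    refine ⟨_, hs W, fun u hu => ?_, fun u hu => ?_⟩
    · obtain ⟨U, hU⟩ := hu F
      rw [opPairing_eq_form hμ hψ hl hsymm F b hV hU, h1, pairing_eq hμ F (hs' W) hU]
      rfl
    · obtain ⟨U, hU⟩ := hu F
      rw [opPairing_eq_form hμ hψ hl hsymm F c hV hU, h2,
        opPairing_eq_form hμ hψ hl hsymm F a (hs' W) hU]

theorem opPairing_eq_of_frame (hμ : IsOMDensity e μ) (F F' : Frame n M) :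
    opPairing e ψ μ F l = opPairing e ψ μ F' l := by
  have h : fourier e μ F = fourier e μ F' := by
    funext a w
    rw [fourier, fourier, Density.tan_eq F F' hμ]
  funext a v u
  simp only [opPairing, h, Density.vol_eq F F' hμ, Density.cot_eq F F' hμ]

theorem isLambdaProduct_frame_iff (hμ : IsOMDensity e μ) (F F' : Frame n M)
    (a b c : CotBundle n M → ℂ) :
    IsLambdaProduct e ψ μ F l a b c ↔ IsLambdaProduct e ψ μ F' l a b c := by
  simp only [IsLambdaProduct, pairing, opPairing_eq_of_frame hμ F F', Density.vol_eq F F' hμ]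

/-- The `λ`-product, computed in the coordinates of a frame. -/
def lambdaMul (hgeom : OMBounded e) (hμ : IsOMDensity e μ)
    (hψ : IsOMLinearization e ψ) (hl : l ∈ Set.Icc (0 : ℝ) 1)
    (hsymm : l ∈ Set.Ioo (0 : ℝ) 1 → HypothesisHPsi ψ) (F : Frame n M) :
    SchwartzCot e →ₗ[ℂ] SchwartzCot e →ₗ[ℂ] SchwartzCot e :=
  ((quantData hμ hψ hl hsymm F).mul.compl₁₂
    (coordEquiv hgeom F : SchwartzCot e →ₗ[ℂ] 𝓢(Coord n × Coord n, ℂ))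
    (coordEquiv hgeom F : SchwartzCot e →ₗ[ℂ] 𝓢(Coord n × Coord n, ℂ))).compr₂
    ((coordEquiv hgeom F).symm : 𝓢(Coord n × Coord n, ℂ) →ₗ[ℂ] SchwartzCot e)

section

variable (hgeom : OMBounded e) (hμ : IsOMDensity e μ)
    (hψ : IsOMLinearization e ψ) (hl : l ∈ Set.Icc (0 : ℝ) 1)
    (hsymm : l ∈ Set.Ioo (0 : ℝ) 1 → HypothesisHPsi ψ) (F : Frame n M)

omit [MeasurableSpace M] [BorelSpace M] in
theorem coordEquiv_lambdaMul (a b : SchwartzCot e) :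
    coordEquiv hgeom F (lambdaMul hgeom hμ hψ hl hsymm F a b) =
      (quantData hμ hψ hl hsymm F).mul (coordEquiv hgeom F a) (coordEquiv hgeom F b) :=
  (coordEquiv hgeom F).apply_symm_apply _

/-- The product computed in the frame `F` is the `λ`-product in every frame `F'`. -/
theorem isLambdaProduct_iff_eq_lambdaMul (F' : Frame n M) (a b c : SchwartzCot e) :
    IsLambdaProduct e ψ μ F' l a b c ↔ c = lambdaMul hgeom hμ hψ hl hsymm F a b := by
  rw [isLambdaProduct_frame_iff hμ F' F, isLambdaProduct_iff hgeom hμ hψ hl hsymm,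
    ← (coordEquiv hgeom F).injective.eq_iff, coordEquiv_lambdaMul]
  rfl

theorem toCoord_lambdaMul (F' : Frame n M) (a b : SchwartzCot e) :
    (lambdaMul hgeom hμ hψ hl hsymm F a b).toCoord F' =
      (quantData hμ hψ hl hsymm F').mul (a.toCoord F') (b.toCoord F') := by
  rw [← isLambdaProduct_iff hgeom hμ hψ hl hsymm,
    isLambdaProduct_iff_eq_lambdaMul hgeom hμ hψ hl hsymm F]

omit [MeasurableSpace M] [BorelSpace M]

theorem lambdaMul_assoc (a b c : SchwartzCot e) :
    lambdaMul hgeom hμ hψ hl hsymm F (lambdaMul hgeom hμ hψ hl hsymm F a b) c =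
      lambdaMul hgeom hμ hψ hl hsymm F a (lambdaMul hgeom hμ hψ hl hsymm F b c) := by
  apply (coordEquiv hgeom F).injective
  simp only [coordEquiv_lambdaMul]
  exact QuantData.mul_assoc _ _ _ _

theorem continuous_lambdaMul : Continuous fun p : SchwartzCot e × SchwartzCot e =>
    lambdaMul hgeom hμ hψ hl hsymm F p.1 p.2 := by
  have hc := (isUniformInducing_coordEquiv hgeom F).uniformContinuous.continuous
  have h := (hc.comp continuous_fst).prodMk (hc.comp continuous_snd)
  have h1 := (quantData hμ hψ hl hsymm F).continuous_mul
  have h2 := h1.comp h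
  refine (isUniformInducing_coordEquiv hgeom F).isInducing.continuous_iff.2 ?_
  refine h2.congr fun p => ?_
  exact (coordEquiv_lambdaMul hgeom hμ hψ hl hsymm F p.1 p.2).symm

theorem exists_lambdaMul_ne [Nontrivial (Coord n)] : ∃ a b : SchwartzCot e,
    lambdaMul hgeom hμ hψ hl hsymm F a b ≠ lambdaMul hgeom hμ hψ hl hsymm F b a := by
  obtain ⟨A, B, h⟩ := (quantData hμ hψ hl hsymm F).exists_mul_ne
  refine ⟨(coordEquiv hgeom F).symm A, (coordEquiv hgeom F).symm B, fun h' => h ?_⟩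
  have := congrArg (coordEquiv hgeom F) h'
  simpa only [coordEquiv_lambdaMul, LinearEquiv.apply_symm_apply] using this

theorem not_exists_lambdaMul_unit [Nontrivial (Coord n)] : ¬ ∃ u : SchwartzCot e,
    ∀ a, lambdaMul hgeom hμ hψ hl hsymm F u a = a ∧ lambdaMul hgeom hμ hψ hl hsymm F a u = a := by
  rintro ⟨u, hu⟩
  refine (quantData hμ hψ hl hsymm F).not_exists_left_unit ⟨coordEquiv hgeom F u, fun A => ?_⟩
  have := congrArg (coordEquiv hgeom F) (hu ((coordEquiv hgeom F).symm A)).1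
  simpa only [coordEquiv_lambdaMul, LinearEquiv.apply_symm_apply] using this

end
end Product

/-! ### The integral formula for the product -/

section Formula

open scoped ComplexConjugate FourierTransform RealInnerProductSpace

variable {n : ℕ} {M : Type*} [TopologicalSpace M] [ChartedSpace (Coord n) M]
  [IsManifold 𝓘(ℝ, Coord n) ∞ M]
  {e : AbstractExp n M} {μ : Density n M} {ψ : AbstractExp n M} {l : ℝ}

instance instSFiniteCot (F : Frame n M) (x : M) : SFinite (μ.cot e F x) := by
  unfold Density.cot; infer_instance

theorem phiCoord_tanChart (F : Frame n M) (w : TanBundle n M) :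
    PhiCoord e ψ F l (e.tanChart F w) =
      (e.chart F (Phi ψ l w).1, e.chart F (Phi ψ l w).2) := by
  rw [PhiCoord, tanChartInv_tanChart]

/-- The Fourier inversion integral of a symbol over a cotangent fiber. -/
theorem integral_cot_exp_mul (hμ : IsOMDensity e μ) (F : Frame n M) (a : SchwartzCot e)
    (w : TanBundle n M) :
    Integrable (fun θ : CotSpace n w.1 =>
      Complex.exp (2 * Real.pi * Complex.I * (θ w.2 : ℝ)) * a ⟨w.1, θ⟩) (μ.cot e F w.1) ∧
    ∫ θ : CotSpace n w.1, Complex.exp (2 * Real.pi * Complex.I * (θ w.2 : ℝ)) * a ⟨w.1, θ⟩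
      ∂(μ.cot e F w.1) = ((μ.coord e F (e.chart F w.1))⁻¹ : ℝ) *
        partialFourierInv (a.toCoord F) (e.tanChart F w) := by
  have h : ∀ ϑ : Coord n, Complex.exp (2 * Real.pi * Complex.I *
      (e.cotCoordInv F w.1 ϑ w.2 : ℝ)) * a ⟨w.1, e.cotCoordInv F w.1 ϑ⟩ =
      𝐞 ⟪ϑ, (e.tanChart F w).2⟫ • slice (e.tanChart F w).1 (a.toCoord F) ϑ := fun ϑ => by
    rw [fourierChar_smul_eq, slice_apply, toCoord_apply]
    exact congrArg _ (congrArg a (cotChartInv_chart F w.1 ϑ).symm)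
  constructor
  · rw [integrable_cot_iff hμ]
    simp_rw [h, Circle.smul_def, smul_eq_mul]
    have hc : Continuous fun ϑ : Coord n =>
      ((𝐞 ⟪ϑ, (e.tanChart F w).2⟫ : Circle) : ℂ) := by fun_prop
    exact (slice (e.tanChart F w).1 (a.toCoord F)).integrable.bdd_mul hc.aestronglyMeasurable
      (Filter.Eventually.of_forall fun ϑ => (Circle.norm_coe _).le)
  · rw [integral_cot hμ, partialFourierInv_apply]
    simp_rw [h]
    rw [SchwartzMap.fourierInv_coe, Real.fourierInv_eq]

variable (hμ : IsOMDensity e μ) (hψ : IsOMLinearization e ψ) (hl : l ∈ Set.Icc (0 : ℝ) 1)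
  (hsymm : l ∈ Set.Ioo (0 : ℝ) 1 → HypothesisHPsi ψ)

/-- `μ_λ` is the inverse of the density times the weight of the kernel, at `Φ_λ⁻¹(x, y)`. -/
theorem muLambda_eq (F : Frame n M) (x y : M) : muLambda e ψ μ F l x y =
    (μ.coord e F (e.tanChart F (PhiInv ψ l x y)).1 *
      (quantData hμ hψ hl hsymm F).weight (e.tanChart F (PhiInv ψ l x y)))⁻¹ := by
  have h1 : (quantData hμ hψ hl hsymm F).Φ (e.tanChart F (PhiInv ψ l x y)) =
      (e.chart F x, e.chart F y) := by
    refine (phiCoord_tanChart F _).trans ?_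
    rw [phi_phiInv hl hsymm]
  have hx := ((hμ F).1 (e.chart F x)).ne'
  have hy := ((hμ F).1 (e.chart F y)).ne'
  have hm := ((hμ F).1 (e.tanChart F (PhiInv ψ l x y)).1).ne'
  have hj := ((quantData hμ hψ hl hsymm F).jac_pos (e.tanChart F (PhiInv ψ l x y))).ne'
  rw [QuantData.weight, h1]
  change μ.coord e F (e.chart F x) * μ.coord e F (e.chart F y) /
    μ.coord e F (e.tanChart F (PhiInv ψ l x y)).1 ^ 2 *
    (quantData hμ hψ hl hsymm F).jac (e.tanChart F (PhiInv ψ l x y)) =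
    (μ.coord e F (e.tanChart F (PhiInv ψ l x y)).1 *
      (μ.coord e F (e.tanChart F (PhiInv ψ l x y)).1 /
      ((quantData hμ hψ hl hsymm F).jac (e.tanChart F (PhiInv ψ l x y)) *
      (μ.coord e F (e.chart F x) * μ.coord e F (e.chart F y)))))⁻¹
  field_simp

/-- The kernel of a symbol at a pair of points of `M`. -/
theorem toKernel_chart (F : Frame n M) (A : 𝓢(Coord n × Coord n, ℂ)) (x y : M) :
    (quantData hμ hψ hl hsymm F).toKernel A (e.chart F x, e.chart F y) =
      (quantData hμ hψ hl hsymm F).weight (e.tanChart F (PhiInv ψ l x y)) *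
        partialFourierInv A (e.tanChart F (PhiInv ψ l x y)) := by
  have h : (quantData hμ hψ hl hsymm F).Ψ (e.chart F x, e.chart F y) =
      e.tanChart F (PhiInv ψ l x y) := by
    change phiInvCoord e F ψ l _ = _
    simp only [phiInvCoord, Diffeomorph.symm_apply_apply]
  rw [QuantData.toKernel_apply, h]

include hl hsymm in
/-- The point and vector at which the second symbol is evaluated are, up to the sign of the vector,
given by `Φ_λ⁻¹`. -/
theorem yPoint_one_sub (x : M) (ξ : TanSpace n x) (y : M) :
    (⟨(yPoint ψ (1 - l) x (-ξ) y).1, -(yPoint ψ (1 - l) x (-ξ) y).2⟩ : TanBundle n M) =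
      PhiInv ψ l y (ψ.toFun ⟨x, (l - 1) • ξ⟩) := by
  have h : (1 - l) • (-ξ) = (l - 1) • ξ := by rw [smul_neg, ← neg_smul, neg_sub]
  rw [yPoint, h, phiInv_one_sub hl hsymm, neg_neg]

/-- The inner integral of the product formula splits into two Fourier inversion integrals. -/
theorem integrable_fiberIntegrand (hμ : IsOMDensity e μ) (F : Frame n M) (a b : SchwartzCot e)
    (x : M) (η : CotSpace n x) (ξ : TanSpace n x) (y : M) :
    Integrable (fiberIntegrand e ψ μ F l a b x η ξ y) (fiberMeasure e ψ μ F l x ξ y) ∧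
    ∫ t, fiberIntegrand e ψ μ F l a b x η ξ y t ∂(fiberMeasure e ψ μ F l x ξ y) =
      (gFactor e ψ μ F l x ξ y : ℂ) * Complex.exp (2 * Real.pi * Complex.I * (-(η ξ) : ℝ)) *
        ((((μ.coord e F (e.tanChart F (yPoint ψ l x ξ y)).1)⁻¹ : ℝ) *
          partialFourierInv (a.toCoord F) (e.tanChart F (yPoint ψ l x ξ y))) *
        (((μ.coord e F (e.chart F (yPoint ψ (1 - l) x (-ξ) y).1))⁻¹ : ℝ) *
          partialFourierInv (b.toCoord F) (e.tanChart F
            ⟨(yPoint ψ (1 - l) x (-ξ) y).1, -(yPoint ψ (1 - l) x (-ξ) y).2⟩))) := by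
  obtain ⟨i1, e1⟩ := integral_cot_exp_mul hμ F a (yPoint ψ l x ξ y)
  obtain ⟨i2, e2⟩ := integral_cot_exp_mul hμ F b
    ⟨(yPoint ψ (1 - l) x (-ξ) y).1, -(yPoint ψ (1 - l) x (-ξ) y).2⟩
  have hfun : fiberIntegrand e ψ μ F l a b x η ξ y = fun t =>
      ((gFactor e ψ μ F l x ξ y : ℂ) *
        Complex.exp (2 * Real.pi * Complex.I * (-(η ξ) : ℝ))) *
      ((Complex.exp (2 * Real.pi * Complex.I * (t.1 (yPoint ψ l x ξ y).2 : ℝ)) *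
        a ⟨(yPoint ψ l x ξ y).1, t.1⟩) *
      (Complex.exp (2 * Real.pi * Complex.I *
        (t.2 (-(yPoint ψ (1 - l) x (-ξ) y).2) : ℝ)) *
        b ⟨(yPoint ψ (1 - l) x (-ξ) y).1, t.2⟩)) := by
    funext t
    have hexp : Complex.exp (2 * Real.pi * Complex.I *
        (phase ψ l x η ξ y t.1 t.2 : ℝ)) =
        Complex.exp (2 * Real.pi * Complex.I * (-(η ξ) : ℝ)) *
        (Complex.exp (2 * Real.pi * Complex.I * (t.1 (yPoint ψ l x ξ y).2 : ℝ)) *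
        Complex.exp (2 * Real.pi * Complex.I *
        (t.2 (-(yPoint ψ (1 - l) x (-ξ) y).2) : ℝ))) := by
      rw [← Complex.exp_add, ← Complex.exp_add, phase, map_neg]
      congr 1
      push_cast
      ring
    rw [fiberIntegrand, hexp]
    ring
  rw [hfun]
  constructor
  · exact (i1.mul_prod i2).const_mul _
  · rw [integral_const_mul, fiberMeasure]
    congr 1
    refine Eq.trans ?_ (congrArg₂ (· * ·) e1 e2)
    exact integral_prod_mul (μ := μ.cot e F (yPoint ψ l x ξ y).1)
      (ν := μ.cot e F (yPoint ψ (1 - l) x (-ξ) y).1)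
      (fun θ => Complex.exp (2 * Real.pi * Complex.I * (θ (yPoint ψ l x ξ y).2 : ℝ)) *
        a ⟨(yPoint ψ l x ξ y).1, θ⟩)
      (fun θ => Complex.exp (2 * Real.pi * Complex.I *
        (θ (-(yPoint ψ (1 - l) x (-ξ) y).2) : ℝ)) * b ⟨(yPoint ψ (1 - l) x (-ξ) y).1, θ⟩)

/-- The inner integral of the product formula is, up to the densities, the integrand of the
composition of the kernels. -/
theorem integral_fiberIntegrand (F : Frame n M) (a b : SchwartzCot e)
    (x : M) (η : CotSpace n x) (ξ : TanSpace n x) (y : M) :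
    (μ.coord e F (e.chart F x) : ℂ) * (μ.coord e F (e.chart F y) *
      ∫ t, fiberIntegrand e ψ μ F l a b x η ξ y t ∂(fiberMeasure e ψ μ F l x ξ y)) =
    (quantData hμ hψ hl hsymm F).mulIntegrand (a.toCoord F) (b.toCoord F)
      (cotChart e F ⟨x, η⟩) (e.tanCoord F x ξ, e.chart F y) := by
  set D := quantData hμ hψ hl hsymm F with hD
  have hp : (l - 1) • ξ = (-(1 - l)) • ξ := by rw [neg_sub]
  have h1 : PhiInv ψ l (ψ.toFun ⟨x, l • ξ⟩) (ψ.toFun ⟨x, (l - 1) • ξ⟩) = ⟨x, ξ⟩ := by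
    rw [hp]
    exact phiInv_phi hl hsymm ⟨x, ξ⟩
  have h2 : D.Φ (e.chart F x, e.tanCoord F x ξ) =
      (e.chart F (ψ.toFun ⟨x, l • ξ⟩), e.chart F (ψ.toFun ⟨x, (l - 1) • ξ⟩)) := by
    rw [hp]
    exact phiCoord_tanChart F ⟨x, ξ⟩
  have h3 : ⟪e.tanCoord F x ξ, (cotChart e F ⟨x, η⟩).2⟫ = η ξ := by
    rw [real_inner_comm]
    exact DFunLike.congr_fun (cotCoordInv_toDual_symm F x η) ξ
  have hq : e.chart F (yPoint ψ (1 - l) x (-ξ) y).1 =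
      (e.tanChart F (PhiInv ψ l y (ψ.toFun ⟨x, (l - 1) • ξ⟩))).1 := by
    have h := congrArg (fun w : TanBundle n M => e.chart F w.1) (yPoint_one_sub hl hsymm x ξ y)
    exact h
  have hm : ∀ p, (μ.coord e F p : ℂ) ≠ 0 := fun p => by exact_mod_cast ((hμ F).1 p).ne'
  have hw : ∀ q, (D.weight q : ℂ) ≠ 0 := fun q => by exact_mod_cast (D.weight_pos q).ne'
  rw [(integrable_fiberIntegrand hμ F a b x η ξ y).2, yPoint_one_sub hl hsymm, hq, gFactor,
    muLambda_eq hμ hψ hl hsymm, muLambda_eq hμ hψ hl hsymm, muLambda_eq hμ hψ hl hsymm, h1,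
    ← hD, QuantData.mulIntegrand, fourierChar_smul_eq, h3]
  change _ = _ * (((D.weight (e.chart F x, e.tanCoord F x ξ))⁻¹ : ℝ) *
    ((μ.coord e F (e.chart F y)) * (D.toKernel (a.toCoord F) ((D.Φ (e.chart F x, e.tanCoord F x ξ)).1, e.chart F y) *
      D.toKernel (b.toCoord F) (e.chart F y, (D.Φ (e.chart F x, e.tanCoord F x ξ)).2))))
  rw [h2, hD, toKernel_chart, toKernel_chart, ← hD, yPoint, tanChart_mk]
  generalize e.tanChart F (PhiInv ψ l (ψ.toFun ⟨x, l • ξ⟩) y) = q1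
  generalize e.tanChart F (PhiInv ψ l y (ψ.toFun ⟨x, (l - 1) • ξ⟩)) = q2
  have := hm q1.1
  have := hm q2.1
  have := hm (e.chart F x)
  have := hw q1
  have := hw q2
  have := hw (e.chart F x, e.tanCoord F x ξ)
  push_cast
  field_simp

variable [MeasurableSpace M] [BorelSpace M]

/-- The measure `dμ_x(ξ) dμ(y)` in coordinates. -/
theorem tan_prod_vol (hμ : IsOMDensity e μ) (F : Frame n M) (x : M) :
    (μ.tan e F x).prod (μ.vol e F) = ENNReal.ofReal (μ.coord e F (e.chart F x)) •
      ((volume : Measure (Coord n × Coord n)).withDensity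
        fun w => ENNReal.ofReal (μ.coord e F w.2)).map
        (Prod.map (e.tanCoord F x).symm (e.chart F).symm) := by
  rw [Density.tan, Density.vol, Measure.prod_smul_left,
    Measure.map_prod_map _ _ (measurableEmbedding_tanCoord_symm F x).measurable
      (measurable_chart_symm e F), prod_withDensity_right (measurable_ofReal_coord hμ F)]
  rfl

theorem measurableEmbedding_prodMap (F : Frame n M) (x : M) :
    MeasurableEmbedding (Prod.map (e.tanCoord F x).symm (e.chart F).symm) :=
  (measurableEmbedding_tanCoord_symm F x).prodMap (measurableEmbedding_chart_symm F)

omit [MeasurableSpace M] [BorelSpace M] in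
theorem measurable_ofReal_coord_snd (hμ : IsOMDensity e μ) (F : Frame n M) :
    Measurable fun w : Coord n × Coord n => ENNReal.ofReal (μ.coord e F w.2) :=
  (measurable_ofReal_coord hμ F).comp measurable_snd

theorem integral_tan_prod_vol (hμ : IsOMDensity e μ) (F : Frame n M) (x : M)
    (g : TanSpace n x × M → ℂ) :
    ∫ p, g p ∂((μ.tan e F x).prod (μ.vol e F)) = ∫ w : Coord n × Coord n,
      (μ.coord e F (e.chart F x) : ℂ) * (μ.coord e F w.2 *
        g ((e.tanCoord F x).symm w.1, (e.chart F).symm w.2)) := by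
  rw [tan_prod_vol hμ, integral_smul_measure, (measurableEmbedding_prodMap F x).integral_map,
    integral_withDensity_eq_integral_toReal_smul
      (measurable_ofReal_coord_snd hμ F)
      (Filter.Eventually.of_forall fun _ => ENNReal.ofReal_lt_top),
    ENNReal.toReal_ofReal ((hμ F).1 _).le, Complex.real_smul, ← integral_const_mul]
  congr 1; ext w
  rw [ENNReal.toReal_ofReal ((hμ F).1 _).le, Complex.real_smul]
  rfl

theorem integrable_tan_prod_vol_iff (hμ : IsOMDensity e μ) (F : Frame n M) (x : M)
    {g : TanSpace n x × M → ℂ} :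
    Integrable g ((μ.tan e F x).prod (μ.vol e F)) ↔ Integrable fun w : Coord n × Coord n =>
      (μ.coord e F (e.chart F x) : ℂ) * (μ.coord e F w.2 *
        g ((e.tanCoord F x).symm w.1, (e.chart F).symm w.2)) := by
  have hm : (μ.coord e F (e.chart F x) : ℂ) ≠ 0 := by exact_mod_cast ((hμ F).1 _).ne'
  rw [tan_prod_vol hμ, integrable_smul_measure (ENNReal.ofReal_pos.2 ((hμ F).1 _)).ne'
    ENNReal.ofReal_ne_top, (measurableEmbedding_prodMap F x).integrable_map_iff,
    integrable_withDensity_iff_integrable_smul'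
      (measurable_ofReal_coord_snd hμ F)
      (Filter.Eventually.of_forall fun _ => ENNReal.ofReal_lt_top),
    integrable_const_mul_iff hm.isUnit]
  refine integrable_congr (Filter.Eventually.of_forall fun w => ?_)
  simp only [Function.comp_apply]
  rw [ENNReal.toReal_ofReal ((hμ F).1 _).le, Complex.real_smul]
  rfl

omit [MeasurableSpace M] [BorelSpace M] in
/-- The integrand of the product formula, in coordinates. -/
theorem fiberIntegrand_coord (F : Frame n M) (a b : SchwartzCot e)
    (x : M) (η : CotSpace n x) : (fun w : Coord n × Coord n =>
      (μ.coord e F (e.chart F x) : ℂ) * (μ.coord e F w.2 *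
      ∫ t, fiberIntegrand e ψ μ F l a b x η ((e.tanCoord F x).symm w.1) ((e.chart F).symm w.2) t
        ∂(fiberMeasure e ψ μ F l x ((e.tanCoord F x).symm w.1) ((e.chart F).symm w.2)))) =
    (quantData hμ hψ hl hsymm F).mulIntegrand (a.toCoord F) (b.toCoord F)
      (cotChart e F ⟨x, η⟩) := by
  funext w
  have h := integral_fiberIntegrand hμ hψ hl hsymm F a b x η ((e.tanCoord F x).symm w.1)
    ((e.chart F).symm w.2)
  rw [Diffeomorph.apply_symm_apply] at h
  refine h.trans (congrArg (fun ζ => QuantData.mulIntegrand _ _ _ _ (ζ, w.2)) ?_)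
  exact (e.tanCoord F x).apply_symm_apply w.1

end Formula
end ExpMan

end

open ExpMan
theorem proposition3p11 {n : ℕ} (hn : 0 < n) {M : Type*} [TopologicalSpace M]
    [ChartedSpace (Coord n) M] [IsManifold 𝓘(ℝ, Coord n) ∞ M] [MeasurableSpace M] [BorelSpace M]
    [Nonempty M]
    (e : AbstractExp n M) (μ : Density n M) (ψ : AbstractExp n M)
    (hgeom : OMBounded e) (hμ : IsOMDensity e μ) (hψ : IsOMLinearization e ψ)
    (l : ℝ) (hl : l ∈ Set.Icc (0 : ℝ) 1) (hsymm : l ∈ Set.Ioo (0 : ℝ) 1 → HypothesisHPsi ψ) :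
    IsFrechetSpace (SchwartzCot e) ∧
    ∃ mul : SchwartzCot e →ₗ[ℂ] SchwartzCot e →ₗ[ℂ] SchwartzCot e,
      -- `mul` is the `λ`-product, transported from the composition of operators
      (∀ (F : Frame n M) (a b c : SchwartzCot e),
        IsLambdaProduct e ψ μ F l a b c ↔ c = mul a b) ∧
      -- it makes `𝒮(T^*M)` a noncommutative nonunital Fréchet algebra
      (∀ a b c : SchwartzCot e, mul (mul a b) c = mul a (mul b c)) ∧
      Continuous (fun p : SchwartzCot e × SchwartzCot e => mul p.1 p.2) ∧
      (∃ a b : SchwartzCot e, mul a b ≠ mul b a) ∧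
      (¬ ∃ u : SchwartzCot e, ∀ a : SchwartzCot e, mul u a = a ∧ mul a u = a) ∧
      -- the integral formula, in every normal frame, with convergent integrals
      (∀ (F : Frame n M) (a b : SchwartzCot e) (x : M) (η : CotSpace n x),
        (∀ (ξ : TanSpace n x) (y : M),
          Integrable (fiberIntegrand e ψ μ F l a b x η ξ y) (fiberMeasure e ψ μ F l x ξ y)) ∧
        Integrable (fun p : TanSpace n x × M =>
            ∫ t, fiberIntegrand e ψ μ F l a b x η p.1 p.2 t ∂(fiberMeasure e ψ μ F l x p.1 p.2))
          ((μ.tan e F x).prod (μ.vol e F)) ∧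
        (mul a b) ⟨x, η⟩ =
          ∫ p : TanSpace n x × M,
            (∫ t, fiberIntegrand e ψ μ F l a b x η p.1 p.2 t
              ∂(fiberMeasure e ψ μ F l x p.1 p.2))
            ∂((μ.tan e F x).prod (μ.vol e F))) := by
  obtain ⟨z⟩ := ‹Nonempty M›
  let F₀ : Frame n M := ⟨z, ContinuousLinearEquiv.refl ℝ (Coord n)⟩
  have : Nonempty (Fin n) := ⟨⟨0, hn⟩⟩
  have : Nontrivial (Coord n) := inferInstance
  refine ⟨isFrechetSpace_schwartzCot hgeom F₀, lambdaMul hgeom hμ hψ hl hsymm F₀,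
    isLambdaProduct_iff_eq_lambdaMul hgeom hμ hψ hl hsymm F₀,
    lambdaMul_assoc hgeom hμ hψ hl hsymm F₀, continuous_lambdaMul hgeom hμ hψ hl hsymm F₀,
    exists_lambdaMul_ne hgeom hμ hψ hl hsymm F₀,
    not_exists_lambdaMul_unit hgeom hμ hψ hl hsymm F₀, fun F a b x η =>
    ⟨fun ξ y => (integrable_fiberIntegrand hμ F a b x η ξ y).1, ?_, ?_⟩⟩
  · rw [integrable_tan_prod_vol_iff hμ, fiberIntegrand_coord hμ hψ hl hsymm]
    exact QuantData.integrable_mulIntegrand _ _ _ _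
  · rw [integral_tan_prod_vol hμ, fiberIntegrand_coord hμ hψ hl hsymm,
      ← QuantData.mul_eq_integral, ← toCoord_lambdaMul hgeom hμ hψ hl hsymm F₀]
    exact apply_eq_toCoord F _ ⟨x, η⟩
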